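/- Let $k\ge 1$ and let $G_N=\frac1{\sqrt N}G$, where $G$ is an $N\times N$ matrix of i.i.d. standard complex normal random variables (mean $0$, $\mathbb E|G_{ij}|^2=1$, independent real and imaginary parts of variance $\tfrac12$). Fix $z\in\mathbb C$ with $|z|=1$ and vectors $\vec u,\vec v\in\mathbb C^k$ (repeated entries allowed), and set $$x_j=z-\frac{u_j}{\overline z\sqrt N},\qquad \overline{y_j}=\overline z-\frac{\overline{v_j}}{z\sqrt N},\qquad j=1,\dots,k .$$ For $t\in(0,1)$, $a,b\in\mathbb C$, $\vec a,\vec b\in\mathbb C^k$ and $E\subseteq\mathbb R$ measurable let $$p_t(a,b)=\frac{1}{\sqrt{2\pi t}}e^{-(a-b)^2/(2t)},\qquad \mathcal Z_t(\vec a,\vec b,E)=\int_{E^k}\det\{p_t(a_i,s_j)\}_{i,j=1}^k\,\det\{p_{1-t}(s_i,b_j)\}_{i,j=1}^k\,d\vec s .$$ For vectors $\vec u,\vec v$ that each have pairwise distinct entries put $$F_k^{(\mathrm{edge})}(\vec u,\vec v)=\frac{\mathcal Z_{1/2}(\vec u,\overline{\vec v},\mathbb R_+)}{\prod_{1\le i<j\le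 k}(u_j-u_i)(\overline{v_j}-\overline{v_i})},\qquad \mathbb R_+=(0,\infty),$$ and if $\vec u$ or $\vec v$ has repeated entries let $F_k^{(\mathrm{edge})}(\vec u,\vec v)$ be the limit of this ratio as pairs of vectors, each with pairwise distinct entries, tend to $(\vec u,\vec v)$. Then the integral defining $\mathcal Z_{1/2}(\vec u,\overline{\vec v},\mathbb R_+)$ converges absolutely, this limit exists (and at pairs without repeated entries it equals the ratio itself), the expectation below is absolutely convergent for every $N$, and as $N\to\infty$ $$\mathbb E\Big(\prod_{j=1}^k\det(G_N-x_j)\det(G_N^\dagger-\overline{y_j})\Big)=\exp\Big(-\sum_{j=1}^k\Big(\sqrt N(u_j+\overline{v_j})-\frac{u_j^2+\overline{v_j}^2}{2}\Big)+\frac{k^2}{2}\log N\Big)\,\frac{(2\pi)^k}{k!}\,\Big(F_k^{(\mathrm{edge})}(\vec u,\vec v)+o(1)\Big).$$ In particular, whenever $F_k^{(\mathrm{edge})}(\vec u,\vec v)\neq0$, the last factor may be written as $F_k^{(\mathrm{edge})}(\vec u,\vec v)\,(1+o(1))$. -/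

import Mathlib

open MeasureTheory Filter Topology
open scoped ComplexConjugate

noncomputable section

/-- The standard complex normal law: the law of `X + i Y` with `X`, `Y` independent real centred
Gaussians of variance `1/2`, so that `E |X + i Y|^2 = 1`. -/
def stdComplexGaussian : Measure ℂ :=
  ((ProbabilityTheory.gaussianReal 0 (1 / 2)).prod
    (ProbabilityTheory.gaussianReal 0 (1 / 2))).map (fun p : ℝ × ℝ => (⟨p.1, p.2⟩ : ℂ))

/-- The law of the array of entries of an `N × N` matrix with i.i.d. standard complex normal
entries. -/
def gaussianEntries (N : ℕ) : Measure (Fin N → Fin N → ℂ) :=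
  Measure.pi fun _ => Measure.pi fun _ => stdComplexGaussian

/-- The normalised Ginibre matrix `G_N = G / √N` built from the array `g` of entries. -/
def ginibreMatrix (N : ℕ) (g : Fin N → Fin N → ℂ) : Matrix (Fin N) (Fin N) ℂ :=
  ((Real.sqrt N : ℂ)⁻¹) • Matrix.of g

/-- `∏_j det (G_N - x_j) det (G_N^† - conj y_j)` as a function of the entries. -/
def charPolyProduct (N : ℕ) {k : ℕ} (x y : Fin k → ℂ) (g : Fin N → Fin N → ℂ) : ℂ :=
  ∏ j, (ginibreMatrix N g - Matrix.scalar (Fin N) (x j)).det *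
    ((ginibreMatrix N g).conjTranspose - Matrix.scalar (Fin N) (conj (y j))).det

/-- `E (∏_j det (G_N - x_j) det (G_N^† - conj y_j))`. -/
def charPolyCorrelation (N : ℕ) {k : ℕ} (x y : Fin k → ℂ) : ℂ :=
  ∫ g, charPolyProduct N x y g ∂(gaussianEntries N)

/-- The edge scaling `z - w / (conj z √N)`; for `x_j` take `w = u_j`, for `y_j` take `w = v_j`
(so that `conj y_j = conj z - conj v_j / (z √N)`). -/
def edgePoint (z : ℂ) (N : ℕ) (w : ℂ) : ℂ := z - w / (conj z * (Real.sqrt N : ℂ))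

/-- The Brownian transition density `p_t(u, v)`, continued to complex `u`, `v`. -/
def brownianDensity (t : ℝ) (u v : ℂ) : ℂ :=
  1 / (Real.sqrt (2 * Real.pi * t) : ℂ) * Complex.exp (-(u - v) ^ 2 / (2 * (t : ℂ)))

/-- The integrand of the Karlin–McGregor formula. -/
def karlinMcGregorIntegrand {k : ℕ} (t : ℝ) (u v : Fin k → ℂ) (s : Fin k → ℝ) : ℂ :=
  (Matrix.of fun i j => brownianDensity t (u i) (s j : ℂ)).det *
    (Matrix.of fun i j => brownianDensity (1 - t) (s i : ℂ) (v j)).det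

/-- The Karlin–McGregor quantity `𝒵_t(u, v, E)`, an integral over `E^k`. -/
def karlinMcGregor {k : ℕ} (t : ℝ) (u v : Fin k → ℂ) (E : Set ℝ) : ℂ :=
  ∫ s in {s : Fin k → ℝ | ∀ i, s i ∈ E}, karlinMcGregorIntegrand t u v s

/-- `𝒵_{1/2}(u, conj v, ℝ₊)` divided by `∏_{i<j} (u_j - u_i)(conj v_j - conj v_i)`; meaningful
when `u` and `v` each have pairwise distinct entries. -/
def edgeRatio {k : ℕ} (u v : Fin k → ℂ) : ℂ :=
  karlinMcGregor (1 / 2) u (fun j => conj (v j)) (Set.Ioi 0) /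
    ∏ i, ∏ j ∈ Finset.Ioi i, (u j - u i) * (conj (v j) - conj (v i))

/-- Pairs of vectors without degeneracies. -/
def nondegeneratePairs (k : ℕ) : Set ((Fin k → ℂ) × (Fin k → ℂ)) :=
  {p | Function.Injective p.1 ∧ Function.Injective p.2}

open scoped Classical in
/-- `F_k^{(edge)}(u, v)`: the ratio when there are no degeneracies, and otherwise the limit of the
ratio along nondegenerate pairs tending to `(u, v)`. -/
def edgeF {k : ℕ} (u v : Fin k → ℂ) : ℂ :=
  if (u, v) ∈ nondegeneratePairs k then edgeRatio u v
  else limUnder (𝓝[nondegeneratePairs k] (u, v)) (fun p => edgeRatio p.1 p.2)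

/-- The factor
`exp (-∑_j (√N (u_j + conj v_j) - (u_j^2 + (conj v_j)^2) / 2) + (k^2 / 2) log N)`. -/
def edgePrefactor (N : ℕ) {k : ℕ} (u v : Fin k → ℂ) : ℂ :=
  Complex.exp (-(∑ j, ((Real.sqrt N : ℂ) * (u j + conj (v j)) -
      ((u j) ^ 2 + (conj (v j)) ^ 2) / 2)) + (k : ℂ) ^ 2 / 2 * (Real.log N : ℂ))

end

/-!
By Gaussian integration by parts, `⟨f, h⟩ = 𝔼 f(G) h(Ḡ)` pairs multiplication by an entry with
differentiation. Hence multiplication by `det (1 - c G†)` is adjoint to an operator whose inverse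
averages over the rank-one perturbations `G + c ξ ξ†`, `ξ` a standard complex Gaussian vector;
formally this is `𝔼 exp (c ξ† M ξ) = det (1 - c M)⁻¹`. On
`Δ(x) ∏ⱼ det (xⱼ - G) = det (xᵢ ^ a χ_G(xᵢ))` that averaging acts as `∏ⱼ (1 - c ∂/∂xⱼ)`. Inverting
this operator by a geometric series and combining the factors by partial fractions gives the exact
formula
`Δ(x) Δ(ȳ) 𝔼 ∏ⱼ det (xⱼ - G) det (ȳⱼ - G†) = ∏_{b < k} (N + b)! det (e_{N + k - 1}(xᵢ ȳⱼ))`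
with `e_n` the `n`-th partial sum of the exponential series.

At the edge, writing `e_n` as an incomplete gamma integral, the rescaled kernel converges by
dominated convergence to a Gaussian integral over a half-line, and Andréief's identity turns the
determinant of the limit kernels into the Karlin–McGregor integral. This settles pairs without
repeated entries. The normalised correlations are entire in `(u, v̄)` and, by the maximum modulus
principle on a polydisc whose distinguished boundary keeps the Vandermonde products away from zero,
locally bounded uniformly in `N`; they are therefore equicontinuous, and convergence on the dense
set of nondegenerate pairs extends to all pairs.
-/

/-! ### Gaussian expectations of polynomials -/

instance : IsProbabilityMeasure stdComplexGaussian :=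
  Measure.isProbabilityMeasure_map
    (Complex.measurableEquivRealProd.symm.measurable :
      Measurable fun p : ℝ × ℝ => (⟨p.1, p.2⟩ : ℂ)).aemeasurable

theorem integral_stdComplexGaussian {f : ℂ → ℂ} (hf : Measurable f) :
    ∫ z, f z ∂stdComplexGaussian =
      ∫ z : ℂ, f z * ((Real.pi⁻¹ * Real.exp (-‖z‖ ^ 2) : ℝ) : ℂ) := by
  have hmk : Measurable fun p : ℝ × ℝ => (⟨p.1, p.2⟩ : ℂ) :=
    Complex.measurableEquivRealProd.symm.measurable
  have hdensity (p : ℝ × ℝ) :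
      (ProbabilityTheory.gaussianPDF 0 (1 / 2) p.1 *
        ProbabilityTheory.gaussianPDF 0 (1 / 2) p.2).toReal =
      Real.pi⁻¹ * Real.exp (-‖(⟨p.1, p.2⟩ : ℂ)‖ ^ 2) := by
    have hvar : 2 * Real.pi * ((1 / 2 : NNReal) : ℝ) = Real.pi := by push_cast; ring
    rw [ENNReal.toReal_mul, ProbabilityTheory.toReal_gaussianPDF,
      ProbabilityTheory.toReal_gaussianPDF, ProbabilityTheory.gaussianPDFReal,
      ProbabilityTheory.gaussianPDFReal, hvar, mul_mul_mul_comm, ← mul_inv,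
      Real.mul_self_sqrt Real.pi_pos.le, ← Real.exp_add, Complex.sq_norm, Complex.normSq_mk]
    congr 2
    push_cast
    ring
  rw [stdComplexGaussian, integral_map hmk.aemeasurable hf.aestronglyMeasurable,
    ProbabilityTheory.gaussianReal_of_var_ne_zero 0 (by norm_num),
    prod_withDensity (ProbabilityTheory.measurable_gaussianPDF _ _)
      (ProbabilityTheory.measurable_gaussianPDF _ _),
    integral_withDensity_eq_integral_toReal_smul (by fun_prop) (Eventually.of_forall fun _ =>
      ENNReal.mul_lt_top ProbabilityTheory.gaussianPDF_lt_top
        ProbabilityTheory.gaussianPDF_lt_top),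
    ← Complex.volume_preserving_equiv_real_prod.symm.integral_comp
      Complex.measurableEquivRealProd.symm.measurableEmbedding]
  refine integral_congr_ae (Eventually.of_forall fun p => ?_)
  simp only [hdensity, Complex.real_smul]
  exact mul_comm _ _

theorem integrable_norm_pow_stdComplexGaussian (m : ℕ) :
    Integrable (fun z : ℂ => ‖z‖ ^ m) stdComplexGaussian := by
  have hmk : Measurable fun p : ℝ × ℝ => (⟨p.1, p.2⟩ : ℂ) :=
    Complex.measurableEquivRealProd.symm.measurable
  have hid := ProbabilityTheory.memLp_id_gaussianReal (μ := 0) (v := 1 / 2) m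
  have hre := (hid.comp_measurePreserving (measurePreserving_fst
    (ν := ProbabilityTheory.gaussianReal 0 (1 / 2)))).ofReal (K := ℂ)
  have him := (hid.comp_measurePreserving (measurePreserving_snd
    (μ := ProbabilityTheory.gaussianReal 0 (1 / 2)))).ofReal (K := ℂ)
  rw [stdComplexGaussian, integrable_map_measure (by fun_prop) hmk.aemeasurable]
  refine (hre.add (him.mul_const Complex.I)).integrable_norm_pow'.congr
    (Eventually.of_forall fun p => ?_)
  simp only [Complex.mk_eq_add_mul_I]
  rfl

theorem integrable_pow_mul_conj_pow (a b : ℕ) :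
    Integrable (fun z : ℂ => z ^ a * conj z ^ b) stdComplexGaussian := by
  refine (integrable_norm_pow_stdComplexGaussian (a + b)).mono'
    (by fun_prop) (Eventually.of_forall fun z => ?_)
  simp [pow_add]

theorem integral_pow_mul_conj_pow_self (a : ℕ) :
    ∫ z : ℂ, z ^ a * conj z ^ a ∂stdComplexGaussian = a.factorial := by
  have hradial (z : ℂ) : z ^ a * conj z ^ a * ((Real.pi⁻¹ * Real.exp (-‖z‖ ^ 2) : ℝ) : ℂ) =
      ((Real.pi⁻¹ * (‖z‖ ^ (2 * a : ℝ) * Real.exp (-‖z‖ ^ (2 : ℝ))) : ℝ) : ℂ) := by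
    have hpow : ‖z‖ ^ (2 * a : ℝ) = (‖z‖ ^ 2) ^ a := by
      rw [← pow_mul, ← Real.rpow_natCast]; norm_num
    rw [← mul_pow, Complex.mul_conj, Complex.normSq_eq_norm_sq, hpow, Real.rpow_two]
    push_cast
    ring
  have hgamma := Complex.integral_rpow_mul_exp_neg_rpow (p := 2) (q := 2 * a) (by norm_num)
    (by linarith [(Nat.cast_nonneg a : (0 : ℝ) ≤ a)])
  rw [show (2 * (a : ℝ) + 2) / 2 = a + 1 by ring, Real.Gamma_nat_eq_factorial] at hgamma
  rw [integral_stdComplexGaussian (by fun_prop)]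
  simp_rw [hradial]
  rw [integral_complex_ofReal, integral_const_mul, hgamma]
  norm_cast
  field_simp [Real.pi_ne_zero]

theorem integral_pow_mul_conj_pow_of_ne {a b : ℕ} (hab : a ≠ b) :
    ∫ z : ℂ, z ^ a * conj z ^ b ∂stdComplexGaussian = 0 := by
  rw [integral_stdComplexGaussian (by fun_prop)]
  set I := ∫ z : ℂ, z ^ a * conj z ^ b * ((Real.pi⁻¹ * Real.exp (-‖z‖ ^ 2) : ℝ) : ℂ)
  have hrotation (c : Circle) : I = (c : ℂ) ^ a * conj (c : ℂ) ^ b * I := by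
    refine ((rotation c).measurePreserving.integral_comp
      (rotation c).toHomeomorph.measurableEmbedding _).symm.trans
        (Eq.trans (integral_congr_ae (Eventually.of_forall fun z => ?_)) (integral_const_mul _ _))
    simp only [rotation_apply, map_mul, norm_mul, Circle.norm_coe, one_mul]
    ring
  have hcircle : (Circle.exp (Real.pi / (a - b)) : ℂ) ^ a *
      conj (Circle.exp (Real.pi / (a - b)) : ℂ) ^ b = -1 := by
    have hsub : (a : ℂ) - b ≠ 0 := sub_ne_zero.2 (by exact_mod_cast hab)
    rw [Circle.coe_exp, ← Complex.exp_conj, ← Complex.exp_nat_mul, ← Complex.exp_nat_mul,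
      ← Complex.exp_add, ← Complex.exp_pi_mul_I, map_mul, Complex.conj_ofReal, Complex.conj_I]
    congr 1
    push_cast
    field_simp
    ring
  have hneg := hrotation (Circle.exp (Real.pi / (a - b)))
  rw [hcircle] at hneg
  linear_combination hneg / 2

theorem integral_pow_mul_conj_pow (a b : ℕ) :
    ∫ z : ℂ, z ^ a * conj z ^ b ∂stdComplexGaussian = if a = b then (a.factorial : ℂ) else 0 := by
  split_ifs with hab
  · rw [← hab, integral_pow_mul_conj_pow_self]
  · exact integral_pow_mul_conj_pow_of_ne hab

section WithConj

variable {ι : Type*}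

/-- The point `(z, conj z)`, at which polynomials in the coordinates `X (inl i)` and their
conjugates `X (inr i)` are evaluated. -/
def withConj (z : ι → ℂ) : ι ⊕ ι → ℂ :=
  Sum.elim z fun i => conj (z i)

variable [Fintype ι]

theorem eval_withConj_monomial (m : ι ⊕ ι →₀ ℕ) (c : ℂ) (z : ι → ℂ) :
    MvPolynomial.eval (withConj z) (MvPolynomial.monomial m c) =
      c * ∏ i, z i ^ m (Sum.inl i) * conj (z i) ^ m (Sum.inr i) := by
  rw [MvPolynomial.eval_monomial, Finsupp.prod_fintype _ _ (by simp), Fintype.prod_sum_type,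
    Finset.prod_mul_distrib]
  rfl

theorem integrable_eval_withConj (p : MvPolynomial (ι ⊕ ι) ℂ) :
    Integrable (fun z : ι → ℂ => MvPolynomial.eval (withConj z) p)
      (Measure.pi fun _ => stdComplexGaussian) := by
  induction p using MvPolynomial.induction_on' with
  | add p q hp hq =>
    simp only [map_add]
    exact hp.add hq
  | monomial m c =>
    simp_rw [eval_withConj_monomial]
    exact (Integrable.fintype_prod fun i => integrable_pow_mul_conj_pow _ _).const_mul c

/-- The expectation of a polynomial in independent standard complex Gaussians and their
conjugates. -/
noncomputable def gaussianExpectation (ι : Type*) [Fintype ι] : MvPolynomial (ι ⊕ ι) ℂ →ₗ[ℂ] ℂ where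
  toFun p := ∫ z, MvPolynomial.eval (withConj z) p ∂Measure.pi fun _ : ι => stdComplexGaussian
  map_add' p q := by
    simp only [map_add]
    exact integral_add (integrable_eval_withConj p) (integrable_eval_withConj q)
  map_smul' c p := by
    simp only [MvPolynomial.smul_eval, RingHom.id_apply, smul_eq_mul]
    exact integral_const_mul c _

theorem gaussianExpectation_apply (p : MvPolynomial (ι ⊕ ι) ℂ) :
    gaussianExpectation ι p =
      ∫ z, MvPolynomial.eval (withConj z) p ∂Measure.pi fun _ => stdComplexGaussian :=
  rfl

theorem gaussianExpectation_monomial (m : ι ⊕ ι →₀ ℕ) (c : ℂ) :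
    gaussianExpectation ι (MvPolynomial.monomial m c) =
      c * ∏ i, if m (Sum.inl i) = m (Sum.inr i) then ((m (Sum.inl i)).factorial : ℂ) else 0 := by
  simp_rw [gaussianExpectation_apply, eval_withConj_monomial]
  rw [integral_const_mul, integral_fintype_prod_eq_prod
    (f := fun i (z : ℂ) => z ^ m (Sum.inl i) * conj z ^ m (Sum.inr i))]
  simp_rw [integral_pow_mul_conj_pow]

theorem gaussianExpectation_C (c : ℂ) : gaussianExpectation ι (MvPolynomial.C c) = c := by
  simp [gaussianExpectation_apply]

theorem gaussianExpectation_C_mul (c : ℂ) (p : MvPolynomial (ι ⊕ ι) ℂ) :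
    gaussianExpectation ι (MvPolynomial.C c * p) = c * gaussianExpectation ι p := by
  rw [MvPolynomial.C_mul', map_smul, smul_eq_mul]

theorem gaussianExpectation_X_inr_mul (i : ι) (p : MvPolynomial (ι ⊕ ι) ℂ) :
    gaussianExpectation ι (MvPolynomial.X (Sum.inr i) * p) =
      gaussianExpectation ι (MvPolynomial.pderiv (Sum.inl i) p) := by
  classical
  induction p using MvPolynomial.induction_on' with
  | add p q hp hq => rw [mul_add, map_add, map_add, map_add, hp, hq]
  | monomial m c =>
    rw [MvPolynomial.pderiv_monomial, ← pow_one (MvPolynomial.X _),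
      ← MvPolynomial.monomial_single_add, gaussianExpectation_monomial,
      gaussianExpectation_monomial, ← Finset.mul_prod_erase _ _ (Finset.mem_univ i),
      ← Finset.mul_prod_erase _ _ (Finset.mem_univ i), mul_assoc c, ← mul_assoc (m _ : ℂ)]
    congr 2
    · simp only [Finsupp.add_apply, Finsupp.tsub_apply, Finsupp.single_eq_same]
      rw [Finsupp.single_eq_of_ne (by simp)]
      rcases m (Sum.inl i) with _ | a
      · simp [(Nat.succ_ne_zero _).symm, add_comm 1]
      · by_cases hb : m (Sum.inr i) = a
        · simp [hb, add_comm, Nat.factorial_succ]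
        · have hb' : ¬ a + 1 = 1 + m (Sum.inr i) := by omega
          simp [hb', Ne.symm hb]
    · refine Finset.prod_congr rfl fun j hj => ?_
      simp [(Finset.ne_of_mem_erase hj).symm]

end WithConj

theorem measurePreserving_curry_gaussianEntries (N : ℕ) :
    MeasurePreserving (MeasurableEquiv.curry (Fin N) (Fin N) ℂ)
      (Measure.pi fun _ => stdComplexGaussian) (gaussianEntries N) := by
  refine ⟨(MeasurableEquiv.curry _ _ _).measurable, ?_⟩
  simpa only [gaussianEntries, Measure.infinitePi_eq_pi] using
    Measure.infinitePi_map_curry fun _ _ : Fin N => stdComplexGaussian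

theorem integrable_gaussianEntries_of_eval {N : ℕ} {f : (Fin N → Fin N → ℂ) → ℂ}
    {p : MvPolynomial ((Fin N × Fin N) ⊕ (Fin N × Fin N)) ℂ}
    (hf : ∀ g, MvPolynomial.eval (withConj (Function.uncurry g)) p = f g) :
    Integrable f (gaussianEntries N) := by
  rw [← (measurePreserving_curry_gaussianEntries N).integrable_comp_emb
    (MeasurableEquiv.measurableEmbedding _)]
  exact (integrable_eval_withConj p).congr (Eventually.of_forall fun z => hf (Function.curry z))

theorem integral_gaussianEntries_of_eval {N : ℕ} {f : (Fin N → Fin N → ℂ) → ℂ}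
    {p : MvPolynomial ((Fin N × Fin N) ⊕ (Fin N × Fin N)) ℂ}
    (hf : ∀ g, MvPolynomial.eval (withConj (Function.uncurry g)) p = f g) :
    ∫ g, f g ∂gaussianEntries N = gaussianExpectation (Fin N × Fin N) p := by
  rw [← (measurePreserving_curry_gaussianEntries N).integral_comp
    (MeasurableEquiv.measurableEmbedding _)]
  exact integral_congr_ae (Eventually.of_forall fun z => (hf (Function.curry z)).symm)

theorem gaussianExpectation_sum {α β : Type*} [Fintype α] [Fintype β]
    {P : MvPolynomial ((α ⊕ β) ⊕ (α ⊕ β)) ℂ} {q : MvPolynomial (α ⊕ α) ℂ}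
    {p : (α → ℂ) → MvPolynomial (β ⊕ β) ℂ}
    (hP : ∀ z w, MvPolynomial.eval (withConj (Sum.elim z w)) P =
      MvPolynomial.eval (withConj w) (p z))
    (hq : ∀ z, MvPolynomial.eval (withConj z) q = gaussianExpectation β (p z)) :
    gaussianExpectation (α ⊕ β) P = gaussianExpectation α q := by
  have hmp := measurePreserving_sumPiEquivProdPi_symm
    (X := fun _ : α ⊕ β => ℂ) fun _ => stdComplexGaussian
  rw [gaussianExpectation_apply, ← hmp.integral_comp (MeasurableEquiv.measurableEmbedding _)]
  refine (integral_prod _ ((hmp.integrable_comp_emb (MeasurableEquiv.measurableEmbedding _)).2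
    (integrable_eval_withConj P))).trans
      (integral_congr_ae (Eventually.of_forall fun z => ?_))
  simp only [hq z, gaussianExpectation_apply, ← hP]
  refine integral_congr_ae (Eventually.of_forall fun w => ?_)
  congr 2

/-! ### Quadratic forms in a Gaussian vector -/

theorem derivation_prod {R A M σ : Type*} [CommSemiring R] [CommSemiring A] [Algebra R A]
    [AddCommMonoid M] [Module A M] [Module R M] [DecidableEq σ] (D : Derivation R A M)
    (s : Finset σ) (f : σ → A) :
    D (∏ i ∈ s, f i) = ∑ i ∈ s, (∏ j ∈ s.erase i, f j) • D (f i) := by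
  induction s using Finset.induction_on with
  | empty => simp
  | insert a s ha ih =>
    rw [Finset.prod_insert ha, D.leibniz, ih, Finset.sum_insert ha, Finset.erase_insert ha,
      add_comm, Finset.smul_sum]
    refine congrArg _ (Finset.sum_congr rfl fun i hi => ?_)
    rw [Finset.erase_insert_of_ne (ne_of_mem_of_not_mem hi ha).symm,
      Finset.prod_insert (by simp [ha]), mul_smul]

theorem derivation_eq_sum_pderiv {R A σ : Type*} [CommSemiring R] [AddCommMonoid A] [Module R A]
    [Module (MvPolynomial σ R) A] [Fintype σ]
    (D : Derivation R (MvPolynomial σ R) A) (p : MvPolynomial σ R) :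
    D p = ∑ i, MvPolynomial.pderiv i p • D (MvPolynomial.X i) := by
  classical
  induction p using MvPolynomial.induction_on with
  | C c => simp
  | add p q hp hq => simp only [map_add, add_smul, Finset.sum_add_distrib, hp, hq]
  | mul_X p j hp =>
    simp only [Derivation.leibniz, MvPolynomial.pderiv_X, hp, add_smul, Finset.sum_add_distrib,
      smul_eq_mul, mul_smul, Finset.smul_sum]
    simp [Pi.single_apply]

section QuadraticForm

open MvPolynomial

variable {n : Type*} [Fintype n]

/-- The form `ξ* A ξ = ∑ A a b * conj (ξ a) * ξ b`, as a polynomial in `ξ` and `conj ξ`. -/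
noncomputable def hermitianQuadForm : Matrix n n ℂ →ₗ[ℂ] MvPolynomial (n ⊕ n) ℂ where
  toFun A := ∑ a, ∑ b, C (A a b) * (X (Sum.inr a) * X (Sum.inl b))
  map_add' A B := by simp only [Matrix.add_apply, C_add, add_mul, Finset.sum_add_distrib]
  map_smul' c A := by
    simp only [Matrix.smul_apply, smul_eq_mul, C_mul, mul_assoc, Finset.smul_sum, smul_eq_C_mul,
      RingHom.id_apply]

theorem hermitianQuadForm_apply (A : Matrix n n ℂ) :
    hermitianQuadForm A = ∑ a, ∑ b, C (A a b) * (X (Sum.inr a) * X (Sum.inl b)) :=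
  rfl

/-- The derivation `∑ A a b * ξ b * ∂/∂(ξ a)`: the action on polynomials in `ξ` and `conj ξ` of
the linear vector field `ξ ↦ A ξ`. -/
noncomputable def linearVectorField (A : Matrix n n ℂ) :
    Derivation ℂ (MvPolynomial (n ⊕ n) ℂ) (MvPolynomial (n ⊕ n) ℂ) :=
  mkDerivation ℂ (Sum.elim (fun a => ∑ b, C (A a b) * X (Sum.inl b)) 0)

theorem linearVectorField_apply (A : Matrix n n ℂ) (F : MvPolynomial (n ⊕ n) ℂ) :
    linearVectorField A F = ∑ a, ∑ b, C (A a b) * X (Sum.inl b) * pderiv (Sum.inl a) F := by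
  rw [derivation_eq_sum_pderiv, Fintype.sum_sum_type]
  simp [linearVectorField, mkDerivation_X, Finset.sum_mul, mul_comm (pderiv _ F)]

theorem linearVectorField_hermitianQuadForm (A B : Matrix n n ℂ) :
    linearVectorField A (hermitianQuadForm B) = hermitianQuadForm (B * A) := by
  have hcoord (a b : n) : linearVectorField A (C (B a b) * (X (Sum.inr a) * X (Sum.inl b))) =
      ∑ c, C (B a b * A b c) * (X (Sum.inr a) * X (Sum.inl c)) := by
    rw [C_mul', Derivation.map_smul, Derivation.leibniz]
    simp only [linearVectorField, mkDerivation_X, Sum.elim_inl, Sum.elim_inr, Pi.zero_apply,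
      smul_eq_mul, smul_eq_C_mul, C_mul, mul_zero, add_zero, Finset.mul_sum]
    exact Finset.sum_congr rfl fun c _ => by ring
  simp only [hermitianQuadForm_apply, map_sum, hcoord, Matrix.mul_apply, Finset.sum_mul]
  exact Finset.sum_congr rfl fun a _ => Finset.sum_comm

/-- The expectation of `∏ (1 - s ξ* R_j ξ)` over a standard complex Gaussian vector `ξ`, for
`R_j = R (x j)` taken from a family of matrices such as the resolvent of a fixed matrix. -/
noncomputable def quadFormCorrelation {α : Type*} (s : ℂ) (R : α → Matrix n n ℂ) {m : ℕ}
    (x : Fin m → α) : ℂ :=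
  gaussianExpectation n (∏ j, (1 - C s * hermitianQuadForm (R (x j))))

theorem quadFormCorrelation_update_sub (s : ℂ) (R : ℂ → Matrix n n ℂ) {m : ℕ} (x : Fin m → ℂ)
    (y : ℂ) (i : Fin m) (hR : (y - x i) • (R (x i) * R y) = R (x i) - R y) :
    quadFormCorrelation s R (Function.update x i y) - quadFormCorrelation s R x =
      (y - x i) * (s * gaussianExpectation n ((∏ j ∈ Finset.univ.erase i,
        (1 - C s * hermitianQuadForm (R (x j)))) * hermitianQuadForm (R (x i) * R y))) := by
  have hfactor : (1 - C s * hermitianQuadForm (R y)) - (1 - C s * hermitianQuadForm (R (x i))) =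
      C ((y - x i) * s) * hermitianQuadForm (R (x i) * R y) := by
    have hresolvent := congrArg hermitianQuadForm hR
    rw [map_smul, map_sub, smul_eq_C_mul] at hresolvent
    rw [C_mul]
    linear_combination -C s * hresolvent
  have hothers : ∏ j ∈ Finset.univ.erase i,
      (1 - C s * hermitianQuadForm (R (Function.update x i y j))) =
      ∏ j ∈ Finset.univ.erase i, (1 - C s * hermitianQuadForm (R (x j))) :=
    Finset.prod_congr rfl fun j hj => by rw [Function.update_of_ne (Finset.ne_of_mem_erase hj)]
  rw [quadFormCorrelation, quadFormCorrelation, ← map_sub,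
    ← Finset.mul_prod_erase _ _ (Finset.mem_univ i),
    ← Finset.mul_prod_erase _ _ (Finset.mem_univ i), Function.update_self, hothers, ← sub_mul,
    hfactor, mul_assoc, gaussianExpectation_C_mul, mul_comm (hermitianQuadForm _), mul_assoc]

theorem gaussianExpectation_hermitianQuadForm_mul (A : Matrix n n ℂ)
    (F : MvPolynomial (n ⊕ n) ℂ) :
    gaussianExpectation n (hermitianQuadForm A * F) =
      A.trace * gaussianExpectation n F + gaussianExpectation n (linearVectorField A F) := by
  classical
  have hentry (a b : n) :
      gaussianExpectation n (C (A a b) * (X (Sum.inr a) * X (Sum.inl b)) * F) =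
      (if a = b then A a b * gaussianExpectation n F else 0) +
        gaussianExpectation n (C (A a b) * X (Sum.inl b) * pderiv (Sum.inl a) F) := by
    rw [mul_assoc, mul_assoc, mul_assoc, gaussianExpectation_C_mul, gaussianExpectation_C_mul,
      gaussianExpectation_X_inr_mul, Derivation.leibniz, pderiv_X, map_add, mul_add, add_comm]
    congr 1
    split_ifs with hab
    · subst hab; simp
    · simp [hab]
  rw [linearVectorField_apply, hermitianQuadForm_apply]
  simp only [Finset.sum_mul, map_sum, hentry, Finset.sum_add_distrib, Matrix.trace, Matrix.diag]
  simp

theorem gaussianExpectation_hermitianQuadForm_mul_prod {ι : Type*} [Fintype ι] [DecidableEq ι]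
    (s : ℂ) (A : Matrix n n ℂ) (R : ι → Matrix n n ℂ) :
    gaussianExpectation n
        (hermitianQuadForm A * ∏ j, (1 - C s * hermitianQuadForm (R j))) =
      A.trace * gaussianExpectation n (∏ j, (1 - C s * hermitianQuadForm (R j))) -
      s * ∑ i, gaussianExpectation n ((∏ j ∈ Finset.univ.erase i,
        (1 - C s * hermitianQuadForm (R j))) * hermitianQuadForm (R i * A)) := by
  rw [gaussianExpectation_hermitianQuadForm_mul, derivation_prod, map_sum, sub_eq_add_neg,
    Finset.mul_sum, ← Finset.sum_neg_distrib]
  refine congrArg _ (Finset.sum_congr rfl fun i _ => ?_)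
  rw [map_sub, Derivation.map_one_eq_zero, C_mul', Derivation.map_smul,
    linearVectorField_hermitianQuadForm, zero_sub, smul_neg, map_neg, smul_comm, map_smul,
    smul_eq_mul, smul_eq_mul]

theorem quadFormCorrelation_snoc (s : ℂ) (R : ℂ → Matrix n n ℂ) {m : ℕ} (x : Fin m → ℂ) (y : ℂ)
    (hR : ∀ i, (y - x i) • (R (x i) * R y) = R (x i) - R y) (hxy : ∀ i, y ≠ x i) :
    quadFormCorrelation s R (Fin.snoc x y : Fin (m + 1) → ℂ) =
      (1 - s * (R y).trace) * quadFormCorrelation s R x +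
      s * ∑ i, (quadFormCorrelation s R (Function.update x i y) - quadFormCorrelation s R x) /
        (y - x i) := by
  have hparts := gaussianExpectation_hermitianQuadForm_mul_prod s (R y) fun i => R (x i)
  simp_rw [quadFormCorrelation_update_sub s R x y _ (hR _),
    mul_div_cancel_left₀ _ (sub_ne_zero.2 (hxy _))]
  simp only [quadFormCorrelation, Fin.prod_univ_castSucc, Fin.snoc_castSucc, Fin.snoc_last]
  rw [mul_sub, mul_one, map_sub, mul_comm (∏ _, _), mul_assoc, gaussianExpectation_C_mul, hparts,
    ← Finset.mul_sum]
  ring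

end QuadraticForm

/-! ### Determinants of first-order functionals -/

theorem swap_castSucc_last_comp_castSucc {m : ℕ} (i : Fin m) :
    Equiv.swap i.castSucc (Fin.last m) ∘ Fin.castSucc =
      Function.update Fin.castSucc i (Fin.last m) := by
  funext j
  by_cases hj : j = i
  · simp [hj]
  · rw [Function.update_of_ne hj, Function.comp_apply, Equiv.swap_apply_of_ne_of_ne
      (by simpa using hj) (Fin.castSucc_lt_last j).ne]

theorem snoc_update_eq_comp_swap {α : Type*} {m : ℕ} (x : Fin m → α) (y : α) (i : Fin m) :
    (Fin.snoc (Function.update x i y) (x i) : Fin (m + 1) → α) =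
      (Fin.snoc x y : Fin (m + 1) → α) ∘ Equiv.swap i.castSucc (Fin.last m) := by
  funext j
  refine Fin.lastCases (by simp) (fun j => ?_) j
  by_cases hj : j = i
  · simp [hj]
  · simp [hj, Equiv.swap_apply_of_ne_of_ne (show j.castSucc ≠ i.castSucc by simpa using hj)
      (Fin.castSucc_lt_last j).ne]

section LastColumn

variable {R : Type*} [CommRing R] {m : ℕ} (A : Matrix (Fin (m + 1)) (Fin (m + 1)) R)

theorem adjugate_last_last :
    A.adjugate (Fin.last m) (Fin.last m) = (A.submatrix Fin.castSucc Fin.castSucc).det := by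
  rw [Matrix.adjugate_fin_succ_eq_det_submatrix, Fin.succAbove_last, Even.neg_one_pow ⟨_, rfl⟩,
    one_mul]

theorem adjugate_last_castSucc (i : Fin m) :
    A.adjugate (Fin.last m) i.castSucc =
      -(A.submatrix (Function.update Fin.castSucc i (Fin.last m)) Fin.castSucc).det := by
  have hswap : (A.updateRow i.castSucc (Pi.single (Fin.last m) 1)).submatrix
      (Equiv.swap i.castSucc (Fin.last m)) id =
      (A.submatrix (Equiv.swap i.castSucc (Fin.last m)) id).updateRow (Fin.last m)
        (Pi.single (Fin.last m) 1) := by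
    simpa using A.submatrix_updateRow_equiv i.castSucc (Pi.single (Fin.last m) 1)
      (Equiv.swap i.castSucc (Fin.last m)) (Equiv.refl _)
  have hsign := Matrix.det_permute (Equiv.swap i.castSucc (Fin.last m))
    (A.updateRow i.castSucc (Pi.single (Fin.last m) 1))
  rw [hswap, ← Matrix.adjugate_apply, adjugate_last_last, Matrix.submatrix_submatrix,
    swap_castSucc_last_comp_castSucc, Function.id_comp, ← Matrix.adjugate_apply,
    Equiv.Perm.sign_swap (Fin.castSucc_lt_last i).ne, Units.val_neg, Units.val_one, Int.cast_neg,
    Int.cast_one] at hsign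
  linear_combination hsign

theorem det_eq_last_col :
    A.det = A (Fin.last m) (Fin.last m) * (A.submatrix Fin.castSucc Fin.castSucc).det -
      ∑ i : Fin m, A i.castSucc (Fin.last m) *
        (A.submatrix (Function.update Fin.castSucc i (Fin.last m)) Fin.castSucc).det := by
  rw [A.det_eq_sum_mul_adjugate_col (Fin.last m), Fin.sum_univ_castSucc, adjugate_last_last]
  simp only [adjugate_last_castSucc, mul_neg, Finset.sum_neg_distrib]
  ring

end LastColumn

section FirstOrder

open Polynomial

theorem det_functional_monic {R : Type*} [CommRing R] [Nontrivial R] {m : ℕ}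
    (l : Fin m → R[X] →ₗ[R] R) (p : Fin m → R[X]) (hdeg : ∀ i, (p i).natDegree = i)
    (hp : ∀ i, (p i).Monic) :
    (Matrix.of fun i j => l i (p j)).det =
      (Matrix.of fun i (j : Fin m) => l i (X ^ (j : ℕ))).det := by
  have hmul : (Matrix.of fun i j => l i (p j)) =
      (Matrix.of fun i (j : Fin m) => l i (X ^ (j : ℕ))) *
        (Matrix.of fun (i j : Fin m) => (p j).coeff i) := by
    ext i j
    rw [Matrix.mul_apply, Matrix.of_apply]
    conv_lhs => rw [(p j).as_sum_range_C_mul_X_pow' (n := m) (by rw [hdeg]; exact j.2)]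
    rw [map_sum, Finset.sum_range]
    refine Finset.sum_congr rfl fun a _ => ?_
    rw [← smul_eq_C_mul, map_smul, smul_eq_mul, Matrix.of_apply, Matrix.of_apply, mul_comm]
  rw [hmul, Matrix.det_mul, Matrix.det_matrixOfPolynomials p hdeg hp, mul_one]

variable {K : Type*} [CommRing K]

/-- The functional `p ↦ c p(y) - s p'(y)`. -/
noncomputable def firstOrderFunctional (s c y : K) : K[X] →ₗ[K] K :=
  c • leval y - s • (leval y ∘ₗ derivative)

theorem firstOrderFunctional_apply (s c y : K) (p : K[X]) :
    firstOrderFunctional s c y p = c * p.eval y - s * (derivative p).eval y := rfl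

/-- The determinant `det (ℓ_i (X ^ a))`, where `ℓ_i` is the functional
`p ↦ c (x i) p(x i) - s p'(x i)`; for `s = 0` and `c = 1` it is the Vandermonde determinant. -/
noncomputable def firstOrderDet (s : K) (c : K → K) {m : ℕ} (x : Fin m → K) : K :=
  (Matrix.of fun i (j : Fin m) => firstOrderFunctional s (c (x i)) (x i) (X ^ (j : ℕ))).det

theorem firstOrderDet_zero_one {m : ℕ} (x : Fin m → K) :
    firstOrderDet 0 1 x = (Matrix.vandermonde x).det := by
  rw [firstOrderDet]
  congr 1
  ext i j
  simp [firstOrderFunctional_apply, Matrix.vandermonde_apply]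

variable [Nontrivial K]

theorem firstOrderDet_snoc (s : K) (c : K → K) {m : ℕ} (x : Fin m → K) (y : K) :
    firstOrderDet s c (Fin.snoc x y : Fin (m + 1) → K) =
      firstOrderFunctional s (c y) y (Lagrange.nodal Finset.univ x) * firstOrderDet s c x +
      s * ∑ i, (∏ j ∈ Finset.univ.erase i, (x i - x j)) *
        firstOrderDet s c (Function.update x i y) := by
  -- Replacing `X ^ m` by the nodal polynomial of `x` kills all values in the last column but one.
  set p : Fin (m + 1) → K[X] := Fin.snoc (fun i : Fin m => X ^ (i : ℕ))
    (Lagrange.nodal Finset.univ x) with hp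
  have hdeg (i : Fin (m + 1)) : (p i).natDegree = i := by
    refine Fin.lastCases ?_ (fun i => ?_) i <;> simp [hp, Lagrange.natDegree_nodal]
  have hmonic (i : Fin (m + 1)) : (p i).Monic := by
    refine Fin.lastCases ?_ (fun i => ?_) i <;> simp [hp, Lagrange.nodal_monic, monic_X_pow]
  have hlast (i : Fin m) :
      firstOrderFunctional s (c (x i)) (x i) (Lagrange.nodal Finset.univ x) =
        -s * ∏ j ∈ Finset.univ.erase i, (x i - x j) := by
    rw [firstOrderFunctional_apply, Lagrange.eval_nodal_at_node (Finset.mem_univ i),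
      Lagrange.eval_nodal_derivative_eval_node_eq (Finset.mem_univ i), Lagrange.eval_nodal]
    ring
  rw [firstOrderDet, ← det_functional_monic _ p hdeg hmonic, det_eq_last_col, sub_eq_add_neg,
    Finset.mul_sum, ← Finset.sum_neg_distrib]
  congr 1
  · simp only [Matrix.of_apply, Fin.snoc_last, hp, firstOrderDet]
    congr 2
    ext i j
    simp
  · refine Finset.sum_congr rfl fun i _ => ?_
    simp only [Matrix.of_apply, Fin.snoc_castSucc, Fin.snoc_last, hp, hlast]
    rw [neg_mul, neg_mul, neg_neg, mul_assoc, firstOrderDet]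
    congr 3
    ext a b
    by_cases ha : a = i <;> simp [ha]

theorem det_vandermonde_snoc {m : ℕ} (x : Fin m → K) (y : K) :
    (Matrix.vandermonde (Fin.snoc x y : Fin (m + 1) → K)).det =
      (∏ i, (y - x i)) * (Matrix.vandermonde x).det := by
  rw [← firstOrderDet_zero_one, firstOrderDet_snoc, firstOrderDet_zero_one]
  simp [firstOrderFunctional_apply, Lagrange.eval_nodal]

theorem det_vandermonde_update {m : ℕ} (x : Fin m → K) (y : K) (i : Fin m) :
    (y - x i) * ((∏ j ∈ Finset.univ.erase i, (x i - x j)) *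
        (Matrix.vandermonde (Function.update x i y)).det) =
      (∏ j, (y - x j)) * (Matrix.vandermonde x).det := by
  have hothers : ∏ j ∈ Finset.univ.erase i, (x i - Function.update x i y j) =
      ∏ j ∈ Finset.univ.erase i, (x i - x j) :=
    Finset.prod_congr rfl fun j hj => by rw [Function.update_of_ne (Finset.ne_of_mem_erase hj)]
  have hswap := det_vandermonde_snoc (Function.update x i y) (x i)
  rw [snoc_update_eq_comp_swap, show Matrix.vandermonde ((Fin.snoc x y : Fin (m + 1) → K) ∘
      Equiv.swap i.castSucc (Fin.last m)) = (Matrix.vandermonde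
      (Fin.snoc x y : Fin (m + 1) → K)).submatrix (Equiv.swap i.castSucc (Fin.last m)) id from rfl,
    Matrix.det_permute, Equiv.Perm.sign_swap (Fin.castSucc_lt_last i).ne, det_vandermonde_snoc,
    ← Finset.mul_prod_erase _ (fun j => x i - Function.update x i y j) (Finset.mem_univ i),
    Function.update_self, hothers, Units.val_neg, Units.val_one, Int.cast_neg,
    Int.cast_one] at hswap
  linear_combination hswap

end FirstOrder

section FirstOrderQuadForm

open Polynomial

theorem eval_derivative_nodal_of_ne {K ι : Type*} [Field K] [Fintype ι] {x : ι → K} {y : K}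
    (hy : ∀ i, y ≠ x i) :
    (derivative (Lagrange.nodal Finset.univ x)).eval y =
      (∏ j, (y - x j)) * ∑ i, (y - x i)⁻¹ := by
  classical
  rw [Lagrange.derivative_nodal, eval_finsetSum, Finset.mul_sum]
  refine Finset.sum_congr rfl fun i _ => ?_
  rw [Lagrange.eval_nodal, ← Finset.mul_prod_erase _ _ (Finset.mem_univ i)]
  field_simp [sub_ne_zero.2 (hy i)]

theorem injective_update {α β : Type*} [DecidableEq α] {f : α → β} (hf : Function.Injective f)
    {b : β} (hb : ∀ a, b ≠ f a) (a : α) : Function.Injective (Function.update f a b) := by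
  intro i j hij
  by_cases hi : i = a <;> by_cases hj : j = a
  · rw [hi, hj]
  · simp only [hi, Function.update_self, Function.update_of_ne hj] at hij
    exact absurd hij (hb j)
  · simp only [hj, Function.update_self, Function.update_of_ne hi] at hij
    exact absurd hij.symm (hb i)
  · rw [Function.update_of_ne hi, Function.update_of_ne hj] at hij
    exact hf hij

variable {n : Type*} [Fintype n] {R : ℂ → Matrix n n ℂ}

theorem vandermonde_mul_quadFormCorrelation_snoc (s : ℂ) {m : ℕ} (x : Fin m → ℂ) (y : ℂ)
    (hR : ∀ i, (y - x i) • (R (x i) * R y) = R (x i) - R y) (hxy : ∀ i, y ≠ x i) :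
    (Matrix.vandermonde (Fin.snoc x y : Fin (m + 1) → ℂ)).det *
        quadFormCorrelation s R (Fin.snoc x y : Fin (m + 1) → ℂ) =
      firstOrderFunctional s (1 - s * (R y).trace) y (Lagrange.nodal Finset.univ x) *
        ((Matrix.vandermonde x).det * quadFormCorrelation s R x) +
      s * ∑ i, (∏ j ∈ Finset.univ.erase i, (x i - x j)) *
        ((Matrix.vandermonde (Function.update x i y)).det *
          quadFormCorrelation s R (Function.update x i y)) := by
  have hupdate (i : Fin m) : (∏ j ∈ Finset.univ.erase i, (x i - x j)) *
      ((Matrix.vandermonde (Function.update x i y)).det *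
        quadFormCorrelation s R (Function.update x i y)) =
      (∏ j, (y - x j)) * (Matrix.vandermonde x).det *
        (quadFormCorrelation s R (Function.update x i y) / (y - x i)) := by
    rw [← det_vandermonde_update x y i]
    field_simp [sub_ne_zero.2 (hxy i)]
  rw [quadFormCorrelation_snoc s R x y hR hxy, det_vandermonde_snoc, firstOrderFunctional_apply,
    eval_derivative_nodal_of_ne hxy, Lagrange.eval_nodal]
  simp only [hupdate, ← Finset.mul_sum, sub_div, Finset.sum_sub_distrib,
    div_eq_mul_inv (quadFormCorrelation s R x)]
  ring

theorem firstOrderDet_eq_vandermonde_mul_quadFormCorrelation (s : ℂ) {S : Set ℂ}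
    (hR : ∀ x ∈ S, ∀ y ∈ S, (y - x) • (R x * R y) = R x - R y) {m : ℕ} (x : Fin m → ℂ)
    (hx : Function.Injective x) (hxS : ∀ i, x i ∈ S) :
    firstOrderDet s (fun y => 1 - s * (R y).trace) x =
      (Matrix.vandermonde x).det * quadFormCorrelation s R x := by
  induction m with
  | zero =>
    have hone := gaussianExpectation_C (ι := n) 1
    rw [MvPolynomial.C_1] at hone
    simp [firstOrderDet, quadFormCorrelation, hone]
  | succ m ih =>
    obtain ⟨x, y, rfl⟩ : ∃ (x' : Fin m → ℂ) (y : ℂ), x = Fin.snoc x' y :=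
      ⟨Fin.init x, x (Fin.last m), (Fin.snoc_init_self x).symm⟩
    obtain ⟨hx', hxy⟩ := Fin.snoc_injective_iff.1 hx
    have hxS' (i : Fin m) : x i ∈ S := by simpa using hxS i.castSucc
    have hyS : y ∈ S := by simpa using hxS (Fin.last m)
    have hne (i : Fin m) : y ≠ x i := fun h => hxy ⟨i, h.symm⟩
    have hupdateS (i j : Fin m) : Function.update x i y j ∈ S := by
      by_cases hj : j = i
      · simpa [hj] using hyS
      · simpa [hj] using hxS' j
    rw [firstOrderDet_snoc, ih x hx' hxS', vandermonde_mul_quadFormCorrelation_snoc s x y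
      (fun i => hR _ (hxS' i) _ hyS) hne]
    simp only [fun i => ih _ (injective_update hx' hne i) (hupdateS i)]

end FirstOrderQuadForm

/-! ### Averaging characteristic polynomials over rank-one perturbations -/

section DetDerivative

theorem derivation_det {R A n : Type*} [CommRing R] [CommRing A] [Algebra R A] [Fintype n]
    [DecidableEq n] (D : Derivation R A A) (M : Matrix n n A) :
    D M.det = ∑ i, ∑ j, M.adjugate j i * D (M i j) := by
  have hcolumns : D M.det = ∑ j, (M.updateCol j fun i => D (M i j)).det := by
    simp_rw [Matrix.det_apply', map_sum]
    rw [Finset.sum_comm]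
    refine Finset.sum_congr rfl fun σ _ => ?_
    rw [D.leibniz, D.map_intCast, smul_zero, add_zero, derivation_prod, smul_eq_mul,
      Finset.mul_sum]
    refine Finset.sum_congr rfl fun j _ => ?_
    rw [← Finset.mul_prod_erase _ _ (Finset.mem_univ j), smul_eq_mul, mul_comm (∏ _ ∈ _, _),
      Matrix.updateCol_self]
    congr 2
    exact Finset.prod_congr rfl fun i hi => by rw [Matrix.updateCol_ne (Finset.ne_of_mem_erase hi)]
  rw [hcolumns, Finset.sum_comm]
  refine Finset.sum_congr rfl fun j _ => ?_
  rw [← Matrix.cramer_apply, Matrix.cramer_eq_adjugate_mulVec]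
  rfl

open Polynomial

variable {A n : Type*} [CommRing A] [DecidableEq n]

theorem map_eval_one_sub_X_smul (M : Matrix n n A) (c : A) :
    (1 - (X : A[X]) • M.map C).map (eval c) = 1 - c • M := by
  ext i j
  by_cases hij : i = j <;> simp [hij] <;> ring

variable [Fintype n]

theorem eval_derivative_det (M : Matrix n n A[X]) (c : A) :
    (derivative M.det).eval c =
      ∑ i, ∑ j, (M.map (eval c)).adjugate j i * (derivative (M i j)).eval c := by
  have hadjugate (i j : n) : (M.adjugate j i).eval c = (M.map (eval c)).adjugate j i :=
    congrFun (congrFun (RingHom.map_adjugate (evalRingHom c) M) j) i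
  rw [show derivative M.det = derivative' (R := A) M.det from rfl, derivation_det]
  simp only [eval_finsetSum, eval_mul, hadjugate]
  rfl

theorem map_eval_charmatrix (M : Matrix n n A) (c : A) :
    M.charmatrix.map (eval c) = Matrix.scalar n c - M := by
  ext i j
  by_cases hij : i = j <;> simp [hij]

theorem eval_derivative_charpoly (M : Matrix n n A) (c : A) :
    (derivative M.charpoly).eval c = ((Matrix.scalar n c - M).adjugate).trace := by
  have hentry (i j : n) : (derivative (M.charmatrix i j)).eval c = if i = j then 1 else 0 := by
    by_cases hij : i = j <;> simp [hij]
  rw [Matrix.charpoly, eval_derivative_det, map_eval_charmatrix]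
  simp [hentry, Matrix.trace]

theorem eval_charpolyRev_eq_det (M : Matrix n n A) (c : A) :
    M.charpolyRev.eval c = (1 - c • M).det := by
  rw [← map_eval_one_sub_X_smul]
  exact RingHom.map_det (evalRingHom c) (1 - (X : A[X]) • M.map C)

theorem eval_derivative_charpolyRev (M : Matrix n n A) (c : A) :
    (derivative M.charpolyRev).eval c = -∑ i, ∑ j, (1 - c • M).adjugate j i * M i j := by
  have hentry (i j : n) :
      (derivative ((1 - (X : A[X]) • M.map C) i j)).eval c = -M i j := by
    by_cases hij : i = j <;> simp [hij]
  rw [Matrix.charpolyRev, eval_derivative_det, map_eval_one_sub_X_smul]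
  simp only [hentry, mul_neg, Finset.sum_neg_distrib]

end DetDerivative

section Resolvent

open Polynomial

variable {n : Type*} [Fintype n] [DecidableEq n] {K : Type*} [Field K]

theorem isUnit_det_scalar_sub {G : Matrix n n K} {x : K} (hx : G.charpoly.eval x ≠ 0) :
    IsUnit (Matrix.scalar n x - G).det := by
  rw [← Matrix.eval_charpoly]
  exact IsUnit.mk0 _ hx

theorem resolvent_identity {G : Matrix n n K} {a b : K} (ha : G.charpoly.eval a ≠ 0)
    (hb : G.charpoly.eval b ≠ 0) :
    (b - a) • ((Matrix.scalar n a - G)⁻¹ * (Matrix.scalar n b - G)⁻¹) =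
      (Matrix.scalar n a - G)⁻¹ - (Matrix.scalar n b - G)⁻¹ := by
  have hdiff : (b - a) • (1 : Matrix n n K) =
      (Matrix.scalar n b - G) - (Matrix.scalar n a - G) := by
    rw [sub_sub_sub_cancel_right, ← map_sub, Matrix.smul_one_eq_diagonal, Matrix.scalar_apply]
  calc (b - a) • ((Matrix.scalar n a - G)⁻¹ * (Matrix.scalar n b - G)⁻¹)
      = (Matrix.scalar n a - G)⁻¹ * ((b - a) • (1 : Matrix n n K)) *
          (Matrix.scalar n b - G)⁻¹ := by simp
    _ = (Matrix.scalar n a - G)⁻¹ - (Matrix.scalar n b - G)⁻¹ := by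
        rw [hdiff, mul_sub, sub_mul, Matrix.nonsing_inv_mul _ (isUnit_det_scalar_sub ha), mul_assoc,
          Matrix.mul_nonsing_inv _ (isUnit_det_scalar_sub hb), mul_one, one_mul]

theorem eval_derivative_charpoly_eq_mul_trace_inv {G : Matrix n n K} {x : K}
    (hx : G.charpoly.eval x ≠ 0) :
    (derivative G.charpoly).eval x = G.charpoly.eval x * ((Matrix.scalar n x - G)⁻¹).trace := by
  rw [eval_derivative_charpoly, Matrix.inv_def, Matrix.trace_smul, ← Matrix.eval_charpoly,
    Ring.inverse_eq_inv', smul_eq_mul, mul_inv_cancel_left₀ hx]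

theorem inv_map_of_isUnit_det {R S : Type*} [CommRing R] [CommRing S] (φ : R →+* S)
    {M : Matrix n n R} (hM : IsUnit M.det) : (M.map φ)⁻¹ = M⁻¹.map φ := by
  refine Matrix.inv_eq_right_inv ?_
  rw [← Matrix.map_mul, Matrix.mul_nonsing_inv _ hM, Matrix.map_one φ φ.map_zero φ.map_one]

theorem exists_injective_eval_ne_zero [Infinite K] {p : K[X]} (hp : p ≠ 0) (D : ℕ) :
    ∃ t : Fin D → K, Function.Injective t ∧ ∀ i, p.eval (t i) ≠ 0 := by
  have hinfinite : {a : K | p.eval a ≠ 0}.Infinite := (finite_setOfPred_isRoot hp).infinite_compl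
  obtain ⟨f⟩ : Nonempty (ℕ ↪ {a : K | p.eval a ≠ 0}) := ⟨hinfinite.natEmbedding _⟩
  exact ⟨fun i => f i, fun a b hab => Fin.ext (f.injective (Subtype.ext hab)), fun i => (f i).2⟩

theorem functional_eq_sum_basis_smul_leval {D : ℕ} {t : Fin D → K} (ht : Function.Injective t)
    (l : K[X] →ₗ[K] K) {p : K[X]} (hp : p.degree < D) :
    l p = (∑ j, l (Lagrange.basis Finset.univ t j) • leval (t j)) p := by
  conv_lhs => rw [Lagrange.eq_interpolate (s := Finset.univ) (v := t) (f := p) ht.injOn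
    (by simpa using hp)]
  simp only [Lagrange.interpolate_apply, map_sum, LinearMap.sum_apply, LinearMap.smul_apply,
    leval_apply, smul_eq_mul, ← smul_eq_C_mul, map_smul]
  exact Finset.sum_congr rfl fun _ _ => mul_comm _ _

end Resolvent

section CharpolyDet

open Polynomial

variable {K : Type*} [CommRing K]

/-- The coefficientwise extension of a linear functional on `K[X]` to polynomials with
coefficients in a `K`-algebra `A`. -/
noncomputable def coeffFunctional (A : Type*) [CommRing A] [Algebra K A] (l : K[X] →ₗ[K] K) :
    A[X] →ₗ[A] A :=
  Polynomial.lsum fun m => algebraMap K A (l (X ^ m)) • LinearMap.id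

variable {A B : Type*} [CommRing A] [Algebra K A] [CommRing B] [Algebra K B]

theorem coeffFunctional_monomial (l : K[X] →ₗ[K] K) (m : ℕ) (a : A) :
    coeffFunctional A l (monomial m a) = algebraMap K A (l (X ^ m)) * a := by
  simp [coeffFunctional, Algebra.smul_def]

theorem coeffFunctional_map (l : K[X] →ₗ[K] K) (φ : A →ₐ[K] B) (p : A[X]) :
    coeffFunctional B l (p.map (φ : A →+* B)) = φ (coeffFunctional A l p) := by
  induction p using Polynomial.induction_on' with
  | add p q hp hq => rw [Polynomial.map_add, map_add, map_add, map_add, hp, hq]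
  | monomial m a => simp [coeffFunctional_monomial]

theorem coeffFunctional_self (l : K[X] →ₗ[K] K) (p : K[X]) : coeffFunctional K l p = l p := by
  induction p using Polynomial.induction_on' with
  | add p q hp hq => rw [map_add, map_add, hp, hq]
  | monomial m a =>
    rw [coeffFunctional_monomial, ← C_mul_X_pow_eq_monomial, ← smul_eq_C_mul, map_smul, smul_eq_mul,
      mul_comm]
    rfl

theorem coeffFunctional_leval (x : K) (p : A[X]) :
    coeffFunctional A (leval x) p = p.eval (algebraMap K A x) := by
  induction p using Polynomial.induction_on' with
  | add p q hp hq => rw [map_add, eval_add, hp, hq]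
  | monomial m a => simp [coeffFunctional_monomial, mul_comm]

theorem coeffFunctional_congr {l l' : K[X] →ₗ[K] K} {p : A[X]} {D : ℕ} (hp : p.natDegree < D)
    (h : ∀ m < D, l (X ^ m) = l' (X ^ m)) : coeffFunctional A l p = coeffFunctional A l' p := by
  rw [p.as_sum_range' D hp, map_sum, map_sum]
  refine Finset.sum_congr rfl fun m hm => ?_
  rw [coeffFunctional_monomial, coeffFunctional_monomial, h m (Finset.mem_range.1 hm)]

/-- The linear map `l ↦ coeffFunctional A l p`. -/
noncomputable def coeffFunctionalHom (p : A[X]) : (K[X] →ₗ[K] K) →ₗ[K] A where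
  toFun l := coeffFunctional A l p
  map_add' l l' := by
    induction p using Polynomial.induction_on' with
    | add p q hp hq => rw [map_add, map_add, map_add, hp, hq]; ring
    | monomial m a => simp only [coeffFunctional_monomial, LinearMap.add_apply, map_add]; ring
  map_smul' c l := by
    induction p using Polynomial.induction_on' with
    | add p q hp hq => rw [map_add, map_add, hp, hq, smul_add]
    | monomial m a =>
      simp only [coeffFunctional_monomial, LinearMap.smul_apply, map_mul, smul_eq_mul,
        RingHom.id_apply, Algebra.smul_def]
      ring

variable {n : Type*} [Fintype n] [DecidableEq n] {k : ℕ}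

/-- `det (ℓ_i (X ^ j χ_M))`, where `χ_M` is the characteristic polynomial of `M`; for evaluations
`ℓ_i` at `x_i` this is the Vandermonde determinant of `x` times `∏ χ_M(x_i)`. -/
noncomputable def charpolyDet (l : Fin k → K[X] →ₗ[K] K) (M : Matrix n n A) : A :=
  (Matrix.of fun i (j : Fin k) => coeffFunctional A (l i) (X ^ (j : ℕ) * M.charpoly)).det

theorem charpolyDet_map (l : Fin k → K[X] →ₗ[K] K) (φ : A →ₐ[K] B) (M : Matrix n n A) :
    charpolyDet l (M.map φ) = φ (charpolyDet l M) := by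
  rw [charpolyDet, charpolyDet, AlgHom.map_det]
  congr 1
  ext i j
  rw [Matrix.of_apply, AlgHom.mapMatrix_apply, Matrix.map_apply, Matrix.of_apply,
    ← coeffFunctional_map, Polynomial.map_mul, Polynomial.map_pow, Polynomial.map_X,
    ← Matrix.charpoly_map]
  rfl

theorem charpolyDet_leval (x : Fin k → K) (M : Matrix n n A) :
    charpolyDet (fun i => leval (x i)) M = algebraMap K A (Matrix.vandermonde x).det *
      ∏ i, (Matrix.scalar n (algebraMap K A (x i)) - M).det := by
  have hentries : (Matrix.of fun i (j : Fin k) => coeffFunctional A (leval (x i))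
      (X ^ (j : ℕ) * M.charpoly)) = Matrix.of fun i j =>
      (Matrix.scalar n (algebraMap K A (x i)) - M).det *
        (Matrix.vandermonde x).map (algebraMap K A) i j := by
    ext i j
    simp [coeffFunctional_leval, Matrix.eval_charpoly, Matrix.vandermonde_apply, mul_comm]
  rw [charpolyDet, hentries, Matrix.det_mul_column, RingHom.map_det, mul_comm]
  rfl

theorem charpolyDet_congr {l l' : Fin k → K[X] →ₗ[K] K} (M : Matrix n n A)
    (h : ∀ i, ∀ m < Fintype.card n + k, l i (X ^ m) = l' i (X ^ m)) :
    charpolyDet l M = charpolyDet l' M := by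
  rw [charpolyDet, charpolyDet]
  congr 1
  ext i j
  refine coeffFunctional_congr ?_ (h i)
  have hM : M.charpoly.natDegree ≤ Fintype.card n := by
    cases subsingleton_or_nontrivial A
    · exact (natDegree_of_subsingleton (p := M.charpoly)).trans_le (Nat.zero_le _)
    · exact M.charpoly_natDegree_eq_dim.le
  calc (X ^ (j : ℕ) * M.charpoly).natDegree ≤ j + Fintype.card n :=
        natDegree_mul_le.trans (add_le_add (natDegree_X_pow_le _) hM)
    _ < Fintype.card n + k := by omega

/-- The multilinear map `l ↦ charpolyDet l M`. -/
noncomputable def charpolyDetMultilinear (k : ℕ) (M : Matrix n n A) :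
    MultilinearMap K (fun _ : Fin k => K[X] →ₗ[K] K) A :=
  (Matrix.detRowAlternating.toMultilinearMap.restrictScalars K).compLinearMap
    fun _ => LinearMap.pi fun j : Fin k => coeffFunctionalHom (X ^ (j : ℕ) * M.charpoly)

theorem charpolyDet_eq_zero_of_eq (M : Matrix n n A) (l : Fin k → K[X] →ₗ[K] K) {i j : Fin k}
    (hij : i ≠ j) (h : l i = l j) : charpolyDet l M = 0 :=
  Matrix.det_zero_of_row_eq hij (by ext a; simp [h])

/-- Precomposition of a functional on polynomials with `1 - s d/dX`. -/
noncomputable def subDeriv (s : K) : (K[X] →ₗ[K] K) →ₗ[K] (K[X] →ₗ[K] K) :=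
  LinearMap.lcomp K K (1 - s • (derivative : K[X] →ₗ[K] K[X]))

theorem subDeriv_apply (s : K) (l : K[X] →ₗ[K] K) (p : K[X]) :
    subDeriv s l p = l (p - s • derivative p) := rfl

/-- The matrix `G + s ξ ξ*` over the polynomial ring in `ξ` and `conj ξ`. -/
noncomputable def rankOnePerturbation (s : ℂ) (G : Matrix n n ℂ) :
    Matrix n n (MvPolynomial (n ⊕ n) ℂ) :=
  Matrix.of fun a b => MvPolynomial.C (G a b) +
    MvPolynomial.C s * (MvPolynomial.X (Sum.inl a) * MvPolynomial.X (Sum.inr b))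

theorem scalar_sub_rankOnePerturbation (s : ℂ) (G : Matrix n n ℂ) (x : ℂ) :
    Matrix.scalar n (MvPolynomial.C x) - rankOnePerturbation s G =
      (Matrix.scalar n x - G).map MvPolynomial.C +
        (Matrix.replicateCol Unit fun a => -MvPolynomial.C s * MvPolynomial.X (Sum.inl a) :
            Matrix n Unit (MvPolynomial (n ⊕ n) ℂ)) *
          (Matrix.replicateRow Unit fun b => MvPolynomial.X (Sum.inr b) :
            Matrix Unit n (MvPolynomial (n ⊕ n) ℂ)) := by
  ext1 a b
  simp only [rankOnePerturbation, Matrix.sub_apply, Matrix.of_apply, Matrix.add_apply,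
    Matrix.map_apply, Matrix.mul_apply, Matrix.replicateCol_apply, Matrix.replicateRow_apply,
    Finset.univ_unique, Finset.sum_singleton, Matrix.scalar_apply, Matrix.diagonal_apply]
  split_ifs <;> simp <;> ring

theorem det_scalar_sub_rankOnePerturbation (s : ℂ) {G : Matrix n n ℂ} {x : ℂ}
    (hx : G.charpoly.eval x ≠ 0) :
    (Matrix.scalar n (MvPolynomial.C x) - rankOnePerturbation s G).det =
      MvPolynomial.C (G.charpoly.eval x) *
        (1 - MvPolynomial.C s * hermitianQuadForm (Matrix.scalar n x - G)⁻¹) := by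
  have hdet : ((Matrix.scalar n x - G).map (MvPolynomial.C (σ := n ⊕ n))).det =
      MvPolynomial.C (G.charpoly.eval x) := by
    rw [Matrix.eval_charpoly, RingHom.map_det, RingHom.mapMatrix_apply]
  have hunit : IsUnit ((Matrix.scalar n x - G).map (MvPolynomial.C (σ := n ⊕ n))).det := by
    rw [hdet]
    exact (IsUnit.mk0 _ hx).map MvPolynomial.C
  rw [scalar_sub_rankOnePerturbation, Matrix.det_add_replicateCol_mul_replicateRow hunit, hdet,
    inv_map_of_isUnit_det _ (isUnit_det_scalar_sub hx), Matrix.det_unique]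
  simp only [Matrix.add_apply, Matrix.one_apply_eq, Matrix.mul_apply, Matrix.replicateRow_apply,
    Matrix.replicateCol_apply, Matrix.map_apply, hermitianQuadForm_apply, sub_eq_add_neg,
    Finset.mul_sum, Finset.sum_mul, ← Finset.sum_neg_distrib]
  rw [Finset.sum_comm]
  congr 2
  exact Finset.sum_congr rfl fun a _ => Finset.sum_congr rfl fun b _ => by ring

theorem gaussianExpectation_charpolyDet_leval_of_injective (s : ℂ) (G : Matrix n n ℂ)
    {x : Fin k → ℂ} (hx : Function.Injective x) (hG : ∀ i, G.charpoly.eval (x i) ≠ 0) :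
    gaussianExpectation n (charpolyDet (fun i => leval (x i)) (rankOnePerturbation s G)) =
      charpolyDet (fun i => subDeriv s (leval (x i))) G := by
  have hcorrelation := firstOrderDet_eq_vandermonde_mul_quadFormCorrelation s
    (S := {a : ℂ | G.charpoly.eval a ≠ 0}) (R := fun y => (Matrix.scalar n y - G)⁻¹)
    (fun _ ha _ hb => resolvent_identity ha hb) x hx hG
  rw [quadFormCorrelation] at hcorrelation
  rw [charpolyDet_leval]
  simp only [MvPolynomial.algebraMap_eq, det_scalar_sub_rankOnePerturbation s (hG _),
    Finset.prod_mul_distrib]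
  rw [← map_prod, gaussianExpectation_C_mul, gaussianExpectation_C_mul, mul_left_comm,
    ← hcorrelation, firstOrderDet, ← Matrix.det_mul_column, charpolyDet]
  congr 1
  ext i j
  simp only [Matrix.of_apply, coeffFunctional_self, subDeriv_apply, firstOrderFunctional_apply,
    leval_apply, eval_sub, eval_smul, derivative_mul, eval_add, eval_mul, smul_eq_mul,
    eval_derivative_charpoly_eq_mul_trace_inv (hG i)]
  ring

theorem gaussianExpectation_charpolyDet_leval (s : ℂ) (G : Matrix n n ℂ) {x : Fin k → ℂ}
    (hG : ∀ i, G.charpoly.eval (x i) ≠ 0) :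
    gaussianExpectation n (charpolyDet (fun i => leval (x i)) (rankOnePerturbation s G)) =
      charpolyDet (fun i => subDeriv s (leval (x i))) G := by
  by_cases hx : Function.Injective x
  · exact gaussianExpectation_charpolyDet_leval_of_injective s G hx hG
  · obtain ⟨i, j, hij, hne⟩ := Function.not_injective_iff.1 hx
    rw [charpolyDet_eq_zero_of_eq _ _ hne (by rw [hij]), map_zero,
      charpolyDet_eq_zero_of_eq _ _ hne (by rw [hij])]

-- Both sides are multilinear in `l` and only see polynomials of bounded degree, on which every
-- functional is a combination of evaluations at points off the spectrum of `G`.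
theorem gaussianExpectation_charpolyDet (s : ℂ) (G : Matrix n n ℂ) (l : Fin k → ℂ[X] →ₗ[ℂ] ℂ) :
    gaussianExpectation n (charpolyDet l (rankOnePerturbation s G)) =
      charpolyDet (fun i => subDeriv s (l i)) G := by
  obtain ⟨t, ht, htG⟩ := exists_injective_eval_ne_zero G.charpoly_monic.ne_zero
    (Fintype.card n + k)
  let f : MultilinearMap ℂ (fun _ : Fin k => ℂ[X] →ₗ[ℂ] ℂ) ℂ :=
    (gaussianExpectation n).compMultilinearMap (charpolyDetMultilinear k (rankOnePerturbation s G))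
  let g : MultilinearMap ℂ (fun _ : Fin k => ℂ[X] →ₗ[ℂ] ℂ) ℂ :=
    (charpolyDetMultilinear k G).compLinearMap fun _ => subDeriv s
  let l' : Fin k → ℂ[X] →ₗ[ℂ] ℂ := fun i =>
    ∑ j, l i (Lagrange.basis Finset.univ t j) • leval (t j)
  have hX {m : ℕ} (hm : m < Fintype.card n + k) :
      ((X : ℂ[X]) ^ m).degree < (Fintype.card n + k : ℕ) := by
    rw [degree_X_pow]
    exact_mod_cast hm
  have hleft : charpolyDet l (rankOnePerturbation s G) = charpolyDet l' (rankOnePerturbation s G) :=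
    charpolyDet_congr _ fun i m hm => functional_eq_sum_basis_smul_leval ht _ (hX hm)
  have hright : charpolyDet (fun i => subDeriv s (l i)) G =
      charpolyDet (fun i => subDeriv s (l' i)) G :=
    charpolyDet_congr _ fun i m hm => functional_eq_sum_basis_smul_leval ht _ <|
      (degree_sub_le _ _).trans_lt <| max_lt (hX hm) <|
        (degree_smul_le _ _).trans_lt <| degree_derivative_le.trans_lt (hX hm)
  rw [hleft, hright]
  change f l' = g l'
  simp only [l', MultilinearMap.map_sum, MultilinearMap.map_smul_univ]
  exact Finset.sum_congr rfl fun v _ => congrArg _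
    (gaussianExpectation_charpolyDet_leval s G fun i => htG (v i))

end CharpolyDet

/-! ### Integration by parts against rank-one perturbations -/

section Pairing

open MvPolynomial

theorem derivation_aeval {R A σ : Type*} [CommSemiring R] [CommSemiring A] [Algebra R A] [Fintype σ]
    (D : Derivation R A A) (φ : σ → A) (f : MvPolynomial σ R) :
    D (aeval φ f) = ∑ i, aeval φ (pderiv i f) * D (φ i) := by
  classical
  induction f using MvPolynomial.induction_on with
  | C a => simp
  | add p q hp hq => simp only [map_add, hp, hq, add_mul, Finset.sum_add_distrib]
  | mul_X p j hp =>
    have hterm (i : σ) : aeval φ (pderiv i (p * X j)) * D (φ i) =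
        (if j = i then aeval φ p * D (φ i) else 0) +
          φ j * (aeval φ (pderiv i p) * D (φ i)) := by
      rw [Derivation.leibniz, pderiv_X, Pi.single_apply]
      split_ifs <;> simp [add_mul, mul_assoc]
    rw [map_mul, aeval_X, D.leibniz, hp]
    simp only [hterm, Finset.sum_add_distrib, Finset.sum_ite_eq, Finset.mem_univ, if_true,
      ← Finset.mul_sum, smul_eq_mul]

theorem hasDerivAt_functional_eval {𝕜 R : Type*} [NontriviallyNormedField 𝕜] [CommRing R]
    [Algebra 𝕜 R] (L : R →ₗ[𝕜] 𝕜) (P : Polynomial R) (c : 𝕜) :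
    HasDerivAt (fun c => L (P.eval (algebraMap 𝕜 R c)))
      (L ((Polynomial.derivative P).eval (algebraMap 𝕜 R c))) c := by
  have hmonomial (m : ℕ) (r : R) (c : 𝕜) :
      L ((Polynomial.monomial m r).eval (algebraMap 𝕜 R c)) = c ^ m * L r := by
    rw [Polynomial.eval_monomial, ← map_pow, mul_comm, ← Algebra.smul_def, map_smul, smul_eq_mul]
  induction P using Polynomial.induction_on' with
  | add p q hp hq =>
    simpa only [Polynomial.eval_add, Polynomial.derivative_add, map_add] using hp.fun_add hq
  | monomial m r =>
    rw [Polynomial.derivative_monomial]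
    simp only [hmonomial]
    refine ((hasDerivAt_pow m c).mul_const (L r)).congr_deriv ?_
    rw [mul_comm r, show (m : R) * r = m • r from (nsmul_eq_mul m r).symm, map_nsmul, nsmul_eq_mul]
    ring

theorem functional_det_mul {R S T n : Type*} [CommRing R] [Semiring S] [Module S R]
    [AddCommMonoid T] [Module S T] [Fintype n] [DecidableEq n] (Λ : n → R →ₗ[S] T) (L : R →ₗ[S] T)
    (M : Matrix n n R) {d : n}
    (hΛ : ∀ a r, ∑ b, Λ b (M a b * r) = if d = a then L r else 0) (e : n) (r : R) :
    Λ e (M.det * r) = L (M.adjugate e d * r) := by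
  have hadjugate (b : n) :
      ∑ a, Λ b (M a b * (M.adjugate e a * r)) = if e = b then Λ b (M.det * r) else 0 := by
    have hentry := congrFun (congrFun M.adjugate_mul e) b
    rw [Matrix.mul_apply, Matrix.smul_apply, Matrix.one_apply] at hentry
    simp only [← map_sum, mul_left_comm (M _ b), ← mul_assoc]
    rw [← Finset.sum_mul, hentry]
    split_ifs <;> simp
  calc Λ e (M.det * r) = ∑ a, ∑ b, Λ b (M a b * (M.adjugate e a * r)) := by
        rw [Finset.sum_comm]
        simp [hadjugate]
    _ = L (M.adjugate e d * r) := by simp [hΛ]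

variable {n : Type*}

/-- The pairing `E (f (g) h (conj g))` of polynomials in Gaussian variables. -/
noncomputable def gaussianPairing [Fintype n] (f h : MvPolynomial n ℂ) : ℂ :=
  gaussianExpectation n (rename Sum.inl f * rename Sum.inr h)

theorem eval_withConj_rename_mul_rename (z : n → ℂ) (f h : MvPolynomial n ℂ) :
    eval (withConj z) (rename Sum.inl f * rename Sum.inr h) =
      eval z f * eval (fun p => conj (z p)) h := by
  rw [map_mul, eval_rename, eval_rename]
  rfl

/-- `f` evaluated at the matrix `g + c ξ ξ*`, where the index type `n × n ⊕ n` lists the entries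
of `g` and of `ξ`, and its second copy lists their conjugates. -/
noncomputable def perturbedEval (c : ℂ) :
    MvPolynomial (n × n) ℂ →ₐ[ℂ] MvPolynomial ((n × n ⊕ n) ⊕ (n × n ⊕ n)) ℂ :=
  aeval fun p => X (Sum.inl (Sum.inl p)) +
    C c * (X (Sum.inl (Sum.inr p.1)) * X (Sum.inr (Sum.inr p.2)))

/-- `h` evaluated at the matrix `conj g`. -/
noncomputable def conjEval :
    MvPolynomial (n × n) ℂ →ₐ[ℂ] MvPolynomial ((n × n ⊕ n) ⊕ (n × n ⊕ n)) ℂ :=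
  aeval fun p => X (Sum.inr (Sum.inl p))

theorem eval_withConj_perturbedEval (c : ℂ) (z : n × n → ℂ) (w : n → ℂ)
    (f : MvPolynomial (n × n) ℂ) :
    eval (withConj (Sum.elim z w)) (perturbedEval c f) =
      eval (fun p => z p + c * (w p.1 * conj (w p.2))) f := by
  rw [perturbedEval, ← coe_aeval_eq_eval, RingHom.coe_coe, comp_aeval_apply, ← coe_aeval_eq_eval]
  simp [withConj]

theorem eval_withConj_conjEval (z : n × n → ℂ) (w : n → ℂ) (h : MvPolynomial (n × n) ℂ) :
    eval (withConj (Sum.elim z w)) (conjEval h) = eval (fun p => conj (z p)) h := by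
  rw [conjEval, ← coe_aeval_eq_eval, RingHom.coe_coe, comp_aeval_apply, ← coe_aeval_eq_eval]
  simp [withConj]

theorem eval_withConj_aeval_rankOnePerturbation (c : ℂ) (G : Matrix n n ℂ) (w : n → ℂ)
    (f : MvPolynomial (n × n) ℂ) :
    eval (withConj w) (aeval (fun p => rankOnePerturbation c G p.1 p.2) f) =
      eval (fun p => G p.1 p.2 + c * (w p.1 * conj (w p.2))) f := by
  rw [← coe_aeval_eq_eval, RingHom.coe_coe, comp_aeval_apply, ← coe_aeval_eq_eval]
  simp [withConj, rankOnePerturbation]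

theorem pderiv_inl_conjEval [Finite n] (i : n × n ⊕ n) (h : MvPolynomial (n × n) ℂ) :
    pderiv (Sum.inl i) (conjEval h) = 0 := by
  classical
  cases nonempty_fintype n
  rw [conjEval, derivation_aeval]
  simp [pderiv_X]

theorem pderiv_entry_perturbedEval [Finite n] (c : ℂ) (p : n × n) (f : MvPolynomial (n × n) ℂ) :
    pderiv (Sum.inl (Sum.inl p)) (perturbedEval c f) = perturbedEval c (pderiv p f) := by
  classical
  cases nonempty_fintype n
  rw [perturbedEval, derivation_aeval]
  simp [pderiv_X, Pi.single_apply]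

/-- `perturbedEval` with the strength `c` of the perturbation as a polynomial variable. -/
noncomputable def perturbedEvalPoly :
    MvPolynomial (n × n) ℂ →ₐ[ℂ] Polynomial (MvPolynomial ((n × n ⊕ n) ⊕ (n × n ⊕ n)) ℂ) :=
  aeval fun p => Polynomial.C (X (Sum.inl (Sum.inl p))) +
    Polynomial.X * Polynomial.C (X (Sum.inl (Sum.inr p.1)) * X (Sum.inr (Sum.inr p.2)))

theorem eval_perturbedEvalPoly (c : ℂ) (f : MvPolynomial (n × n) ℂ) :
    (perturbedEvalPoly f).eval (C c) = perturbedEval c f := by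
  induction f using MvPolynomial.induction_on with
  | C a => simp [perturbedEval, perturbedEvalPoly, Polynomial.algebraMap_apply]
  | add p q hp hq => simp only [map_add, Polynomial.eval_add, hp, hq]
  | mul_X q j hq =>
    rw [map_mul, Polynomial.eval_mul, hq, map_mul]
    simp [perturbedEval, perturbedEvalPoly]

theorem eval_map_conjEval (E : Polynomial (MvPolynomial (n × n) ℂ)) (c : ℂ) :
    (E.map (conjEval : _ →ₐ[ℂ] _).toRingHom).eval (C c) = conjEval (E.eval (C c)) := by
  have hC : C c = (conjEval (n := n)).toRingHom (C c) := by simp [conjEval]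
  rw [hC, Polynomial.eval_map_apply]
  rfl

variable [Fintype n]

theorem gaussianExpectation_perturbedEval_mul_conjEval {c : ℂ} {f fT : MvPolynomial (n × n) ℂ}
    (hT : ∀ G : Matrix n n ℂ, eval (fun p => G p.1 p.2) fT =
      gaussianExpectation n (aeval (fun p => rankOnePerturbation c G p.1 p.2) f))
    (h : MvPolynomial (n × n) ℂ) :
    gaussianExpectation _ (perturbedEval c f * conjEval h) = gaussianPairing fT h := by
  refine gaussianExpectation_sum (p := fun z => C (eval (fun p => conj (z p)) h) *
    aeval (fun p => rankOnePerturbation c (Matrix.of fun a b => z (a, b)) p.1 p.2) f)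
    (fun z w => ?_) fun z => ?_
  · rw [map_mul, map_mul, eval_C, eval_withConj_perturbedEval, eval_withConj_conjEval,
      eval_withConj_aeval_rankOnePerturbation, mul_comm]
    rfl
  · rw [eval_withConj_rename_mul_rename, gaussianExpectation_C_mul, ← hT, mul_comm]
    rfl

theorem gaussianExpectation_aeval_rankOnePerturbation_zero (G : Matrix n n ℂ)
    (f : MvPolynomial (n × n) ℂ) :
    gaussianExpectation n (aeval (fun p => rankOnePerturbation 0 G p.1 p.2) f) =
      eval (fun p => G p.1 p.2) f := by
  simp only [gaussianExpectation_apply, eval_withConj_aeval_rankOnePerturbation, zero_mul, add_zero,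
    integral_const, probReal_univ, one_smul]

theorem pderiv_vector_perturbedEval (c : ℂ) (a : n) (f : MvPolynomial (n × n) ℂ) :
    pderiv (Sum.inl (Sum.inr a)) (perturbedEval c f) =
      C c * ∑ b, X (Sum.inr (Sum.inr b)) * perturbedEval c (pderiv (a, b) f) := by
  classical
  rw [perturbedEval, derivation_aeval, Fintype.sum_prod_type, Finset.mul_sum,
    Finset.sum_eq_single a]
  · refine Finset.sum_congr rfl fun b _ => ?_
    simp [pderiv_X]
    ring
  · intro a' _ ha'
    simp [pderiv_X, ha']
  · simp

theorem gaussianExpectation_perturbedEval_entry (c : ℂ) (d b : n) (p : n × n)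
    (f h : MvPolynomial (n × n) ℂ) :
    gaussianExpectation _ (X (Sum.inl (Sum.inr d)) * X (Sum.inr (Sum.inr b)) *
        (perturbedEval c f * conjEval (X p * h))) =
      gaussianExpectation _ (X (Sum.inl (Sum.inr d)) * X (Sum.inr (Sum.inr b)) *
        (perturbedEval c (pderiv p f) * conjEval h)) := by
  classical
  have hpull : X (Sum.inl (Sum.inr d)) * X (Sum.inr (Sum.inr b)) *
        (perturbedEval c f * conjEval (X p * h)) = X (Sum.inr (Sum.inl p)) *
      (X (Sum.inl (Sum.inr d)) * X (Sum.inr (Sum.inr b)) * (perturbedEval c f * conjEval h)) := by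
    rw [map_mul, show conjEval (X p : MvPolynomial (n × n) ℂ) = _ from aeval_X _ _]
    ring
  rw [hpull, gaussianExpectation_X_inr_mul]
  simp only [Derivation.leibniz, pderiv_inl_conjEval, pderiv_entry_perturbedEval, pderiv_X]
  simp [mul_comm (conjEval h)]

theorem eval_derivative_perturbedEvalPoly (c : ℂ) (f : MvPolynomial (n × n) ℂ) :
    (Polynomial.derivative (perturbedEvalPoly f)).eval (C c) =
      ∑ a, ∑ b, X (Sum.inl (Sum.inr a)) * X (Sum.inr (Sum.inr b)) *
        perturbedEval c (pderiv (a, b) f) := by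
  have hderiv := derivation_aeval ((Polynomial.derivative'
    (R := MvPolynomial ((n × n ⊕ n) ⊕ (n × n ⊕ n)) ℂ)).restrictScalars ℂ) (fun p : n × n =>
      Polynomial.C (X (Sum.inl (Sum.inl p))) +
        Polynomial.X * Polynomial.C (X (Sum.inl (Sum.inr p.1)) * X (Sum.inr (Sum.inr p.2)))) f
  rw [perturbedEvalPoly, show Polynomial.derivative _ = _ from hderiv, Polynomial.eval_finsetSum,
    Fintype.sum_prod_type]
  refine Finset.sum_congr rfl fun a _ => Finset.sum_congr rfl fun b _ => ?_
  rw [Polynomial.eval_mul, ← perturbedEvalPoly, eval_perturbedEvalPoly, mul_comm]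
  simp

variable [DecidableEq n]

theorem gaussianExpectation_perturbedEval_vector (c : ℂ) (d a : n)
    (f h : MvPolynomial (n × n) ℂ) :
    gaussianExpectation _ (X (Sum.inl (Sum.inr d)) * X (Sum.inr (Sum.inr a)) *
        (perturbedEval c f * conjEval h)) =
      (if d = a then gaussianExpectation _ (perturbedEval c f * conjEval h) else 0) +
      c * ∑ b, gaussianExpectation _ (X (Sum.inl (Sum.inr d)) * X (Sum.inr (Sum.inr b)) *
        (perturbedEval c f * conjEval (X (a, b) * h))) := by
  simp only [gaussianExpectation_perturbedEval_entry]
  have hderiv : pderiv (Sum.inl (Sum.inr a))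
      (X (Sum.inl (Sum.inr d)) * (perturbedEval c f * conjEval h)) =
      (if d = a then perturbedEval c f * conjEval h else 0) +
        C c * ∑ b, X (Sum.inl (Sum.inr d)) * X (Sum.inr (Sum.inr b)) *
          (perturbedEval c (pderiv (a, b) f) * conjEval h) := by
    simp only [Derivation.leibniz, pderiv_inl_conjEval, pderiv_vector_perturbedEval, pderiv_X,
      Pi.single_apply, Sum.inl.injEq, Sum.inr.injEq, smul_eq_mul, Finset.mul_sum]
    rw [add_comm]
    congr 1
    · split_ifs <;> simp
    · rw [mul_zero, zero_add, Finset.mul_sum]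
      exact Finset.sum_congr rfl fun b _ => by ring
  rw [mul_comm (X (Sum.inl _)), mul_assoc, gaussianExpectation_X_inr_mul, hderiv, map_add,
    gaussianExpectation_C_mul, map_sum]
  split_ifs <;> simp

theorem gaussianExpectation_perturbedEval_det (c : ℂ) (d e : n) (f h : MvPolynomial (n × n) ℂ) :
    gaussianExpectation _ (X (Sum.inl (Sum.inr d)) * X (Sum.inr (Sum.inr e)) *
        (perturbedEval c f *
          conjEval ((1 - (C c : MvPolynomial (n × n) ℂ) • Matrix.mvPolynomialX n n ℂ).det * h))) =
      gaussianExpectation _ (perturbedEval c f * conjEval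
        ((1 - (C c : MvPolynomial (n × n) ℂ) • Matrix.mvPolynomialX n n ℂ).adjugate e d * h)) := by
  let L : MvPolynomial (n × n) ℂ →ₗ[ℂ] ℂ :=
    gaussianExpectation _ ∘ₗ LinearMap.mulLeft ℂ (perturbedEval c f) ∘ₗ conjEval.toLinearMap
  let Λ : n → MvPolynomial (n × n) ℂ →ₗ[ℂ] ℂ := fun b =>
    gaussianExpectation _ ∘ₗ LinearMap.mulLeft ℂ (X (Sum.inl (Sum.inr d)) * X (Sum.inr (Sum.inr b)))
      ∘ₗ LinearMap.mulLeft ℂ (perturbedEval c f) ∘ₗ conjEval.toLinearMap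
  refine functional_det_mul Λ L _ (fun a r => ?_) e h
  have hvector : Λ a r = (if d = a then L r else 0) + c * ∑ b, Λ b (X (a, b) * r) :=
    gaussianExpectation_perturbedEval_vector c d a f r
  have hentry (b : n) :
      Λ b ((1 - (C c : MvPolynomial (n × n) ℂ) • Matrix.mvPolynomialX n n ℂ) a b * r) =
        (if a = b then Λ b r else 0) - c * Λ b (X (a, b) * r) := by
    rw [Matrix.sub_apply, Matrix.smul_apply, Matrix.one_apply, Matrix.mvPolynomialX_apply, sub_mul,
      map_sub, smul_eq_mul, mul_assoc, ← smul_eq_C_mul, map_smul, smul_eq_mul]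
    split_ifs <;> simp
  simp only [hentry, Finset.sum_sub_distrib, Finset.sum_ite_eq, Finset.mem_univ, if_true,
    ← Finset.mul_sum, hvector, add_sub_cancel_right]

-- The strength `c` enters through the perturbation `c ξ ξ*` and through the determinant. The two
-- contributions to the derivative in `c` cancel, by integrating by parts in `g` and in `ξ`.
theorem gaussianExpectation_perturbedEval_const (c : ℂ) (f h : MvPolynomial (n × n) ℂ) :
    gaussianExpectation _ (perturbedEval c f *
        conjEval ((1 - (C c : MvPolynomial (n × n) ℂ) • Matrix.mvPolynomialX n n ℂ).det * h)) =
      gaussianExpectation _ (perturbedEval 0 f * conjEval h) := by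
  let P : Polynomial (MvPolynomial ((n × n ⊕ n) ⊕ (n × n ⊕ n)) ℂ) :=
    perturbedEvalPoly f * ((Matrix.mvPolynomialX n n ℂ).charpolyRev.map
      (conjEval : _ →ₐ[ℂ] _).toRingHom * Polynomial.C (conjEval h))
  have hP (c : ℂ) : P.eval (C c) = perturbedEval c f *
      conjEval ((1 - (C c : MvPolynomial (n × n) ℂ) • Matrix.mvPolynomialX n n ℂ).det * h) := by
    rw [Polynomial.eval_mul, eval_perturbedEvalPoly, Polynomial.eval_mul, eval_map_conjEval,
      eval_charpolyRev_eq_det, Polynomial.eval_C, map_mul]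
  have hP' (c : ℂ) : gaussianExpectation _ ((Polynomial.derivative P).eval (C c)) = 0 := by
    simp only [P, Polynomial.derivative_mul, Polynomial.derivative_C, mul_zero, add_zero,
      Polynomial.derivative_map, Polynomial.eval_add, Polynomial.eval_mul, eval_map_conjEval,
      Polynomial.eval_C, eval_perturbedEvalPoly, eval_derivative_perturbedEvalPoly,
      eval_charpolyRev_eq_det, eval_derivative_charpolyRev]
    rw [← map_mul, ← map_mul, map_add]
    simp only [neg_mul, Finset.sum_mul, map_neg, mul_neg, map_sum, Finset.mul_sum]
    rw [← sub_eq_add_neg, sub_eq_zero]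
    refine Finset.sum_congr rfl fun a _ => Finset.sum_congr rfl fun b _ => ?_
    rw [mul_assoc, ← gaussianExpectation_perturbedEval_entry, mul_left_comm (X (a, b)),
      gaussianExpectation_perturbedEval_det, Matrix.mvPolynomialX_apply, mul_assoc]
  have hconst := is_const_of_deriv_eq_zero (𝕜 := ℂ)
    (fun c => (hasDerivAt_functional_eval (gaussianExpectation _) P c).differentiableAt)
    (fun c => (hasDerivAt_functional_eval (gaussianExpectation _) P c).deriv.trans (hP' c)) c 0
  rw [MvPolynomial.algebraMap_eq, hP, hP, C_0, zero_smul, sub_zero, Matrix.det_one,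
    one_mul] at hconst
  exact hconst

theorem gaussianPairing_det_mul {c : ℂ} {f fT : MvPolynomial (n × n) ℂ}
    (hT : ∀ G : Matrix n n ℂ, eval (fun p => G p.1 p.2) fT =
      gaussianExpectation n (aeval (fun p => rankOnePerturbation c G p.1 p.2) f))
    (h : MvPolynomial (n × n) ℂ) :
    gaussianPairing fT
        ((1 - (C c : MvPolynomial (n × n) ℂ) • Matrix.mvPolynomialX n n ℂ).det * h) =
      gaussianPairing f h := by
  rw [← gaussianExpectation_perturbedEval_mul_conjEval hT, gaussianExpectation_perturbedEval_const,
    gaussianExpectation_perturbedEval_mul_conjEval fun G =>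
      (gaussianExpectation_aeval_rankOnePerturbation_zero G f).symm]

end Pairing

/-! ### Polynomials in the differentiation operator -/

section DifferentialOperators

open Polynomial

/-- The partial sum of order `n` of the exponential series. -/
noncomputable def expPartialSum (n : ℕ) (x : ℂ) : ℂ :=
  ∑ m ∈ Finset.range (n + 1), x ^ m / (m.factorial : ℂ)

/-- The differential operator with constant coefficients and symbol `p`, acting on polynomials. -/
noncomputable def diffOp : ℂ[X] →ₐ[ℂ] Module.End ℂ ℂ[X] :=
  aeval (derivative : ℂ[X] →ₗ[ℂ] ℂ[X])

theorem diffOp_mul (p q r : ℂ[X]) : diffOp (p * q) r = diffOp p (diffOp q r) := by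
  rw [map_mul, Module.End.mul_apply]

theorem diffOp_X_pow (d : ℕ) (p : ℂ[X]) : diffOp (X ^ d) p = derivative^[d] p := by
  simp [diffOp, Module.End.pow_apply]

theorem diffOp_C_mul (c : ℂ) (p q : ℂ[X]) : diffOp (C c * p) q = c • diffOp p q := by
  rw [← smul_eq_C_mul, map_smul, LinearMap.smul_apply]

theorem diffOp_sum {ι : Type*} (s : Finset ι) (f : ι → ℂ[X]) (p : ℂ[X]) :
    diffOp (∑ i ∈ s, f i) p = ∑ i ∈ s, diffOp (f i) p := by
  rw [map_sum, LinearMap.sum_apply]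

theorem diffOp_one_sub (p q : ℂ[X]) : diffOp (1 - p) q = q - diffOp p q := by
  rw [map_sub, map_one, LinearMap.sub_apply, Module.End.one_apply]

theorem diffOp_one_sub_C_mul_X (c : ℂ) (p : ℂ[X]) :
    diffOp (1 - C c * X) p = p - c • derivative p := by
  rw [diffOp_one_sub, diffOp_C_mul, ← pow_one (X : ℂ[X]), diffOp_X_pow, Function.iterate_one]

theorem diffOp_prod_one_sub_pow {ι : Type*} (s : Finset ι) (c : ι → ℂ) {n : ℕ} {p : ℂ[X]}
    (hp : p.natDegree ≤ n) : diffOp (∏ i ∈ s, (1 - (C (c i) * X) ^ (n + 1))) p = p := by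
  classical
  induction s using Finset.induction_on with
  | empty => rw [Finset.prod_empty, map_one, Module.End.one_apply]
  | insert a s ha ih =>
    rw [Finset.prod_insert ha, diffOp_mul, ih, diffOp_one_sub, mul_pow, ← C_pow, diffOp_C_mul,
      diffOp_X_pow, iterate_derivative_eq_zero (by lia), smul_zero, sub_zero]

/-- The truncated geometric series `∑_{r ≤ n} (c X)^r`. -/
noncomputable def geomPoly (n : ℕ) (c : ℂ) : ℂ[X] := ∑ r ∈ Finset.range (n + 1), (C c * X) ^ r

theorem geomPoly_mul_one_sub (n : ℕ) (c : ℂ) :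
    geomPoly n c * (1 - C c * X) = 1 - (C c * X) ^ (n + 1) := geom_sum_mul_neg _ _

theorem eval_diffOp_geomPoly (n : ℕ) {y : ℂ} (hy : y ≠ 0) (x : ℂ) :
    (diffOp (geomPoly n y⁻¹) (X ^ n)).eval x =
      n.factorial * y⁻¹ ^ n * expPartialSum n (x * y) := by
  rw [geomPoly, diffOp_sum, eval_finsetSum, expPartialSum, Finset.mul_sum,
    ← Finset.sum_range_reflect, Nat.add_sub_cancel]
  refine Finset.sum_congr rfl fun m hm => ?_
  obtain ⟨r, rfl⟩ := Nat.exists_eq_add_of_le (Nat.lt_succ_iff.1 (Finset.mem_range.1 hm))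
  have hfactorial : (m.factorial : ℂ) * (m + r).descFactorial r = (m + r).factorial := by
    have h := Nat.factorial_mul_descFactorial (Nat.le_add_left r m)
    rw [Nat.add_sub_cancel] at h
    exact_mod_cast h
  have hm0 : (m.factorial : ℂ) ≠ 0 := Nat.cast_ne_zero.2 m.factorial_ne_zero
  rw [mul_pow, ← C_pow, diffOp_C_mul, diffOp_X_pow, iterate_derivative_X_pow_eq_smul, eval_smul,
    eval_smul, eval_pow, eval_X, smul_eq_mul, smul_eq_mul, Nat.add_sub_cancel_left,
    Nat.add_sub_cancel, ← hfactorial, pow_add, mul_pow, inv_pow,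
    inv_pow]
  field_simp

variable {k : ℕ} {y : Fin k → ℂ}

/-- The normalising factor of the Lagrange basis polynomial `∏_{m ≠ i} (1 - X / y_m)` at the node
`y_i`. -/
noncomputable def lagrangeWeight (y : Fin k → ℂ) (i : Fin k) : ℂ :=
  ∏ m ∈ ({i}ᶜ : Finset (Fin k)), (1 - (y m)⁻¹ * y i)⁻¹

theorem degree_prod_one_sub_lt (y : Fin k → ℂ) (l : Fin k) :
    (∏ m ∈ ({l}ᶜ : Finset (Fin k)), (1 - C (y m)⁻¹ * X : ℂ[X])).degree < (k : WithBot ℕ) := by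
  have hlinear (m : Fin k) : (1 - C (y m)⁻¹ * X : ℂ[X]).degree ≤ 1 := by compute_degree
  refine ((degree_prod_le _ _).trans (Finset.sum_le_card_nsmul _ _ 1 fun m _ => hlinear m)).trans_lt
    ?_
  rw [Finset.card_compl, Fintype.card_fin, Finset.card_singleton, nsmul_one, Nat.cast_withBot,
    Nat.cast_withBot, WithBot.coe_lt_coe]
  exact Nat.sub_lt l.pos one_pos

theorem lagrangeWeight_mul_prod (hy : Function.Injective y) (hy0 : ∀ i, y i ≠ 0) (i : Fin k) :
    lagrangeWeight y i * ∏ m ∈ ({i}ᶜ : Finset (Fin k)), (1 - (y m)⁻¹ * y i) = 1 := by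
  rw [lagrangeWeight, ← Finset.prod_mul_distrib]
  refine Finset.prod_eq_one fun m hm => inv_mul_cancel₀ (sub_ne_zero.2 fun h => ?_)
  exact Finset.mem_compl.1 hm (Finset.mem_singleton.2 (hy ((inv_mul_eq_one₀ (hy0 m)).1 h.symm)))

theorem sum_lagrangeWeight (hy : Function.Injective y) (hy0 : ∀ i, y i ≠ 0) {d : ℕ} (hd : d < k) :
    ∑ l, C (lagrangeWeight y l * y l ^ d) *
      ∏ m ∈ ({l}ᶜ : Finset (Fin k)), (1 - C (y m)⁻¹ * X) = X ^ d := by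
  refine Polynomial.eq_of_degrees_lt_of_eval_index_eq (v := y) Finset.univ hy.injOn ?_ ?_
    fun i _ => ?_
  · rw [Finset.card_univ, Fintype.card_fin]
    refine (degree_sum_le _ _).trans_lt ((Finset.sup_lt_iff (WithBot.bot_lt_coe k)).2 fun l _ => ?_)
    rw [← smul_eq_C_mul]
    exact (degree_smul_le _ _).trans_lt (degree_prod_one_sub_lt y l)
  · rw [degree_X_pow, Finset.card_univ, Fintype.card_fin]
    exact_mod_cast hd
  · rw [eval_finsetSum, Finset.sum_eq_single i]
    · simp only [eval_mul, eval_C, eval_prod, eval_pow, eval_X, eval_sub, eval_one]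
      rw [mul_right_comm, lagrangeWeight_mul_prod hy hy0, one_mul]
    · intro l _ hl
      rw [eval_mul, eval_prod, Finset.prod_eq_zero (i := i) (by simp [hl.symm]) (by simp [hy0 i]),
        mul_zero]
    · simp

theorem prod_geomPoly_mul_prod_one_sub (n : ℕ) (c : Fin k → ℂ) (l : Fin k) :
    (∏ m, geomPoly n (c m)) * ∏ m ∈ ({l}ᶜ : Finset (Fin k)), (1 - C (c m) * X) =
      geomPoly n (c l) * ∏ m ∈ ({l}ᶜ : Finset (Fin k)), (1 - (C (c m) * X) ^ (n + 1)) := by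
  simp only [Fintype.prod_eq_mul_prod_compl l, ← geomPoly_mul_one_sub, Finset.prod_mul_distrib,
    mul_assoc]

theorem eval_diffOp_prod_geomPoly (hy : Function.Injective y) (hy0 : ∀ i, y i ≠ 0)
    {n d : ℕ} (hd : d < k) (hdn : d ≤ n) (x : ℂ) :
    (diffOp (∏ l, geomPoly n (y l)⁻¹) (X ^ (n - d))).eval x = (n - d).factorial *
      ∑ l, lagrangeWeight y l * (y l)⁻¹ ^ n * expPartialSum n (x * y l) * y l ^ d := by
  have hmul : (diffOp ((∏ l, geomPoly n (y l)⁻¹) * X ^ d) (X ^ n)).eval x = n.factorial *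
      ∑ l, lagrangeWeight y l * (y l)⁻¹ ^ n * expPartialSum n (x * y l) * y l ^ d := by
    rw [← sum_lagrangeWeight hy hy0 hd, Finset.mul_sum, diffOp_sum, eval_finsetSum,
      Finset.mul_sum]
    refine Finset.sum_congr rfl fun l _ => ?_
    rw [mul_left_comm, prod_geomPoly_mul_prod_one_sub n (fun m => (y m)⁻¹), diffOp_C_mul,
      diffOp_mul, diffOp_prod_one_sub_pow _ _ (natDegree_X_pow_le n), eval_smul,
      eval_diffOp_geomPoly n (hy0 l), smul_eq_mul]
    ring
  rw [diffOp_mul, diffOp_X_pow, iterate_derivative_X_pow_eq_smul, map_smul, eval_smul,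
    smul_eq_mul, ← Nat.factorial_mul_descFactorial hdn, Nat.cast_mul,
    mul_comm ((n - d).factorial : ℂ), mul_assoc] at hmul
  exact mul_left_cancel₀ (Nat.cast_ne_zero.2 (Nat.descFactorial_pos.2 hdn).ne') hmul

theorem prod_prod_compl_singleton (y : Fin k → ℂ) :
    ∏ i, ∏ m ∈ ({i}ᶜ : Finset (Fin k)), y m = (∏ l, y l) ^ (k - 1) := by
  rw [Finset.prod_comm' (t' := Finset.univ) (s' := fun m => {m}ᶜ) (by simp [eq_comm]),
    ← Finset.prod_pow]
  simp only [Finset.prod_const, Finset.card_compl, Fintype.card_fin, Finset.card_singleton]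

theorem prod_prod_compl_singleton_sub (y : Fin k → ℂ) :
    ∏ i, ∏ m ∈ ({i}ᶜ : Finset (Fin k)), (y m - y i) =
      (Matrix.projVandermonde 1 y).det * (Matrix.vandermonde y).det := by
  rw [← Finset.prod_prod_Ioi_mul_eq_prod_prod_off_diag (fun a b => y a - y b),
    Matrix.det_vandermonde, Matrix.det_projVandermonde]
  simp only [← Finset.prod_mul_distrib, Pi.one_apply, mul_one, mul_comm]

theorem prod_lagrangeWeight_mul_det (hy : Function.Injective y) (hy0 : ∀ i, y i ≠ 0) :
    (∏ l, lagrangeWeight y l) * (Matrix.of fun l (b : Fin k) => y l ^ (b.rev : ℕ)).det *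
      (Matrix.vandermonde y).det = (∏ l, y l) ^ (k - 1) := by
  have hproj : (Matrix.of fun l (b : Fin k) => y l ^ (b.rev : ℕ)) = Matrix.projVandermonde 1 y := by
    ext l b
    simp [Matrix.projVandermonde_apply]
  have hfactor (i m : Fin k) : y m - y i = y m * (1 - (y m)⁻¹ * y i) := by
    rw [mul_sub, mul_one, mul_inv_cancel_left₀ (hy0 m)]
  rw [hproj, mul_assoc, ← prod_prod_compl_singleton_sub, ← prod_prod_compl_singleton]
  simp only [hfactor, ← Finset.prod_mul_distrib]
  refine Finset.prod_congr rfl fun i _ => ?_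
  rw [Finset.prod_mul_distrib, mul_left_comm, lagrangeWeight_mul_prod hy hy0, mul_one]

theorem det_eval_diffOp_prod_geomPoly (hy : Function.Injective y) (hy0 : ∀ i, y i ≠ 0) (N : ℕ)
    (x : Fin k → ℂ) :
    (Matrix.of fun i (j : Fin k) =>
        (diffOp (∏ l, geomPoly (N + k - 1) (y l)⁻¹) (X ^ (N + j))).eval (x i)).det *
        (∏ l, y l) ^ N * (Matrix.vandermonde y).det =
      (∏ b : Fin k, ((N + b).factorial : ℂ)) *
        (Matrix.of fun i j => expPartialSum (N + k - 1) (x i * y j)).det := by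
  have hfactor : (Matrix.of fun i (j : Fin k) =>
      (diffOp (∏ l, geomPoly (N + k - 1) (y l)⁻¹) (X ^ (N + j))).eval (x i)) =
      Matrix.of fun i (j : Fin k) => ((N + j).factorial : ℂ) *
        ((Matrix.of fun i l => lagrangeWeight y l * (y l)⁻¹ ^ (N + k - 1) *
            (Matrix.of fun i j => expPartialSum (N + k - 1) (x i * y j)) i l) *
          (Matrix.of fun l (b : Fin k) => y l ^ (b.rev : ℕ))) i j := by
    ext i j
    rw [Matrix.of_apply, Matrix.of_apply, show N + j = N + k - 1 - j.rev by rw [Fin.val_rev]; lia,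
      eval_diffOp_prod_geomPoly hy hy0 j.rev.2 (by rw [Fin.val_rev]; lia)]
    rfl
  have hpow : (∏ l, (y l)⁻¹ ^ (N + k - 1)) * (∏ l, y l) ^ (k - 1) * (∏ l, y l) ^ N = 1 := by
    rw [Finset.prod_pow, Finset.prod_inv_distrib, mul_assoc, ← pow_add]
    rcases k.eq_zero_or_pos with rfl | hk
    · simp
    · rw [show k - 1 + N = N + k - 1 by lia, ← mul_pow, inv_mul_cancel₀, one_pow]
      exact Finset.prod_ne_zero_iff.2 fun i _ => hy0 i
  rw [hfactor, Matrix.det_mul_row, Matrix.det_mul, Matrix.det_mul_row, Finset.prod_mul_distrib]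
  linear_combination (∏ b : Fin k, ((N + b).factorial : ℂ)) *
    (Matrix.of fun i j => expPartialSum (N + k - 1) (x i * y j)).det *
    ((∏ l, (y l)⁻¹ ^ (N + k - 1)) * (∏ l, y l) ^ N * prod_lagrangeWeight_mul_det hy hy0 + hpow)

end DifferentialOperators

/-! ### The exact formula at finite size -/

section ExactFormula

open Polynomial

theorem eval_charpoly_eq_pow_mul_det_one_sub {A n : Type*} [CommRing A] [Fintype n] [DecidableEq n]
    (M : Matrix n n A) {c d : A} (hcd : c * d = 1) :
    M.charpoly.eval c = c ^ Fintype.card n * (1 - d • M).det := by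
  rw [Matrix.eval_charpoly, ← Matrix.det_smul, smul_sub, smul_smul, hcd, one_smul,
    Matrix.smul_one_eq_diagonal, Matrix.scalar_apply]

theorem gaussianExpectation_rename_inl {ι : Type*} [Fintype ι] (f : MvPolynomial ι ℂ) :
    gaussianExpectation ι (MvPolynomial.rename Sum.inl f) = MvPolynomial.eval 0 f := by
  induction f using MvPolynomial.induction_on' with
  | add p q hp hq => rw [map_add, map_add, map_add, hp, hq]
  | monomial m a =>
    rw [MvPolynomial.rename_monomial, gaussianExpectation_monomial, MvPolynomial.eval_monomial,
      Finsupp.prod_fintype _ _ (by simp)]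
    congr 1
    refine Finset.prod_congr rfl fun i _ => ?_
    rw [Finsupp.mapDomain_apply Sum.inl_injective, Finsupp.mapDomain_of_notMem_range _ _ (by simp)]
    by_cases h : m i = 0 <;> simp [h]

theorem gaussianPairing_C_mul_left {n : Type*} [Fintype n] (c : ℂ) (f h : MvPolynomial n ℂ) :
    gaussianPairing (MvPolynomial.C c * f) h = c * gaussianPairing f h := by
  rw [gaussianPairing, map_mul (MvPolynomial.rename Sum.inl), MvPolynomial.rename_C, mul_assoc,
    gaussianExpectation_C_mul, gaussianPairing]

theorem gaussianPairing_C_mul_right {n : Type*} [Fintype n] (c : ℂ) (f h : MvPolynomial n ℂ) :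
    gaussianPairing f (MvPolynomial.C c * h) = c * gaussianPairing f h := by
  rw [gaussianPairing, map_mul (MvPolynomial.rename Sum.inr), MvPolynomial.rename_C, mul_left_comm,
    gaussianExpectation_C_mul, gaussianPairing]

variable {n : Type*} [Fintype n] [DecidableEq n] {k : ℕ}

theorem aeval_charpolyDet_mvPolynomialX {A : Type*} [CommRing A] [Algebra ℂ A]
    (l : Fin k → ℂ[X] →ₗ[ℂ] ℂ) (M : Matrix n n A) :
    MvPolynomial.aeval (fun p : n × n => M p.1 p.2) (charpolyDet l (Matrix.mvPolynomialX n n ℂ)) =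
      charpolyDet l M := by
  rw [← charpolyDet_map, ← AlgHom.mapMatrix_apply, Matrix.mvPolynomialX_mapMatrix_aeval]

theorem gaussianPairing_charpolyDet_subDeriv (c : ℂ) (l : Fin k → ℂ[X] →ₗ[ℂ] ℂ)
    (h : MvPolynomial (n × n) ℂ) :
    gaussianPairing (charpolyDet (fun i => subDeriv c (l i)) (Matrix.mvPolynomialX n n ℂ))
        ((1 - (MvPolynomial.C c : MvPolynomial (n × n) ℂ) • Matrix.mvPolynomialX n n ℂ).det * h) =
      gaussianPairing (charpolyDet l (Matrix.mvPolynomialX n n ℂ)) h := by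
  refine gaussianPairing_det_mul (fun G => ?_) h
  rw [← MvPolynomial.coe_aeval_eq_eval, RingHom.coe_coe, aeval_charpolyDet_mvPolynomialX,
    aeval_charpolyDet_mvPolynomialX, gaussianExpectation_charpolyDet]

theorem gaussianPairing_charpolyDet_prod {ι : Type*} (s : Finset ι) (c : ι → ℂ)
    (l : Fin k → ℂ[X] →ₗ[ℂ] ℂ) :
    gaussianPairing (charpolyDet (fun i => l i ∘ₗ diffOp (∏ m ∈ s, (1 - C (c m) * X)))
        (Matrix.mvPolynomialX n n ℂ))
        (∏ m ∈ s, (1 - (MvPolynomial.C (c m) : MvPolynomial (n × n) ℂ) •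
          Matrix.mvPolynomialX n n ℂ).det) =
      gaussianPairing (charpolyDet l (Matrix.mvPolynomialX n n ℂ)) 1 := by
  classical
  induction s using Finset.induction_on with
  | empty => simp only [Finset.prod_empty, map_one]; rfl
  | insert a s ha ih =>
    have hsubDeriv (i : Fin k) : l i ∘ₗ diffOp (∏ m ∈ insert a s, (1 - C (c m) * X)) =
        subDeriv (c a) (l i ∘ₗ diffOp (∏ m ∈ s, (1 - C (c m) * X))) := by
      refine LinearMap.ext fun p => ?_
      rw [subDeriv_apply, ← diffOp_one_sub_C_mul_X, LinearMap.comp_apply, LinearMap.comp_apply,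
        ← diffOp_mul, Finset.prod_insert ha, mul_comm]
    rw [← ih]
    simp only [hsubDeriv]
    rw [Finset.prod_insert ha]
    exact gaussianPairing_charpolyDet_subDeriv _ _ _

theorem gaussianPairing_charpolyDet_one (l : Fin k → ℂ[X] →ₗ[ℂ] ℂ) :
    gaussianPairing (charpolyDet l (Matrix.mvPolynomialX n n ℂ)) 1 =
      (Matrix.of fun i (j : Fin k) => l i (X ^ (Fintype.card n + j))).det := by
  rw [gaussianPairing, map_one, mul_one, gaussianExpectation_rename_inl,
    ← MvPolynomial.coe_aeval_eq_eval, RingHom.coe_coe]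
  refine (aeval_charpolyDet_mvPolynomialX l (0 : Matrix n n ℂ)).trans ?_
  rw [charpolyDet]
  congr 1
  ext i j
  rw [Matrix.of_apply, Matrix.of_apply, coeffFunctional_self, Matrix.charpoly_zero, ← pow_add,
    add_comm]

theorem gaussianPairing_charpolyDet_leval (x : Fin k → ℂ) {y : Fin k → ℂ}
    (hy : Function.Injective y) (hy0 : ∀ i, y i ≠ 0) :
    gaussianPairing (charpolyDet (fun i => leval (x i)) (Matrix.mvPolynomialX n n ℂ))
        (∏ m, (1 - (MvPolynomial.C (y m)⁻¹ : MvPolynomial (n × n) ℂ) •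
          Matrix.mvPolynomialX n n ℂ).det) * (∏ l, y l) ^ Fintype.card n *
        (Matrix.vandermonde y).det =
      (∏ b : Fin k, ((Fintype.card n + b).factorial : ℂ)) *
        (Matrix.of fun i j => expPartialSum (Fintype.card n + k - 1) (x i * y j)).det := by
  -- The geometric series invert the operators `1 - (y m)⁻¹ d/dX` on the degrees that occur.
  have hinverse : charpolyDet (fun i => leval (x i)) (Matrix.mvPolynomialX n n ℂ) =
      charpolyDet (fun i => (leval (x i) ∘ₗ
          diffOp (∏ l, geomPoly (Fintype.card n + k - 1) (y l)⁻¹)) ∘ₗ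
        diffOp (∏ m, (1 - C (y m)⁻¹ * X))) (Matrix.mvPolynomialX n n ℂ) := by
    refine charpolyDet_congr _ fun i m hm => ?_
    rw [LinearMap.comp_apply, LinearMap.comp_apply, ← diffOp_mul, ← Finset.prod_mul_distrib]
    simp only [geomPoly_mul_one_sub]
    rw [diffOp_prod_one_sub_pow _ _ ((natDegree_X_pow_le m).trans (by lia))]
  rw [hinverse, gaussianPairing_charpolyDet_prod, gaussianPairing_charpolyDet_one,
    ← det_eval_diffOp_prod_geomPoly hy hy0]
  rfl

/-- `E ∏_j det (x_j - G) det (y_j - G†)` for a matrix `G` of independent standard complex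
normal entries, written as a Gaussian pairing of polynomials in the entries of `G`. -/
noncomputable def gaussianCharpolyPairing (n : Type*) [Fintype n] [DecidableEq n]
    (x y : Fin k → ℂ) : ℂ :=
  gaussianPairing (∏ j, (Matrix.mvPolynomialX n n ℂ).charpoly.eval (MvPolynomial.C (x j)))
    (∏ j, (Matrix.mvPolynomialX n n ℂ).charpoly.eval (MvPolynomial.C (y j)))

theorem gaussianCharpolyPairing_mul_vandermonde (x : Fin k → ℂ) {y : Fin k → ℂ}
    (hy : Function.Injective y) (hy0 : ∀ i, y i ≠ 0) :
    gaussianCharpolyPairing n x y * ((Matrix.vandermonde x).det * (Matrix.vandermonde y).det) =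
      (∏ b : Fin k, ((Fintype.card n + b).factorial : ℂ)) *
        (Matrix.of fun i j => expPartialSum (Fintype.card n + k - 1) (x i * y j)).det := by
  have hx : charpolyDet (fun i => leval (x i)) (Matrix.mvPolynomialX n n ℂ) =
      MvPolynomial.C (Matrix.vandermonde x).det *
        ∏ j, (Matrix.mvPolynomialX n n ℂ).charpoly.eval (MvPolynomial.C (x j)) := by
    simp only [charpolyDet_leval, Matrix.eval_charpoly, MvPolynomial.algebraMap_eq]
  have hy' : ∏ j, (Matrix.mvPolynomialX n n ℂ).charpoly.eval (MvPolynomial.C (y j)) =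
      MvPolynomial.C ((∏ j, y j) ^ Fintype.card n) *
        ∏ j, (1 - (MvPolynomial.C (y j)⁻¹ : MvPolynomial (n × n) ℂ) •
          Matrix.mvPolynomialX n n ℂ).det := by
    rw [← Finset.prod_pow, map_prod, ← Finset.prod_mul_distrib]
    refine Finset.prod_congr rfl fun j _ => ?_
    rw [map_pow]
    exact eval_charpoly_eq_pow_mul_det_one_sub _ (by
      rw [← map_mul, mul_inv_cancel₀ (hy0 j), map_one])
  rw [← gaussianPairing_charpolyDet_leval x hy hy0, hx, gaussianPairing_C_mul_left,
    gaussianCharpolyPairing, hy', gaussianPairing_C_mul_right]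
  ring

end ExactFormula

/-! ### Relation to the correlation functions of the Ginibre ensemble -/

section GinibreCorrelation

variable {k : ℕ} (N : ℕ)

theorem ofReal_sqrt_natCast_ne_zero {N : ℕ} (hN : N ≠ 0) : (Real.sqrt N : ℂ) ≠ 0 :=
  Complex.ofReal_ne_zero.2 (Real.sqrt_ne_zero'.2 (Nat.cast_pos.2 hN.bot_lt))

theorem ofReal_sqrt_natCast_sq : (Real.sqrt N : ℂ) ^ 2 = N := by
  rw [← Complex.ofReal_pow, Real.sq_sqrt N.cast_nonneg, Complex.ofReal_natCast]

theorem det_inv_sqrt_smul_sub (M : Matrix (Fin N) (Fin N) ℂ) (x : ℂ) :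
    ((Real.sqrt N : ℂ)⁻¹ • M - Matrix.scalar (Fin N) x).det =
      (-(Real.sqrt N : ℂ)⁻¹) ^ N * M.charpoly.eval ((Real.sqrt N : ℂ) * x) := by
  rcases N.eq_zero_or_pos with rfl | hN
  · simp
  have hsmul : (Real.sqrt N : ℂ)⁻¹ • M - Matrix.scalar (Fin N) x = (-(Real.sqrt N : ℂ)⁻¹) •
      (Matrix.scalar (Fin N) ((Real.sqrt N : ℂ) * x) - M) := by
    have hscalar : (Real.sqrt N : ℂ)⁻¹ • Matrix.scalar (Fin N) ((Real.sqrt N : ℂ) * x) =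
        Matrix.scalar (Fin N) x := by
      rw [Matrix.scalar_apply, Matrix.scalar_apply, ← Matrix.diagonal_smul]
      congr 1
      funext
      exact inv_mul_cancel_left₀ (ofReal_sqrt_natCast_ne_zero hN.ne') x
    rw [neg_smul, smul_sub, hscalar, neg_sub]
  rw [hsmul, Matrix.det_smul, Fintype.card_fin, Matrix.eval_charpoly]

theorem eval_mvPolynomialX_charpoly {n : Type*} [Fintype n] [DecidableEq n] (M : Matrix n n ℂ)
    (c : ℂ) :
    MvPolynomial.eval (fun p : n × n => M p.1 p.2)
      ((Matrix.mvPolynomialX n n ℂ).charpoly.eval (MvPolynomial.C c)) = M.charpoly.eval c := by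
  rw [Matrix.eval_charpoly, Matrix.eval_charpoly, RingHom.map_det]
  congr 1
  ext i j
  simp [Matrix.diagonal_apply, apply_ite]

theorem charPolyProduct_eq_eval (x y : Fin k → ℂ) (g : Fin N → Fin N → ℂ) :
    MvPolynomial.eval (withConj (Function.uncurry g))
      (MvPolynomial.C (((N : ℂ)⁻¹ ^ N) ^ k) *
        (MvPolynomial.rename Sum.inl (∏ j, (Matrix.mvPolynomialX (Fin N) (Fin N) ℂ).charpoly.eval
          (MvPolynomial.C ((Real.sqrt N : ℂ) * x j))) *
        MvPolynomial.rename Sum.inr (∏ j, (Matrix.mvPolynomialX (Fin N) (Fin N) ℂ).charpoly.eval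
          (MvPolynomial.C ((Real.sqrt N : ℂ) * conj (y j)))))) =
      charPolyProduct N x y g := by
  have hconjTranspose : (ginibreMatrix N g).conjTranspose =
      (Real.sqrt N : ℂ)⁻¹ • (Matrix.of g).conjTranspose := by
    rw [ginibreMatrix, Matrix.conjTranspose_smul, RCLike.star_def, map_inv₀, Complex.conj_ofReal]
  have hcharpoly : (Matrix.of g).conjTranspose.charpoly =
      (Matrix.of fun a b => conj (g a b)).charpoly :=
    (Matrix.of fun a b => conj (g a b)).charpoly_transpose
  have hscale : (-(Real.sqrt N : ℂ)⁻¹) ^ N * (-(Real.sqrt N : ℂ)⁻¹) ^ N = (N : ℂ)⁻¹ ^ N := by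
    rw [← mul_pow, neg_mul_neg, ← sq, inv_pow, ofReal_sqrt_natCast_sq]
  have hleft (c : ℂ) : MvPolynomial.eval (Function.uncurry g)
      ((Matrix.mvPolynomialX (Fin N) (Fin N) ℂ).charpoly.eval (MvPolynomial.C c)) =
        (Matrix.of g).charpoly.eval c :=
    eval_mvPolynomialX_charpoly (Matrix.of g) c
  have hright (c : ℂ) : MvPolynomial.eval (fun p => conj (Function.uncurry g p))
      ((Matrix.mvPolynomialX (Fin N) (Fin N) ℂ).charpoly.eval (MvPolynomial.C c)) =
        (Matrix.of fun a b => conj (g a b)).charpoly.eval c :=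
    eval_mvPolynomialX_charpoly (Matrix.of fun a b => conj (g a b)) c
  rw [map_mul, MvPolynomial.eval_C, eval_withConj_rename_mul_rename, map_prod, map_prod,
    charPolyProduct]
  simp only [hleft, hright, hconjTranspose]
  simp only [ginibreMatrix, det_inv_sqrt_smul_sub, hcharpoly]
  rw [Finset.prod_mul_distrib, Finset.prod_mul_distrib, Finset.prod_mul_distrib,
    Finset.prod_const, Finset.card_univ, Fintype.card_fin, ← hscale, mul_pow]
  ring

theorem integrable_charPolyProduct (x y : Fin k → ℂ) :
    Integrable (charPolyProduct N x y) (gaussianEntries N) :=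
  integrable_gaussianEntries_of_eval (charPolyProduct_eq_eval N x y)

theorem charPolyCorrelation_eq_gaussianCharpolyPairing (x y : Fin k → ℂ) :
    charPolyCorrelation N x y = ((N : ℂ)⁻¹ ^ N) ^ k *
      gaussianCharpolyPairing (Fin N) (fun j => (Real.sqrt N : ℂ) * x j)
        fun j => (Real.sqrt N : ℂ) * conj (y j) := by
  rw [charPolyCorrelation, integral_gaussianEntries_of_eval (charPolyProduct_eq_eval N x y),
    gaussianExpectation_C_mul]
  rfl

end GinibreCorrelation

/-! ### The kernel at the edge -/

section EdgeKernel

theorem integrableOn_pow_mul_exp_neg (n : ℕ) :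
    IntegrableOn (fun t : ℝ => (t : ℂ) ^ n * Complex.exp (-t)) (Set.Ioi 0) := by
  refine (Complex.GammaIntegral_convergent (s := n + 1) (by
    simp only [Complex.add_re, Complex.natCast_re, Complex.one_re]
    positivity)).congr_fun
    (fun t _ => ?_) measurableSet_Ioi
  simp [mul_comm]

theorem integral_pow_mul_exp_neg (n : ℕ) :
    ∫ t in Set.Ioi (0 : ℝ), (t : ℂ) ^ n * Complex.exp (-t) = n.factorial := by
  rw [← Complex.Gamma_nat_eq_factorial, Complex.Gamma_eq_integral (by
    simp only [Complex.add_re, Complex.natCast_re, Complex.one_re]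
    positivity),
    Complex.GammaIntegral]
  refine setIntegral_congr_fun measurableSet_Ioi fun t _ => ?_
  simp [mul_comm]

theorem integral_add_pow_mul_exp_neg (n : ℕ) (x : ℂ) :
    ∫ t in Set.Ioi (0 : ℝ), (x + t) ^ n * Complex.exp (-t) = n.factorial * expPartialSum n x := by
  have hbinomial (t : ℝ) : (x + t) ^ n * Complex.exp (-t) = ∑ m ∈ Finset.range (n + 1),
      x ^ m * (n.choose m : ℂ) * ((t : ℂ) ^ (n - m) * Complex.exp (-t)) := by
    rw [add_pow, Finset.sum_mul]
    exact Finset.sum_congr rfl fun m _ => by ring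
  simp_rw [hbinomial]
  rw [integral_finsetSum _ fun m _ => (integrableOn_pow_mul_exp_neg (n - m)).const_mul _,
    expPartialSum, Finset.mul_sum]
  refine Finset.sum_congr rfl fun m hm => ?_
  rw [integral_const_mul, integral_pow_mul_exp_neg,
    ← Nat.choose_mul_factorial_mul_factorial (Finset.mem_range_succ_iff.1 hm)]
  have hm0 : (m.factorial : ℂ) ≠ 0 := Nat.cast_ne_zero.2 m.factorial_ne_zero
  push_cast
  field_simp

theorem integral_rescaled_add_pow_mul_exp_neg (n : ℕ) (x : ℂ) {q : ℝ} (hq : 0 < q) :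
    (q : ℂ) ^ (2 * n + 1) * ∫ t in Set.Ioi (0 : ℝ), (x + t / q) ^ n * Complex.exp (-(q * t)) =
      n.factorial * expPartialSum n (q ^ 2 * x) := by
  have hq0 : (q : ℂ) ≠ 0 := Complex.ofReal_ne_zero.2 hq.ne'
  have hsubst := integral_comp_mul_left_Ioi
    (fun t : ℝ => (q ^ 2 * x + t) ^ n * Complex.exp (-t)) 0 hq
  rw [mul_zero, integral_add_pow_mul_exp_neg, eq_inv_smul_iff₀ hq.ne', Complex.real_smul] at hsubst
  rw [← hsubst, pow_succ', mul_assoc, ← integral_const_mul]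
  congr 1
  refine setIntegral_congr_fun measurableSet_Ioi fun t _ => ?_
  simp only [Complex.ofReal_mul]
  rw [pow_mul, ← mul_assoc, ← mul_pow]
  congr 2
  field_simp

/-- The integrand of `edgeKernel`. -/
noncomputable def edgeIntegrand (m N : ℕ) (u w : ℂ) (t : ℝ) : ℂ :=
  ((1 - u / (Real.sqrt N : ℂ)) * (1 - w / (Real.sqrt N : ℂ)) + t / (Real.sqrt N : ℂ)) ^ (N + m) *
    Complex.exp ((Real.sqrt N : ℂ) * (u + w) - (Real.sqrt N : ℂ) * t)

/-- The kernel `exp (-(u ^ 2 + w ^ 2) / 2) ∫_0^∞ edgeIntegrand`, which is the truncated exponential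
of degree `N + m` at `(√N - u) (√N - w)` up to factors that do not depend on both `u` and `w`. -/
noncomputable def edgeKernel (m N : ℕ) (u w : ℂ) : ℂ :=
  Complex.exp (-((u ^ 2 + w ^ 2) / 2)) * ∫ t in Set.Ioi (0 : ℝ), edgeIntegrand m N u w t

/-- The limit of `edgeKernel` as `N → ∞`. -/
noncomputable def edgeLimitKernel (u w : ℂ) : ℂ :=
  Complex.exp (-((u ^ 2 + w ^ 2) / 2)) *
    ∫ t in Set.Ioi (0 : ℝ), Complex.exp (u * w - (t - (u + w)) ^ 2 / 2)

/-- A function of `t ≥ 0` dominating `edgeIntegrand m N u w` for `‖u‖, ‖w‖ ≤ R` and large `N`. -/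
noncomputable def edgeMajorant (m : ℕ) (R t : ℝ) : ℝ :=
  Real.exp (((m + 1) ^ 2 + R ^ 2) * (m + 1) + (2 * m + 1) * (2 * R) - t / 2)

theorem integrableOn_edgeMajorant (m : ℕ) (R : ℝ) :
    IntegrableOn (edgeMajorant m R) (Set.Ioi 0) := by
  refine ((exp_neg_integrableOn_Ioi 0 one_half_pos).const_mul
    (Real.exp (((m + 1) ^ 2 + R ^ 2) * (m + 1) + (2 * m + 1) * (2 * R)))).congr
    (.of_forall fun t => ?_)
  beta_reduce
  rw [edgeMajorant, ← Real.exp_add]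
  ring_nf

theorem pow_le_exp_of_rescale {B s : ℝ} (hB : 0 ≤ B) (hs : 0 < s) (n : ℕ) :
    B ^ n ≤ Real.exp (n * (s - 1 + (B / s - 1))) := by
  have hle : B ≤ Real.exp (s - 1 + (B / s - 1)) := by
    calc B = s * (B / s) := (mul_div_cancel₀ B hs.ne').symm
      _ ≤ Real.exp (s - 1) * Real.exp (B / s - 1) := by
        gcongr
        · linarith [Real.add_one_le_exp (s - 1)]
        · linarith [Real.add_one_le_exp (B / s - 1)]
      _ = Real.exp (s - 1 + (B / s - 1)) := (Real.exp_add _ _).symm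
  rw [Real.exp_nat_mul]
  exact pow_le_pow_left₀ hB hle n

section Exponent

variable {m q A α R t : ℝ}

theorem edge_exponent_eq (hm : 0 ≤ m) (hq : 0 < q) :
    (q ^ 2 + m) * (1 + (m + 1) / q - 1 + ((A + t / q) / (1 + (m + 1) / q) - 1)) +
        (q * α - q * t) =
      ((q ^ 2 + m) * ((m + 1) ^ 2 / q ^ 2 + (A - 1)) + q * α + (m + 1) * α) /
        (1 + (m + 1) / q) + t * ((m - q * (m + 1)) / (q + (m + 1))) := by
  have hqm : q + (m + 1) ≠ 0 := by positivity
  have hs : 1 + (m + 1) / q = (q + (m + 1)) / q := by field_simp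
  rw [hs]
  field_simp
  ring

theorem edge_exponent_const_le (hm : 0 ≤ m) (hq : 1 ≤ q)
    (hA : A ≤ 1 - α / q + R ^ 2 / q ^ 2) (hα : |α| ≤ 2 * R) :
    (q ^ 2 + m) * ((m + 1) ^ 2 / q ^ 2 + (A - 1)) + q * α + (m + 1) * α ≤
      ((m + 1) ^ 2 + R ^ 2) * (m + 1) + (2 * m + 1) * (2 * R) := by
  have hq0 : 0 < q := one_pos.trans_le hq
  have hlinear : -(α / q) ≤ 2 * R := by
    refine (neg_le_abs _).trans ?_
    rw [abs_div, abs_of_pos hq0]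
    exact (div_le_self (abs_nonneg α) hq).trans hα
  calc (q ^ 2 + m) * ((m + 1) ^ 2 / q ^ 2 + (A - 1)) + q * α + (m + 1) * α
      ≤ (q ^ 2 + m) * ((m + 1) ^ 2 / q ^ 2 + (-(α / q) + R ^ 2 / q ^ 2)) + q * α +
          (m + 1) * α := by
        gcongr
        linarith
    _ = ((m + 1) ^ 2 + R ^ 2) * (m / q ^ 2 + 1) + m * -(α / q) + (m + 1) * α := by
        field_simp
        ring
    _ ≤ ((m + 1) ^ 2 + R ^ 2) * (m + 1) + m * (2 * R) + (m + 1) * (2 * R) := by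
        gcongr
        · exact div_le_self hm (one_le_pow₀ hq)
        · exact (le_abs_self α).trans hα
    _ = ((m + 1) ^ 2 + R ^ 2) * (m + 1) + (2 * m + 1) * (2 * R) := by ring

theorem edge_exponent_slope_le (hm : 0 ≤ m) (hqm : m + 1 ≤ q) :
    (m - q * (m + 1)) / (q + (m + 1)) ≤ -(1 / 2) := by
  rw [div_le_iff₀ (by linarith)]
  nlinarith [mul_nonneg hm (hm.trans (by linarith : m ≤ q))]

end Exponent

/- Since `log x ≤ x - 1` is sharp only at `x = 1`, it has to be applied to `(A + t / q) / s` and `s`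
for a suitable `s > 1`; with `s = 1` the exponent would grow like `m t / q`. -/
theorem pow_mul_exp_le_edgeMajorant {m N : ℕ} {q A α R t : ℝ} (hq : q ^ 2 = N)
    (hqm : (m : ℝ) + 1 ≤ q) (hA0 : 0 ≤ A) (hA : A ≤ 1 - α / q + R ^ 2 / q ^ 2) (ht : 0 ≤ t)
    (hα : |α| ≤ 2 * R) :
    (A + t / q) ^ (N + m) * Real.exp (q * α - q * t) ≤ edgeMajorant m R t := by
  have hm : (0 : ℝ) ≤ m := m.cast_nonneg
  have hq1 : 1 ≤ q := by linarith
  have hq0 : 0 < q := by linarith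
  have hR : 0 ≤ R := by linarith [abs_nonneg α]
  have hs : 1 ≤ 1 + (m + 1) / q := le_add_of_nonneg_right (by positivity)
  refine (mul_le_mul_of_nonneg_right (pow_le_exp_of_rescale (s := 1 + (m + 1) / q) (by positivity)
    (by positivity) _) (Real.exp_pos _).le).trans ?_
  rw [← Real.exp_add, edgeMajorant, Real.exp_le_exp, Nat.cast_add, ← hq, edge_exponent_eq hm hq0,
    sub_eq_add_neg]
  refine add_le_add ?_ ?_
  · refine (div_le_div_of_nonneg_right (edge_exponent_const_le hm hq1 hA hα)
      (by positivity)).trans (div_le_self (by positivity) hs)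
  · linarith [mul_le_mul_of_nonneg_left (edge_exponent_slope_le hm hqm) ht]

theorem norm_one_sub_div_ofReal_sq_le {R q : ℝ} {u : ℂ} (hu : ‖u‖ ≤ R) :
    ‖1 - u / (q : ℂ)‖ ^ 2 ≤ 1 - 2 * (u.re / q) + R ^ 2 / q ^ 2 := by
  rw [norm_sub_sq_real, Complex.inner, map_one, mul_one, Complex.div_ofReal_re, norm_one, one_pow,
    norm_div, Complex.norm_real, div_pow, Real.norm_eq_abs, sq_abs]
  gcongr

theorem norm_edgeIntegrand_le {m N : ℕ} {R : ℝ} {u w : ℂ} (hu : ‖u‖ ≤ R) (hw : ‖w‖ ≤ R)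
    (hN : (m : ℝ) + 1 ≤ Real.sqrt N) {t : ℝ} (ht : 0 ≤ t) :
    ‖edgeIntegrand m N u w t‖ ≤ edgeMajorant m R t := by
  rw [edgeIntegrand]
  have hsq : Real.sqrt N ^ 2 = N := Real.sq_sqrt N.cast_nonneg
  generalize Real.sqrt N = q at *
  have hq : 0 ≤ q := by linarith [m.cast_nonneg (α := ℝ)]
  have hproduct : ‖1 - u / (q : ℂ)‖ * ‖1 - w / (q : ℂ)‖ ≤
      1 - (u + w).re / q + R ^ 2 / q ^ 2 := by
    rw [Complex.add_re, add_div]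
    linarith [two_mul_le_add_sq ‖1 - u / (q : ℂ)‖ ‖1 - w / (q : ℂ)‖,
      norm_one_sub_div_ofReal_sq_le (q := q) hu, norm_one_sub_div_ofReal_sq_le (q := q) hw]
  have hre : |(u + w).re| ≤ 2 * R := by
    linarith [Complex.abs_re_le_norm (u + w), norm_add_le u w]
  have hexp : ((q : ℂ) * (u + w) - (q : ℂ) * (t : ℂ)).re = q * (u + w).re - q * t := by
    rw [Complex.sub_re, Complex.re_ofReal_mul, Complex.re_ofReal_mul, Complex.ofReal_re]
  have hbase : ‖(1 - u / (q : ℂ)) * (1 - w / (q : ℂ)) + t / (q : ℂ)‖ ≤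
      ‖1 - u / (q : ℂ)‖ * ‖1 - w / (q : ℂ)‖ + t / q := by
    refine (norm_add_le _ _).trans_eq ?_
    rw [norm_mul, norm_div, Complex.norm_real, Complex.norm_real, Real.norm_of_nonneg ht,
      Real.norm_of_nonneg hq]
  rw [norm_mul, norm_pow, Complex.norm_exp, hexp]
  exact (mul_le_mul_of_nonneg_right (pow_le_pow_left₀ (norm_nonneg _) hbase _)
    (Real.exp_pos _).le).trans
      (pow_mul_exp_le_edgeMajorant hsq hN (by positivity) hproduct ht hre)

theorem eventually_le_sqrt_natCast (c : ℝ) : ∀ᶠ N : ℕ in atTop, c ≤ Real.sqrt N :=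
  (Real.tendsto_sqrt_atTop.comp tendsto_natCast_atTop_atTop).eventually_ge_atTop c

theorem tendsto_inv_ofReal_sqrt_natCast :
    Tendsto (fun N : ℕ => (Real.sqrt N : ℂ)⁻¹) atTop (𝓝[≠] 0) :=
  tendsto_inv₀_cobounded'.comp ((RCLike.tendsto_ofReal_atTop_cobounded ℂ).comp
    (Real.tendsto_sqrt_atTop.comp tendsto_natCast_atTop_atTop))

theorem tendsto_one_add_quadratic_mul_exp_neg_sub_one_div_sq (b c : ℂ) :
    Tendsto (fun h : ℂ => ((1 + b * h + c * h ^ 2) * Complex.exp (-(b * h)) - 1) / h ^ 2)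
      (𝓝[≠] 0) (𝓝 (c - b ^ 2 / 2)) := by
  have hlinear : Tendsto (fun h : ℂ => -(b * h)) (𝓝 0) (𝓝 0) :=
    Continuous.tendsto' (by fun_prop) _ _ (by simp)
  have hremainder : Tendsto (fun h : ℂ =>
      (Complex.exp (-(b * h)) - (1 - b * h + (b * h) ^ 2 / 2)) / h ^ 2) (𝓝[≠] 0) (𝓝 0) := by
    have hlittleO := (Complex.exp_sub_sum_range_succ_isLittleO_pow 2).comp_tendsto hlinear
    have hbigO : (fun h : ℂ => (-(b * h)) ^ 2) =O[𝓝 0] fun h => h ^ 2 :=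
      .of_bound (‖b‖ ^ 2) (.of_forall fun h => by simp [mul_pow])
    refine ((hlittleO.trans_isBigO hbigO).tendsto_div_nhds_zero.mono_left
      nhdsWithin_le_nhds).congr fun h => ?_
    simp [Finset.sum_range_succ, sub_eq_add_neg]
  have hpoly : Tendsto (fun h : ℂ =>
      c - b ^ 2 / 2 + h * (b ^ 3 / 2 - b * c) + h ^ 2 * (c * b ^ 2 / 2))
      (𝓝[≠] 0) (𝓝 (c - b ^ 2 / 2)) :=
    (Continuous.tendsto' (by fun_prop) _ _ (by simp)).mono_left nhdsWithin_le_nhds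
  have hquadratic : Tendsto (fun h : ℂ => 1 + b * h + c * h ^ 2) (𝓝[≠] 0) (𝓝 1) :=
    (Continuous.tendsto' (by fun_prop) _ _ (by simp)).mono_left nhdsWithin_le_nhds
  have hsum := hpoly.add (hquadratic.mul hremainder)
  rw [mul_zero, add_zero] at hsum
  refine hsum.congr' ?_
  filter_upwards [self_mem_nhdsWithin] with h (hh : h ≠ 0)
  field_simp
  ring

theorem edgeIntegrand_eq (m : ℕ) {N : ℕ} (hN : N ≠ 0) (u w : ℂ) (t : ℝ) :
    edgeIntegrand m N u w t =
      ((1 + (t - (u + w)) * (Real.sqrt N : ℂ)⁻¹ + u * w * (Real.sqrt N : ℂ)⁻¹ ^ 2) *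
          Complex.exp (-((t - (u + w)) * (Real.sqrt N : ℂ)⁻¹))) ^ N *
        (1 + (t - (u + w)) * (Real.sqrt N : ℂ)⁻¹ + u * w * (Real.sqrt N : ℂ)⁻¹ ^ 2) ^ m := by
  have hq0 := ofReal_sqrt_natCast_ne_zero hN
  have hbase : (1 - u / (Real.sqrt N : ℂ)) * (1 - w / (Real.sqrt N : ℂ)) + t / (Real.sqrt N : ℂ) =
      1 + (t - (u + w)) * (Real.sqrt N : ℂ)⁻¹ + u * w * (Real.sqrt N : ℂ)⁻¹ ^ 2 := by
    field_simp
    ring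
  rw [edgeIntegrand, hbase, mul_pow, ← Complex.exp_nat_mul, pow_add, mul_right_comm]
  congr 3
  rw [← ofReal_sqrt_natCast_sq]
  field_simp
  ring

theorem tendsto_edgeIntegrand (m : ℕ) (u w : ℂ) (t : ℝ) :
    Tendsto (fun N => edgeIntegrand m N u w t) atTop
      (𝓝 (Complex.exp (u * w - (t - (u + w)) ^ 2 / 2))) := by
  have hsecondOrder := (tendsto_one_add_quadratic_mul_exp_neg_sub_one_div_sq (t - (u + w))
    (u * w)).comp tendsto_inv_ofReal_sqrt_natCast
  have hpow := Complex.tendsto_one_add_pow_exp_of_tendsto (hsecondOrder.congr fun N => by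
    rw [Function.comp_apply, inv_pow, div_inv_eq_mul, ofReal_sqrt_natCast_sq, mul_comm])
  have hinv := tendsto_nhds_of_tendsto_nhdsWithin tendsto_inv_ofReal_sqrt_natCast
  have hextra := (((hinv.const_mul (t - (u + w))).const_add 1).add
    ((hinv.pow 2).const_mul (u * w))).pow m
  simp only [mul_zero, add_zero, ne_eq, OfNat.ofNat_ne_zero, not_false_eq_true, zero_pow,
    one_pow] at hextra
  have hproduct := hpow.mul hextra
  rw [mul_one] at hproduct
  refine hproduct.congr' ?_
  filter_upwards [eventually_ne_atTop 0] with N hN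
  rw [edgeIntegrand_eq m hN, add_sub_cancel, inv_pow, ofReal_sqrt_natCast_sq]

theorem continuous_edgeIntegrand (m N : ℕ) (u w : ℂ) : Continuous (edgeIntegrand m N u w) := by
  unfold edgeIntegrand
  fun_prop

theorem exists_norm_edgeKernel_le (m : ℕ) (R : ℝ) : ∃ C : ℝ, ∀ N : ℕ, (m : ℝ) + 1 ≤ Real.sqrt N →
    ∀ u w : ℂ, ‖u‖ ≤ R → ‖w‖ ≤ R → ‖edgeKernel m N u w‖ ≤ C := by
  refine ⟨Real.exp (R ^ 2) * ∫ t in Set.Ioi (0 : ℝ), edgeMajorant m R t,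
    fun N hN u w hu hw => ?_⟩
  rw [edgeKernel, norm_mul]
  refine mul_le_mul ?_ ?_ (norm_nonneg _) (Real.exp_pos _).le
  · refine (Complex.norm_exp_le_exp_norm _).trans (Real.exp_le_exp.2 ?_)
    rw [norm_neg, norm_div, Complex.norm_two, div_le_iff₀ two_pos, mul_two]
    refine (norm_add_le _ _).trans ?_
    rw [norm_pow, norm_pow]
    gcongr
  · refine norm_integral_le_of_norm_le (integrableOn_edgeMajorant m R) ?_
    exact (ae_restrict_mem measurableSet_Ioi).mono fun t ht =>
      norm_edgeIntegrand_le hu hw hN (le_of_lt ht)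

theorem tendsto_edgeKernel (m : ℕ) (u w : ℂ) :
    Tendsto (fun N => edgeKernel m N u w) atTop (𝓝 (edgeLimitKernel u w)) := by
  refine (tendsto_integral_filter_of_dominated_convergence (edgeMajorant m (max ‖u‖ ‖w‖))
    (.of_forall fun N => (continuous_edgeIntegrand m N u w).aestronglyMeasurable) ?_
    (integrableOn_edgeMajorant m _) (.of_forall fun t => tendsto_edgeIntegrand m u w t)).const_mul _
  filter_upwards [eventually_le_sqrt_natCast (m + 1)] with N hN
  exact (ae_restrict_mem measurableSet_Ioi).mono fun t ht =>
    norm_edgeIntegrand_le (le_max_left _ _) (le_max_right _ _) hN (le_of_lt ht)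

end EdgeKernel

/-! ### The correlation functions at the edge -/

section EdgeCorrelation

variable {k : ℕ}

theorem prod_eval_C_eq_sum {σ : Type*} (p : Polynomial (MvPolynomial σ ℂ)) (x : Fin k → ℂ) :
    ∏ j, p.eval (MvPolynomial.C (x j)) =
      ∑ a ∈ Fintype.piFinset fun _ : Fin k => Finset.range (p.natDegree + 1),
        MvPolynomial.C (∏ j, x j ^ a j) * ∏ j, p.coeff (a j) := by
  simp only [Polynomial.eval_eq_sum_range]
  rw [Finset.prod_univ_sum]
  refine Finset.sum_congr rfl fun a _ => ?_
  simp only [Finset.prod_mul_distrib, map_prod, map_pow, mul_comm]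

theorem gaussianPairing_sum_sum {n ι κ : Type*} [Fintype n] (s : Finset ι) (t : Finset κ)
    (f : ι → MvPolynomial n ℂ) (h : κ → MvPolynomial n ℂ) :
    gaussianPairing (∑ i ∈ s, f i) (∑ j ∈ t, h j) =
      ∑ i ∈ s, ∑ j ∈ t, gaussianPairing (f i) (h j) := by
  simp only [gaussianPairing, map_sum, Finset.sum_mul_sum]

theorem differentiable_gaussianCharpolyPairing {E n : Type*} [NormedAddCommGroup E]
    [NormedSpace ℂ E] [Fintype n] [DecidableEq n] {x y : E → Fin k → ℂ} (hx : Differentiable ℂ x)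
    (hy : Differentiable ℂ y) :
    Differentiable ℂ fun p => gaussianCharpolyPairing n (x p) (y p) := by
  simp only [gaussianCharpolyPairing, prod_eval_C_eq_sum, gaussianPairing_sum_sum,
    gaussianPairing_C_mul_left, gaussianPairing_C_mul_right]
  fun_prop

/-- The constant of `edgeCorrelation_mul_vandermonde`, which tends to `1`. -/
noncomputable def edgeConstant (k N : ℕ) : ℂ :=
  ∏ b : Fin k, ((N + b).factorial : ℂ) * (N : ℂ) ^ (b.rev : ℕ) / ((N + (k - 1)).factorial : ℂ)

theorem tendsto_factorial_mul_pow_div (b d : ℕ) :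
    Tendsto (fun N : ℕ => ((N + b).factorial : ℂ) * (N : ℂ) ^ d / ((N + b + d).factorial : ℂ))
      atTop (𝓝 1) := by
  induction d with
  | zero =>
    refine tendsto_const_nhds.congr fun N => ?_
    simp [Nat.factorial_ne_zero]
  | succ d ih =>
    have hratio := tendsto_natCast_div_add_atTop (𝕜 := ℂ) ((b : ℂ) + d + 1)
    rw [← mul_one (1 : ℂ)]
    refine (ih.mul hratio).congr fun N => ?_
    rw [← add_assoc (N + b), Nat.factorial_succ, div_mul_div_comm, Nat.cast_mul, pow_succ]
    push_cast
    congr 1 <;> ring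

theorem tendsto_edgeConstant (k : ℕ) : Tendsto (edgeConstant k) atTop (𝓝 1) := by
  rw [← Finset.prod_const_one (ι := Fin k) (s := Finset.univ)]
  refine tendsto_finsetProd _ fun b _ =>
    (tendsto_factorial_mul_pow_div b b.rev).congr fun N => ?_
  rw [show N + (b : ℕ) + b.rev = N + (k - 1) by rw [Fin.val_rev]; lia]

/-- The prefactor `edgePrefactor` as a function of `u` and `w = conj v`, in which it is entire. -/
noncomputable def edgeNormalization (N : ℕ) (u w : Fin k → ℂ) : ℂ :=
  Complex.exp (-(∑ j, ((Real.sqrt N : ℂ) * (u j + w j) - ((u j) ^ 2 + (w j) ^ 2) / 2)) +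
    (k : ℂ) ^ 2 / 2 * (Real.log N : ℂ))

theorem edgeNormalization_ne_zero (N : ℕ) (u w : Fin k → ℂ) : edgeNormalization N u w ≠ 0 :=
  Complex.exp_ne_zero _

/-- The correlation function at the edge divided by its prefactor, as a function of `u` and
`w = conj v`, in which it is entire. -/
noncomputable def edgeCorrelation (z : ℂ) (N : ℕ) (u w : Fin k → ℂ) : ℂ :=
  ((N : ℂ)⁻¹ ^ N) ^ k * gaussianCharpolyPairing (Fin N) (fun j => z * ((Real.sqrt N : ℂ) - u j))
    (fun j => conj z * ((Real.sqrt N : ℂ) - w j)) / edgeNormalization N u w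

theorem differentiable_edgeCorrelation (z : ℂ) (N : ℕ) :
    Differentiable ℂ fun p : (Fin k → ℂ) × (Fin k → ℂ) => edgeCorrelation z N p.1 p.2 := by
  have hpairing : Differentiable ℂ fun p : (Fin k → ℂ) × (Fin k → ℂ) =>
      gaussianCharpolyPairing (Fin N) (fun j => z * ((Real.sqrt N : ℂ) - p.1 j))
        (fun j => conj z * ((Real.sqrt N : ℂ) - p.2 j)) :=
    differentiable_gaussianCharpolyPairing (by fun_prop) (by fun_prop)
  have hnormalization : Differentiable ℂ fun p : (Fin k → ℂ) × (Fin k → ℂ) =>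
      edgeNormalization N p.1 p.2 := by
    unfold edgeNormalization
    fun_prop
  have hinv : Differentiable ℂ fun p : (Fin k → ℂ) × (Fin k → ℂ) =>
      (edgeNormalization N p.1 p.2)⁻¹ :=
    fun p => (hnormalization p).inv (edgeNormalization_ne_zero N p.1 p.2)
  simp only [edgeCorrelation, div_eq_mul_inv]
  exact (hpairing.const_mul _).mul hinv

section EdgePoint

variable {z : ℂ} {N : ℕ}

theorem mul_conj_eq_one_of_norm_eq_one (hz : ‖z‖ = 1) : z * conj z = 1 := by
  rw [Complex.mul_conj', hz, Complex.ofReal_one, one_pow]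

theorem sqrt_mul_edgePoint (hz : ‖z‖ = 1) (hN : N ≠ 0) (a : ℂ) :
    (Real.sqrt N : ℂ) * edgePoint z N a = z * ((Real.sqrt N : ℂ) - a) := by
  have hzz := mul_conj_eq_one_of_norm_eq_one hz
  have hz0 : conj z ≠ 0 := right_ne_zero_of_mul_eq_one hzz
  have hq0 := ofReal_sqrt_natCast_ne_zero hN
  rw [edgePoint]
  field_simp
  linear_combination a * hzz

theorem charPolyCorrelation_edgePoint (hz : ‖z‖ = 1) (hN : N ≠ 0) (u v : Fin k → ℂ) :
    charPolyCorrelation N (fun j => edgePoint z N (u j)) (fun j => edgePoint z N (v j)) =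
      edgePrefactor N u v * edgeCorrelation z N u fun j => conj (v j) := by
  have hconj (a : ℂ) : (Real.sqrt N : ℂ) * conj (edgePoint z N a) =
      conj z * ((Real.sqrt N : ℂ) - conj a) := by
    rw [← Complex.conj_ofReal, ← map_mul, sqrt_mul_edgePoint hz hN, map_mul, map_sub]
  have hprefactor : edgePrefactor N u v = edgeNormalization N u fun j => conj (v j) := rfl
  rw [charPolyCorrelation_eq_gaussianCharpolyPairing, edgeCorrelation, hprefactor,
    mul_div_cancel₀ _ (edgeNormalization_ne_zero N _ _)]
  simp only [sqrt_mul_edgePoint hz hN, hconj]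

end EdgePoint

theorem exp_sq_div_two_mul_log (k : ℕ) {N : ℕ} (hN : N ≠ 0) :
    Complex.exp ((k : ℂ) ^ 2 / 2 * (Real.log N : ℂ)) = (Real.sqrt N : ℂ) ^ (k ^ 2) := by
  have hpos : 0 < Real.sqrt N := Real.sqrt_pos.2 (Nat.cast_pos.2 hN.bot_lt)
  have hexp : (Real.sqrt N : ℂ) = Complex.exp (Real.log N / 2 : ℝ) := by
    rw [← Real.log_sqrt N.cast_nonneg, ← Complex.ofReal_exp, Real.exp_log hpos]
  rw [hexp, ← Complex.exp_nat_mul]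
  push_cast
  ring_nf

theorem edgeNormalization_eq {N : ℕ} (hN : N ≠ 0) (u w : Fin k → ℂ) :
    edgeNormalization N u w = (∏ j, Complex.exp (u j ^ 2 / 2 - (Real.sqrt N : ℂ) * u j)) *
      (∏ j, Complex.exp (w j ^ 2 / 2 - (Real.sqrt N : ℂ) * w j)) * (Real.sqrt N : ℂ) ^ (k ^ 2) := by
  rw [edgeNormalization, Complex.exp_add, exp_sq_div_two_mul_log k hN, ← Complex.exp_sum,
    ← Complex.exp_sum, ← Complex.exp_add, ← Finset.sum_add_distrib, ← Finset.sum_neg_distrib]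
  congr 3
  funext j
  ring

theorem expPartialSum_eq_edgeKernel (m : ℕ) {N : ℕ} (hN : N ≠ 0) (u w : ℂ) :
    expPartialSum (N + m) (((Real.sqrt N : ℂ) - u) * ((Real.sqrt N : ℂ) - w)) =
      Complex.exp (u ^ 2 / 2 - (Real.sqrt N : ℂ) * u) *
        ((Real.sqrt N : ℂ) ^ (2 * (N + m) + 1) / ((N + m).factorial : ℂ) *
          Complex.exp (w ^ 2 / 2 - (Real.sqrt N : ℂ) * w) * edgeKernel m N u w) := by
  have hfactorial : ((N + m).factorial : ℂ) ≠ 0 := Nat.cast_ne_zero.2 (N + m).factorial_ne_zero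
  have hq0 := ofReal_sqrt_natCast_ne_zero hN
  have hproduct : ((Real.sqrt N : ℂ) - u) * ((Real.sqrt N : ℂ) - w) = (Real.sqrt N : ℂ) ^ 2 *
      ((1 - u / (Real.sqrt N : ℂ)) * (1 - w / (Real.sqrt N : ℂ))) := by
    field_simp
  have hintegrand : ∫ t in Set.Ioi (0 : ℝ), edgeIntegrand m N u w t =
      Complex.exp ((Real.sqrt N : ℂ) * (u + w)) * ∫ t in Set.Ioi (0 : ℝ),
        ((1 - u / (Real.sqrt N : ℂ)) * (1 - w / (Real.sqrt N : ℂ)) + t / (Real.sqrt N : ℂ)) ^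
          (N + m) * Complex.exp (-((Real.sqrt N : ℂ) * t)) := by
    rw [← integral_const_mul]
    refine setIntegral_congr_fun measurableSet_Ioi fun t _ => ?_
    simp only [edgeIntegrand]
    rw [sub_eq_add_neg (_ * _), Complex.exp_add]
    ring
  have hexp : Complex.exp (u ^ 2 / 2 - (Real.sqrt N : ℂ) * u) *
      Complex.exp (w ^ 2 / 2 - (Real.sqrt N : ℂ) * w) * Complex.exp (-((u ^ 2 + w ^ 2) / 2)) *
      Complex.exp ((Real.sqrt N : ℂ) * (u + w)) = 1 := by
    rw [← Complex.exp_add, ← Complex.exp_add, ← Complex.exp_add, ← Complex.exp_zero]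
    ring_nf
  rw [hproduct, ← mul_right_inj' hfactorial, ← integral_rescaled_add_pow_mul_exp_neg (N + m) _
    (Real.sqrt_pos.2 (Nat.cast_pos.2 hN.bot_lt)), edgeKernel, hintegrand]
  set I := ∫ t in Set.Ioi (0 : ℝ),
    ((1 - u / (Real.sqrt N : ℂ)) * (1 - w / (Real.sqrt N : ℂ)) + t / (Real.sqrt N : ℂ)) ^ (N + m) *
      Complex.exp (-((Real.sqrt N : ℂ) * t))
  linear_combination -((N + m).factorial * ((N + m).factorial : ℂ)⁻¹ *
    (Real.sqrt N : ℂ) ^ (2 * (N + m) + 1) * I) * hexp -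
      (Real.sqrt N : ℂ) ^ (2 * (N + m) + 1) * I * mul_inv_cancel₀ hfactorial

theorem det_expPartialSum_eq_det_edgeKernel (m : ℕ) {N : ℕ} (hN : N ≠ 0) (u w : Fin k → ℂ) :
    (Matrix.of fun i j =>
        expPartialSum (N + m) (((Real.sqrt N : ℂ) - u i) * ((Real.sqrt N : ℂ) - w j))).det =
      (∏ j, Complex.exp (u j ^ 2 / 2 - (Real.sqrt N : ℂ) * u j)) *
        (((Real.sqrt N : ℂ) ^ (2 * (N + m) + 1) / ((N + m).factorial : ℂ)) ^ k *
          (∏ j, Complex.exp (w j ^ 2 / 2 - (Real.sqrt N : ℂ) * w j)) *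
            (Matrix.of fun i j => edgeKernel m N (u i) (w j)).det) := by
  have hconst : ((Real.sqrt N : ℂ) ^ (2 * (N + m) + 1) / ((N + m).factorial : ℂ)) ^ k =
      ∏ _j : Fin k, (Real.sqrt N : ℂ) ^ (2 * (N + m) + 1) / ((N + m).factorial : ℂ) := by
    rw [Finset.prod_const, Finset.card_univ, Fintype.card_fin]
  rw [hconst, ← Finset.prod_mul_distrib, ← Matrix.det_mul_row, ← Matrix.det_mul_column]
  simp only [expPartialSum_eq_edgeKernel m hN, Matrix.of_apply]

theorem edgeConstant_mul_pow {N : ℕ} (hN : N ≠ 0) :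
    ((N : ℂ)⁻¹ ^ N) ^ k * (∏ b : Fin k, ((N + b).factorial : ℂ)) *
        ((Real.sqrt N : ℂ) ^ (2 * (N + (k - 1)) + 1) / ((N + (k - 1)).factorial : ℂ)) ^ k =
      edgeConstant k N * (Real.sqrt N : ℂ) ^ (k ^ 2) := by
  have hpow : ∏ b : Fin k, (N : ℂ) ^ (b.rev : ℕ) = (Real.sqrt N : ℂ) ^ (k * (k - 1)) := by
    have hrev : ∑ b : Fin k, (b.rev : ℕ) = ∑ b : Fin k, (b : ℕ) :=
      Equiv.sum_comp Fin.revPerm fun b : Fin k => (b : ℕ)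
    rw [Finset.prod_pow_eq_pow_sum, ← ofReal_sqrt_natCast_sq, ← pow_mul, hrev,
      Fin.sum_univ_eq_sum_range fun b => b, mul_comm, Finset.sum_range_id_mul_two]
  have hexponent : (2 * (N + (k - 1)) + 1) * k = 2 * N * k + (k * (k - 1) + k ^ 2) := by
    rcases k with _ | k
    · rfl
    · rw [Nat.add_sub_cancel]
      ring
  have hcancel : ((N : ℂ)⁻¹ ^ N) ^ k * ((Real.sqrt N : ℂ) ^ (2 * (N + (k - 1)) + 1)) ^ k =
      (Real.sqrt N : ℂ) ^ (k * (k - 1)) * (Real.sqrt N : ℂ) ^ (k ^ 2) := by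
    rw [← pow_mul (Real.sqrt N : ℂ), hexponent, pow_add, pow_add, pow_mul, pow_mul,
      ofReal_sqrt_natCast_sq, ← mul_assoc, ← mul_pow, inv_pow, inv_mul_cancel₀, one_pow,
      one_mul]
    exact pow_ne_zero _ (Nat.cast_ne_zero.2 hN)
  rw [edgeConstant, Finset.prod_div_distrib, Finset.prod_mul_distrib, Finset.prod_const,
    Finset.card_univ, Fintype.card_fin, hpow, div_pow]
  linear_combination (∏ b : Fin k, ((N + b).factorial : ℂ)) /
    ((N + (k - 1)).factorial : ℂ) ^ k * hcancel

theorem det_vandermonde_mul_sub_mul_det_vandermonde {c d : ℂ} (hcd : c * d = 1) (q : ℂ)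
    (u w : Fin k → ℂ) :
    (Matrix.vandermonde fun j => c * (q - u j)).det *
        (Matrix.vandermonde fun j => d * (q - w j)).det =
      (Matrix.vandermonde u).det * (Matrix.vandermonde w).det := by
  simp only [Matrix.det_vandermonde, ← Finset.prod_mul_distrib]
  refine Finset.prod_congr rfl fun i _ => Finset.prod_congr rfl fun j _ => ?_
  linear_combination (u i - u j) * (w i - w j) * hcd

theorem edgeCorrelation_mul_vandermonde {z : ℂ} (hz : ‖z‖ = 1) {N : ℕ} (hN : N ≠ 0)
    (u : Fin k → ℂ) {w : Fin k → ℂ} (hw : Function.Injective w)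
    (hw0 : ∀ j, w j ≠ (Real.sqrt N : ℂ)) :
    edgeCorrelation z N u w * ((Matrix.vandermonde u).det * (Matrix.vandermonde w).det) =
      edgeConstant k N * (Matrix.of fun i j => edgeKernel (k - 1) N (u i) (w j)).det := by
  have hzz := mul_conj_eq_one_of_norm_eq_one hz
  have hz0 : conj z ≠ 0 := right_ne_zero_of_mul_eq_one hzz
  have hkernel : (Matrix.of fun i j : Fin k => expPartialSum (N + k - 1)
        (z * ((Real.sqrt N : ℂ) - u i) * (conj z * ((Real.sqrt N : ℂ) - w j)))) =
      Matrix.of fun i j =>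
        expPartialSum (N + (k - 1)) (((Real.sqrt N : ℂ) - u i) * ((Real.sqrt N : ℂ) - w j)) := by
    ext i j
    rw [Matrix.of_apply, Matrix.of_apply, mul_mul_mul_comm, hzz, one_mul,
      Nat.add_sub_assoc (Nat.one_le_of_lt i.2)]
  have hexact := gaussianCharpolyPairing_mul_vandermonde (n := Fin N)
    (fun j => z * ((Real.sqrt N : ℂ) - u j)) (y := fun j => conj z * ((Real.sqrt N : ℂ) - w j))
    (fun a b hab => hw (sub_right_injective (mul_left_cancel₀ hz0 hab)))
    fun j => mul_ne_zero hz0 (sub_ne_zero.2 (hw0 j).symm)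
  rw [det_vandermonde_mul_sub_mul_det_vandermonde hzz, Fintype.card_fin, hkernel,
    det_expPartialSum_eq_det_edgeKernel _ hN] at hexact
  rw [edgeCorrelation, div_mul_eq_mul_div, mul_assoc, hexact,
    div_eq_iff (edgeNormalization_ne_zero N u w), edgeNormalization_eq hN]
  linear_combination (∏ j, Complex.exp (u j ^ 2 / 2 - (Real.sqrt N : ℂ) * u j)) *
    (∏ j, Complex.exp (w j ^ 2 / 2 - (Real.sqrt N : ℂ) * w j)) *
    (Matrix.of fun i j => edgeKernel (k - 1) N (u i) (w j)).det * edgeConstant_mul_pow (k := k) hN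

end EdgeCorrelation

/-! ### Locally bounded sequences of holomorphic functions -/

section MaximumModulus

variable {ι κ F : Type*} [Finite ι] [Finite κ] [NormedAddCommGroup F] [NormedSpace ℂ F]

theorem norm_le_of_forall_norm_eq {f : (ι → ℂ) → F} (hf : Differentiable ℂ f) {r : ι → ℝ}
    (hr : ∀ i, 0 < r i) {C : ℝ} (hC : ∀ x : ι → ℂ, (∀ i, ‖x i‖ = r i) → ‖f x‖ ≤ C) {x : ι → ℂ}
    (hx : ∀ i, ‖x i‖ ≤ r i) : ‖f x‖ ≤ C := by
  classical
  cases nonempty_fintype ι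
  suffices hpartial : ∀ (s : Finset ι) (x : ι → ℂ), (∀ i ∈ s, ‖x i‖ ≤ r i) →
      (∀ i ∉ s, ‖x i‖ = r i) → ‖f x‖ ≤ C from
    hpartial Finset.univ x (fun i _ => hx i) fun i hi => absurd (Finset.mem_univ i) hi
  intro s
  induction s using Finset.induction_on with
  | empty => exact fun x _ hx => hC x fun i => hx i (Finset.notMem_empty i)
  | insert a s ha ih =>
    intro x hle heq
    have hslice : Differentiable ℂ fun t : ℂ => f (Function.update x a t) :=
      hf.comp fun t => (hasFDerivAt_update x t).differentiableAt
    have hfrontier : ∀ t ∈ frontier (Metric.ball (0 : ℂ) (r a)),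
        ‖f (Function.update x a t)‖ ≤ C := by
      intro t ht
      rw [frontier_ball _ (hr a).ne', mem_sphere_zero_iff_norm] at ht
      refine ih _ (fun i hi => ?_) fun i hi => ?_
      · rw [Function.update_of_ne (ne_of_mem_of_not_mem hi ha)]
        exact hle i (Finset.mem_insert_of_mem hi)
      · rcases eq_or_ne i a with rfl | hia
        · rwa [Function.update_self]
        · rw [Function.update_of_ne hia]
          exact heq i fun hmem => (Finset.mem_insert.1 hmem).elim hia hi
    have hmem : x a ∈ closure (Metric.ball (0 : ℂ) (r a)) := by
      rw [closure_ball _ (hr a).ne', mem_closedBall_zero_iff]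
      exact hle a (Finset.mem_insert_self a s)
    simpa only [Function.update_eq_self] using Complex.norm_le_of_forall_mem_frontier_norm_le
      Metric.isBounded_ball hslice.diffContOnCl hfrontier hmem

theorem norm_le_of_forall_norm_eq_prod {f : (ι → ℂ) × (κ → ℂ) → F} (hf : Differentiable ℂ f)
    {r : ι → ℝ} (hr : ∀ i, 0 < r i) {s : κ → ℝ} (hs : ∀ j, 0 < s j) {C : ℝ}
    (hC : ∀ u w, (∀ i, ‖u i‖ = r i) → (∀ j, ‖w j‖ = s j) → ‖f (u, w)‖ ≤ C) {u : ι → ℂ}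
    {w : κ → ℂ} (hu : ∀ i, ‖u i‖ ≤ r i) (hw : ∀ j, ‖w j‖ ≤ s j) : ‖f (u, w)‖ ≤ C := by
  cases nonempty_fintype ι
  cases nonempty_fintype κ
  have hleft (w : κ → ℂ) : Differentiable ℂ fun u => f (u, w) :=
    hf.comp (differentiable_id.prodMk (differentiable_const w))
  have hright (u : ι → ℂ) : Differentiable ℂ fun w => f (u, w) :=
    hf.comp ((differentiable_const u).prodMk differentiable_id)
  exact norm_le_of_forall_norm_eq (hleft w) hr
    (fun u hu => norm_le_of_forall_norm_eq (hright u) hs (hC u · hu) hw) hu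

end MaximumModulus

theorem equicontinuousAt_of_forall_norm_le {ι E F : Type*} [NormedAddCommGroup E]
    [NormedSpace ℂ E] [NormedAddCommGroup F] [NormedSpace ℂ F] {f : ι → E → F} {p : E} {r C : ℝ}
    (hr : 0 < r) (hf : ∀ i, DifferentiableOn ℂ (f i) (Metric.ball p r))
    (hC : ∀ i, ∀ q ∈ Metric.ball p r, ‖f i q‖ ≤ C) : EquicontinuousAt f p := by
  have hmodulus : Tendsto (fun q => (C + C) / r * dist q p) (𝓝 p) (𝓝 0) :=
    (by fun_prop : Continuous fun q => (C + C) / r * dist q p).tendsto' p 0 (by simp)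
  refine Metric.equicontinuousAt_of_continuity_modulus _ hmodulus f ?_
  filter_upwards [Metric.ball_mem_nhds p hr] with q hq i
  have hmaps : Set.MapsTo (f i) (Metric.ball p r) (Metric.closedBall (f i p) (C + C)) :=
    fun q hq => (dist_le_norm_add_norm _ _).trans
      (add_le_add (hC i q hq) (hC i p (Metric.mem_ball_self hr)))
  rw [dist_comm]
  exact Complex.dist_le_div_mul_dist_of_mapsTo_ball (hf i) hmaps hq

theorem exists_tendsto_of_equicontinuousAt {ι X α : Type*} [TopologicalSpace X]
    [PseudoMetricSpace α] [CompleteSpace α] {l : Filter ι} [l.NeBot] {f : ι → X → α} {g : X → α}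
    {s : Set X} {x : X} (hf : EquicontinuousAt f x)
    (hg : ∀ y ∈ s, Tendsto (fun i => f i y) l (𝓝 (g y))) (hx : x ∈ closure s) :
    ∃ a, Tendsto g (𝓝[s] x) (𝓝 a) ∧ Tendsto (fun i => f i x) l (𝓝 a) := by
  have := mem_closure_iff_nhdsWithin_neBot.1 hx
  have hcauchy : Cauchy (map g (𝓝[s] x)) := by
    refine Metric.cauchy_iff.2 ⟨inferInstance, fun ε hε => ?_⟩
    have hnear : {y | y ∈ s ∧ ∀ i, dist (f i x) (f i y) < ε / 3} ∈ 𝓝[s] x :=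
      inter_mem self_mem_nhdsWithin (mem_nhdsWithin_of_mem_nhds
        (Metric.equicontinuousAt_iff_right.1 hf (ε / 3) (by positivity)))
    refine ⟨_, image_mem_map hnear, ?_⟩
    rintro _ ⟨y, ⟨hys, hy⟩, rfl⟩ _ ⟨y', ⟨hys', hy'⟩, rfl⟩
    have hle : dist (g y) (g y') ≤ ε / 3 + ε / 3 :=
      le_of_tendsto ((hg y hys).dist (hg y' hys')) <| Eventually.of_forall fun i =>
        (dist_triangle_left _ _ (f i x)).trans (add_le_add (hy i).le (hy' i).le)
    linarith
  obtain ⟨a, ha⟩ := CompleteSpace.complete hcauchy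
  exact ⟨a, ha, hf.tendsto_of_mem_closure ha hg hx⟩

theorem dense_setOfPred_injective (ι : Type*) [Finite ι] :
    Dense {u : ι → ℂ | Function.Injective u} := by
  have := Fintype.ofFinite ι
  have hinter : {u : ι → ℂ | Function.Injective u} =
      ⋂ q : {q : ι × ι // q.1 ≠ q.2}, {u | u q.1.1 ≠ u q.1.2} := by
    ext u
    simp only [Set.mem_ofPred_eq, Set.mem_iInter, Subtype.forall, Prod.forall]
    exact ⟨fun hu i j hij => hu.ne hij, fun hu i j => not_imp_not.1 (hu i j)⟩
  rw [hinter]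
  refine dense_iInter_of_isOpen
    (fun q => isOpen_ne_fun (continuous_apply _) (continuous_apply _)) fun ⟨⟨i, j⟩, hij⟩ => ?_
  classical
  let H : Submodule ℂ (ι → ℂ) :=
    LinearMap.eqLocus (LinearMap.proj i) (LinearMap.proj j)
  have hH : H ≠ ⊤ := fun htop => by
    have hmem : Pi.single i (1 : ℂ) ∈ H := htop ▸ Submodule.mem_top
    simp [H, LinearMap.mem_eqLocus, hij.symm] at hmem
  have hinterior : interior (H : Set (ι → ℂ)) = ∅ := by
    by_contra hne
    exact hH (H.eq_top_of_nonempty_interior' (Set.nonempty_iff_ne_empty.2 hne))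
  exact interior_eq_empty_iff_dense_compl.1 hinterior

theorem dense_nondegeneratePairs (k : ℕ) : Dense (nondegeneratePairs k) :=
  (dense_setOfPred_injective (Fin k)).prod (dense_setOfPred_injective (Fin k))

/-! ### The limit at the edge -/

section EdgeLimit

variable {k : ℕ}

theorem one_le_norm_det_vandermonde {r : ℝ} {u : Fin k → ℂ} (hu : ∀ i, ‖u i‖ = r + i) :
    1 ≤ ‖(Matrix.vandermonde u).det‖ := by
  simp only [Matrix.det_vandermonde, norm_prod]
  refine Finset.univ.one_le_prod fun i _ => (Finset.Ioi i).one_le_prod fun j hj => ?_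
  have hij : (i : ℝ) + 1 ≤ j := by exact_mod_cast Finset.mem_Ioi.1 hj
  have hsub := norm_sub_norm_le (u j) (u i)
  rw [hu, hu] at hsub
  linarith

theorem norm_edgeCorrelation_le {z : ℂ} (hz : ‖z‖ = 1) {N : ℕ} (hN : N ≠ 0) {r C : ℝ}
    (hC : ∀ a b : ℂ, ‖a‖ ≤ r + k → ‖b‖ ≤ r + k → ‖edgeKernel (k - 1) N a b‖ ≤ C)
    (hr : r + k < Real.sqrt N) {u w : Fin k → ℂ} (hu : ∀ i, ‖u i‖ = r + i)
    (hw : ∀ i, ‖w i‖ = r + i) :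
    ‖edgeCorrelation z N u w‖ ≤ ‖edgeConstant k N‖ * (k.factorial * C ^ k) := by
  have hrk (i : Fin k) : r + i ≤ r + k := by
    have hik : (i : ℝ) ≤ k := Nat.cast_le.2 i.2.le
    linarith
  have hw0 (j : Fin k) : w j ≠ (Real.sqrt N : ℂ) := by
    intro hj
    have hnorm := hw j
    rw [hj, Complex.norm_real, Real.norm_of_nonneg (Real.sqrt_nonneg _)] at hnorm
    linarith [hrk j]
  have hinj : Function.Injective w := fun a b hab => by
    have hnorm := hw a
    rw [hab, hw, add_right_inj, Nat.cast_inj] at hnorm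
    exact Fin.ext hnorm.symm
  have hdet : ‖(Matrix.of fun i j => edgeKernel (k - 1) N (u i) (w j)).det‖ ≤
      k.factorial * C ^ k := by
    have hle := Matrix.det_le (abv := NormedField.toAbsoluteValue ℂ)
      (A := Matrix.of fun i j => edgeKernel (k - 1) N (u i) (w j)) fun i j =>
        hC (u i) (w j) ((hu i).trans_le (hrk i)) ((hw j).trans_le (hrk j))
    rwa [Fintype.card_fin, nsmul_eq_mul] at hle
  calc ‖edgeCorrelation z N u w‖
      ≤ ‖edgeCorrelation z N u w‖ *
          (‖(Matrix.vandermonde u).det‖ * ‖(Matrix.vandermonde w).det‖) :=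
        le_mul_of_one_le_right (norm_nonneg _) (one_le_mul_of_one_le_of_one_le
          (one_le_norm_det_vandermonde hu) (one_le_norm_det_vandermonde hw))
    _ = ‖edgeConstant k N‖ *
          ‖(Matrix.of fun i j => edgeKernel (k - 1) N (u i) (w j)).det‖ := by
        rw [← norm_mul, ← norm_mul, edgeCorrelation_mul_vandermonde hz hN u hinj hw0, norm_mul]
    _ ≤ _ := mul_le_mul_of_nonneg_left hdet (norm_nonneg _)

theorem eventually_norm_edgeCorrelation_le {z : ℂ} (hz : ‖z‖ = 1) (k : ℕ) {R : ℝ} (hR : 0 < R) :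
    ∃ C : ℝ, ∀ᶠ N in atTop, ∀ u w : Fin k → ℂ, (∀ i, ‖u i‖ ≤ R) → (∀ i, ‖w i‖ ≤ R) →
      ‖edgeCorrelation z N u w‖ ≤ C := by
  obtain ⟨C, hC⟩ := exists_norm_edgeKernel_le (k - 1) (R + k)
  refine ⟨2 * (k.factorial * (max C 0) ^ k), ?_⟩
  have hconstant : ∀ᶠ N in atTop, ‖edgeConstant k N‖ < 2 :=
    (tendsto_edgeConstant k).norm.eventually_lt_const (by simp)
  filter_upwards [eventually_le_sqrt_natCast ((k - 1 : ℕ) + 1),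
    eventually_le_sqrt_natCast (R + k + 1), hconstant, eventually_ne_atTop 0]
    with N hkN hRN hconstantN hN u w hu hw
  have hradius (i : Fin k) : R ≤ R + i := le_add_of_nonneg_right (Nat.cast_nonneg _)
  refine norm_le_of_forall_norm_eq_prod (differentiable_edgeCorrelation z N)
    (fun i => hR.trans_le (hradius i)) (fun i => hR.trans_le (hradius i)) (fun u w hu hw => ?_)
    (fun i => (hu i).trans (hradius i)) fun i => (hw i).trans (hradius i)
  have hkernel (a b : ℂ) (ha : ‖a‖ ≤ R + k) (hb : ‖b‖ ≤ R + k) :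
      ‖edgeKernel (k - 1) N a b‖ ≤ max C 0 := (hC N hkN a b ha hb).trans (le_max_left _ _)
  exact (norm_edgeCorrelation_le hz hN hkernel (by linarith) hu hw).trans
    (mul_le_mul_of_nonneg_right hconstantN.le (by positivity))

theorem exists_equicontinuousAt_edgeCorrelation {z : ℂ} (hz : ‖z‖ = 1)
    (p : (Fin k → ℂ) × (Fin k → ℂ)) :
    ∃ N₀, EquicontinuousAt (fun N (q : (Fin k → ℂ) × (Fin k → ℂ)) =>
      edgeCorrelation z (N + N₀) q.1 q.2) p := by
  obtain ⟨C, hC⟩ := eventually_norm_edgeCorrelation_le hz k (R := ‖p‖ + 1) (by positivity)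
  obtain ⟨N₀, hN₀⟩ := eventually_atTop.1 hC
  refine ⟨N₀, equicontinuousAt_of_forall_norm_le (C := C) one_pos
    (fun N => (differentiable_edgeCorrelation z (N + N₀)).differentiableOn) fun N q hq => ?_⟩
  have hq' : ‖q‖ ≤ ‖p‖ + 1 := (norm_lt_of_mem_ball hq).le
  exact hN₀ _ (Nat.le_add_left _ _) _ _
    (fun i => ((norm_le_pi_norm q.1 i).trans (norm_fst_le q)).trans hq')
    fun i => ((norm_le_pi_norm q.2 i).trans (norm_snd_le q)).trans hq'

/-- The limit of `edgeCorrelation` at nondegenerate `u` and `w`; a junk value `0` if `u` or `w` has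
repeated entries. -/
noncomputable def edgeLimit (u w : Fin k → ℂ) : ℂ :=
  (Matrix.of fun i j => edgeLimitKernel (u i) (w j)).det /
    ((Matrix.vandermonde u).det * (Matrix.vandermonde w).det)

theorem tendsto_edgeCorrelation_of_injective {z : ℂ} (hz : ‖z‖ = 1) {u w : Fin k → ℂ}
    (hu : Function.Injective u) (hw : Function.Injective w) :
    Tendsto (fun N => edgeCorrelation z N u w) atTop (𝓝 (edgeLimit u w)) := by
  have hvandermonde : (Matrix.vandermonde u).det * (Matrix.vandermonde w).det ≠ 0 :=
    mul_ne_zero (Matrix.det_vandermonde_ne_zero_iff.2 hu) (Matrix.det_vandermonde_ne_zero_iff.2 hw)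
  have hdet : Tendsto (fun N => (Matrix.of fun i j => edgeKernel (k - 1) N (u i) (w j)).det) atTop
      (𝓝 (Matrix.of fun i j => edgeLimitKernel (u i) (w j)).det) := by
    simp only [Matrix.det_apply']
    exact tendsto_finsetSum _ fun σ _ => Tendsto.const_mul _ <|
      tendsto_finsetProd _ fun i _ => tendsto_edgeKernel _ _ _
  rw [edgeLimit, ← one_mul (Matrix.det _)]
  refine (((tendsto_edgeConstant k).mul hdet).div_const _).congr' ?_
  filter_upwards [eventually_le_sqrt_natCast (‖w‖ + 1), eventually_ne_atTop 0] with N hwN hN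
  refine (eq_div_of_mul_eq hvandermonde
    (edgeCorrelation_mul_vandermonde hz hN u hw fun j hj => ?_)).symm
  have hle := norm_le_pi_norm w j
  rw [hj, Complex.norm_real, Real.norm_of_nonneg (Real.sqrt_nonneg _)] at hle
  linarith

theorem exists_tendsto_edgeCorrelation {z : ℂ} (hz : ‖z‖ = 1) (u w : Fin k → ℂ) :
    ∃ a, Tendsto (fun p : (Fin k → ℂ) × (Fin k → ℂ) => edgeLimit p.1 p.2)
        (𝓝[nondegeneratePairs k] (u, w)) (𝓝 a) ∧
      Tendsto (fun N => edgeCorrelation z N u w) atTop (𝓝 a) := by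
  obtain ⟨N₀, hN₀⟩ := exists_equicontinuousAt_edgeCorrelation hz (u, w)
  obtain ⟨a, hlimit, hcorrelation⟩ := exists_tendsto_of_equicontinuousAt hN₀
    (fun p hp => (tendsto_add_atTop_iff_nat N₀).2
      (tendsto_edgeCorrelation_of_injective hz hp.1 hp.2))
    (dense_nondegeneratePairs k (u, w))
  exact ⟨a, hlimit, (tendsto_add_atTop_iff_nat N₀).1 hcorrelation⟩

end EdgeLimit

/-! ### Andréief's identity and the Karlin–McGregor integral -/

section Andreief

variable {α n : Type*} [Fintype n]

theorem integrable_prod_mul [MeasurableSpace α] {μ : Measure α} [SigmaFinite μ] {f g : n → α → ℂ}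
    (hfg : ∀ i j, Integrable (fun a => f i a * g j a) μ) (σ τ : n → n) :
    Integrable (fun s : n → α => ∏ i, f (σ i) (s i) * g (τ i) (s i)) (Measure.pi fun _ => μ) :=
  Integrable.fintype_prod (f := fun i a => f (σ i) a * g (τ i) a) fun _ => hfg _ _

variable [DecidableEq n]

theorem det_mul_det_eq_sum (f g : n → α → ℂ) (s : n → α) :
    (Matrix.of fun i j => f i (s j)).det * (Matrix.of fun i j => g j (s i)).det =
      ∑ τ : Equiv.Perm n, ((Equiv.Perm.sign τ : ℤ) : ℂ) * ∑ σ : Equiv.Perm n,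
        ((Equiv.Perm.sign σ : ℤ) : ℂ) * ∏ i, f (σ i) (s i) * g (τ i) (s i) := by
  rw [← Matrix.det_transpose (Matrix.of fun i j => g j (s i)), Matrix.det_apply', Matrix.det_apply',
    Finset.sum_mul_sum, Finset.sum_comm]
  simp only [Finset.mul_sum]
  refine Finset.sum_congr rfl fun τ _ => Finset.sum_congr rfl fun σ _ => ?_
  simp only [Matrix.of_apply, Matrix.transpose_apply, Finset.prod_mul_distrib]
  ring

variable [MeasurableSpace α] {μ : Measure α} [SigmaFinite μ] {f g : n → α → ℂ}

theorem integrable_det_mul_det (hfg : ∀ i j, Integrable (fun a => f i a * g j a) μ) :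
    Integrable (fun s : n → α => (Matrix.of fun i j => f i (s j)).det *
      (Matrix.of fun i j => g j (s i)).det) (Measure.pi fun _ => μ) := by
  have hterm (σ τ : Equiv.Perm n) := (integrable_prod_mul hfg σ τ).const_mul
    ((Equiv.Perm.sign σ : ℤ) : ℂ)
  simp only [det_mul_det_eq_sum]
  exact integrable_finsetSum _ fun τ _ => (integrable_finsetSum _ fun σ _ => hterm σ τ).const_mul _

theorem integral_det_mul_det (hfg : ∀ i j, Integrable (fun a => f i a * g j a) μ) :
    ∫ s : n → α, (Matrix.of fun i j => f i (s j)).det *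
      (Matrix.of fun i j => g j (s i)).det ∂(Measure.pi fun _ => μ) =
      (Fintype.card n).factorial * (Matrix.of fun i j => ∫ a, f i a * g j a ∂μ).det := by
  have hterm (σ τ : Equiv.Perm n) := (integrable_prod_mul hfg σ τ).const_mul
    ((Equiv.Perm.sign σ : ℤ) : ℂ)
  have hsign (τ : Equiv.Perm n) : ((Equiv.Perm.sign τ : ℤ) : ℂ) * (Equiv.Perm.sign τ : ℤ) = 1 := by
    rw [← Int.cast_mul, ← Units.val_mul, Int.units_mul_self, Units.val_one, Int.cast_one]
  have hperm (τ : Equiv.Perm n) : ∑ σ : Equiv.Perm n, ((Equiv.Perm.sign σ : ℤ) : ℂ) *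
      ∫ s : n → α, ∏ i, f (σ i) (s i) * g (τ i) (s i) ∂(Measure.pi fun _ => μ) =
        (Equiv.Perm.sign τ : ℤ) * (Matrix.of fun i j => ∫ a, f i a * g j a ∂μ).det := by
    rw [← Matrix.det_permute', Matrix.det_apply']
    refine Finset.sum_congr rfl fun σ _ => congrArg _ ?_
    exact integral_fintype_prod_eq_prod (f := fun i a => f (σ i) a * g (τ i) a)
  simp only [det_mul_det_eq_sum]
  rw [integral_finsetSum _ fun τ _ => (integrable_finsetSum _ fun σ _ => hterm σ τ).const_mul _]
  simp only [integral_const_mul, integral_finsetSum Finset.univ fun σ _ => hterm σ _,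
    hperm, ← mul_assoc, hsign, one_mul, Finset.sum_const, Finset.card_univ, Fintype.card_perm,
    nsmul_eq_mul]

end Andreief

section KarlinMcGregor

variable {k : ℕ}

theorem brownianDensity_half_mul (u w : ℂ) (s : ℝ) :
    brownianDensity (1 / 2) u s * brownianDensity (1 - 1 / 2) s w =
      (Real.pi : ℂ)⁻¹ * Complex.exp (-2 * (s : ℂ) ^ 2 + 2 * (u + w) * s + -(u ^ 2 + w ^ 2)) := by
  have hsqrt : (Real.sqrt Real.pi : ℂ) * (Real.sqrt Real.pi : ℂ) = (Real.pi : ℂ) := by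
    rw [← Complex.ofReal_mul, Real.mul_self_sqrt Real.pi_pos.le]
  have hhalf : (1 : ℝ) - 1 / 2 = 1 / 2 := by norm_num
  have hvariance : 2 * Real.pi * (1 / 2) = Real.pi := by ring
  have hdenominator : (2 : ℂ) * ((1 / 2 : ℝ) : ℂ) = 1 := by norm_num
  rw [brownianDensity, brownianDensity, hhalf, hvariance, hdenominator, mul_mul_mul_comm,
    ← Complex.exp_add, one_div, ← mul_inv, hsqrt]
  congr 2
  ring

theorem integrable_brownianDensity_half_mul (u w : ℂ) :
    Integrable fun s : ℝ => brownianDensity (1 / 2) u s * brownianDensity (1 - 1 / 2) s w := by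
  simp only [brownianDensity_half_mul]
  exact (integrable_cexp_quadratic (by norm_num) _ _).const_mul _

theorem volume_restrict_setOfPred_forall_mem {ι : Type*} [Fintype ι] (E : Set ℝ) :
    (volume : Measure (ι → ℝ)).restrict {s | ∀ i, s i ∈ E} =
      Measure.pi fun _ => (volume : Measure ℝ).restrict E := by
  rw [← Measure.restrict_pi_pi, ← volume_pi]
  congr 1
  ext s
  simp only [Set.mem_ofPred_eq, Set.mem_univ_pi]

theorem integrableOn_karlinMcGregorIntegrand_half (u w : Fin k → ℂ) (E : Set ℝ) :
    IntegrableOn (karlinMcGregorIntegrand (1 / 2) u w) {s : Fin k → ℝ | ∀ i, s i ∈ E} := by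
  rw [IntegrableOn, volume_restrict_setOfPred_forall_mem]
  exact integrable_det_mul_det (f := fun i (s : ℝ) => brownianDensity (1 / 2) (u i) s)
    (g := fun j (s : ℝ) => brownianDensity (1 - 1 / 2) s (w j)) fun i j =>
      (integrable_brownianDensity_half_mul (u i) (w j)).integrableOn

theorem karlinMcGregor_half (u w : Fin k → ℂ) (E : Set ℝ) :
    karlinMcGregor (1 / 2) u w E = k.factorial * (Matrix.of fun i j =>
      ∫ s in E, brownianDensity (1 / 2) (u i) s * brownianDensity (1 - 1 / 2) s (w j)).det := by
  have handreief := integral_det_mul_det (μ := (volume : Measure ℝ).restrict E)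
    (f := fun i (s : ℝ) => brownianDensity (1 / 2) (u i) s)
    (g := fun j (s : ℝ) => brownianDensity (1 - 1 / 2) s (w j)) fun i j =>
      (integrable_brownianDensity_half_mul (u i) (w j)).integrableOn
  rw [Fintype.card_fin] at handreief
  rw [karlinMcGregor, volume_restrict_setOfPred_forall_mem, ← handreief]
  rfl

theorem edgeLimitKernel_eq (u w : ℂ) : edgeLimitKernel u w = 2 * Real.pi *
    ∫ s in Set.Ioi (0 : ℝ), brownianDensity (1 / 2) u s * brownianDensity (1 - 1 / 2) s w := by
  have hpi : (Real.pi : ℂ) ≠ 0 := Complex.ofReal_ne_zero.2 Real.pi_ne_zero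
  have hsubst : ∫ t in Set.Ioi (0 : ℝ), Complex.exp (u * w - (t - (u + w)) ^ 2 / 2) =
      2 * ∫ s in Set.Ioi (0 : ℝ),
        Complex.exp (u * w - (((2 * s : ℝ) : ℂ) - (u + w)) ^ 2 / 2) := by
    have hscaling := integral_comp_mul_left_Ioi
      (fun t : ℝ => Complex.exp (u * w - (t - (u + w)) ^ 2 / 2)) 0 two_pos
    rw [mul_zero, Complex.real_smul, Complex.ofReal_inv, Complex.ofReal_ofNat] at hscaling
    rw [hscaling, mul_inv_cancel_left₀ two_ne_zero]
  rw [edgeLimitKernel, hsubst, mul_left_comm, mul_assoc]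
  congr 1
  rw [← integral_const_mul, ← integral_const_mul]
  refine setIntegral_congr_fun measurableSet_Ioi fun s _ => ?_
  simp only [brownianDensity_half_mul]
  rw [mul_inv_cancel_left₀ hpi, ← Complex.exp_add]
  congr 1
  push_cast
  ring

theorem two_pi_pow_div_factorial_ne_zero (k : ℕ) :
    (2 * (Real.pi : ℂ)) ^ k / (k.factorial : ℂ) ≠ 0 :=
  div_ne_zero (pow_ne_zero _ (mul_ne_zero two_ne_zero (Complex.ofReal_ne_zero.2 Real.pi_ne_zero)))
    (Nat.cast_ne_zero.2 k.factorial_ne_zero)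

theorem det_edgeLimitKernel (u w : Fin k → ℂ) :
    (Matrix.of fun i j => edgeLimitKernel (u i) (w j)).det =
      (2 * (Real.pi : ℂ)) ^ k / (k.factorial : ℂ) *
        karlinMcGregor (1 / 2) u w (Set.Ioi 0) := by
  have hfactorial : (k.factorial : ℂ) ≠ 0 := Nat.cast_ne_zero.2 k.factorial_ne_zero
  have hsmul : (Matrix.of fun i j => edgeLimitKernel (u i) (w j)) = (2 * (Real.pi : ℂ)) •
      Matrix.of fun i j => ∫ s in Set.Ioi (0 : ℝ),
        brownianDensity (1 / 2) (u i) s * brownianDensity (1 - 1 / 2) s (w j) := by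
    ext i j
    simp only [Matrix.of_apply, Matrix.smul_apply, edgeLimitKernel_eq, smul_eq_mul]
  rw [hsmul, Matrix.det_smul, Fintype.card_fin, karlinMcGregor_half, ← mul_assoc,
    div_mul_cancel₀ _ hfactorial]

theorem edgeLimit_conj (u v : Fin k → ℂ) :
    edgeLimit u (fun j => conj (v j)) =
      (2 * (Real.pi : ℂ)) ^ k / (k.factorial : ℂ) * edgeRatio u v := by
  rw [edgeLimit, edgeRatio, det_edgeLimitKernel, mul_div_assoc, Matrix.det_vandermonde,
    Matrix.det_vandermonde]
  simp only [← Finset.prod_mul_distrib]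

end KarlinMcGregor

section EdgeF

variable {k : ℕ}

theorem tendsto_edgeRatio_of_tendsto_edgeLimit {u v : Fin k → ℂ} {a : ℂ}
    (ha : Tendsto (fun p : (Fin k → ℂ) × (Fin k → ℂ) => edgeLimit p.1 p.2)
      (𝓝[nondegeneratePairs k] (u, fun j => conj (v j))) (𝓝 a)) :
    Tendsto (fun p : (Fin k → ℂ) × (Fin k → ℂ) => edgeRatio p.1 p.2)
      (𝓝[nondegeneratePairs k] (u, v))
      (𝓝 (((2 * (Real.pi : ℂ)) ^ k / (k.factorial : ℂ))⁻¹ * a)) := by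
  have hcontinuous : Continuous fun p : (Fin k → ℂ) × (Fin k → ℂ) =>
      ((p.1, fun j => conj (p.2 j)) : (Fin k → ℂ) × (Fin k → ℂ)) := by fun_prop
  have hmaps : Set.MapsTo (fun p : (Fin k → ℂ) × (Fin k → ℂ) => (p.1, fun j => conj (p.2 j)))
      (nondegeneratePairs k) (nondegeneratePairs k) :=
    fun p hp => ⟨hp.1, (starRingEnd ℂ).injective.comp hp.2⟩
  refine ((ha.comp (hcontinuous.continuousWithinAt.tendsto_nhdsWithin hmaps)).const_mul _).congr
    fun p => ?_
  rw [Function.comp_apply, edgeLimit_conj,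
    inv_mul_cancel_left₀ (two_pi_pow_div_factorial_ne_zero k)]

theorem edgeF_eq_of_tendsto {u v : Fin k → ℂ} {a : ℂ}
    (hratio : Tendsto (fun p : (Fin k → ℂ) × (Fin k → ℂ) => edgeRatio p.1 p.2)
      (𝓝[nondegeneratePairs k] (u, v)) (𝓝 a))
    (hnondegenerate : (u, v) ∈ nondegeneratePairs k → edgeRatio u v = a) : edgeF u v = a := by
  rw [edgeF]
  split_ifs with h
  · exact hnondegenerate h
  · have := mem_closure_iff_nhdsWithin_neBot.1 (dense_nondegeneratePairs k (u, v))
    exact hratio.limUnder_eq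

theorem tendsto_edgeCorrelation_and_edgeRatio {z : ℂ} (hz : ‖z‖ = 1) (u v : Fin k → ℂ) :
    Tendsto (fun N => edgeCorrelation z N u fun j => conj (v j)) atTop
        (𝓝 ((2 * (Real.pi : ℂ)) ^ k / (k.factorial : ℂ) * edgeF u v)) ∧
      Tendsto (fun p : (Fin k → ℂ) × (Fin k → ℂ) => edgeRatio p.1 p.2)
        (𝓝[nondegeneratePairs k] (u, v)) (𝓝 (edgeF u v)) := by
  have hc := two_pi_pow_div_factorial_ne_zero k
  obtain ⟨a, hlimit, hcorrelation⟩ :=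
    exists_tendsto_edgeCorrelation hz u fun j => conj (v j)
  have hratio := tendsto_edgeRatio_of_tendsto_edgeLimit hlimit
  have hedgeF : edgeF u v = ((2 * (Real.pi : ℂ)) ^ k / (k.factorial : ℂ))⁻¹ * a := by
    refine edgeF_eq_of_tendsto hratio fun h => ?_
    have hvalue := tendsto_nhds_unique hcorrelation (tendsto_edgeCorrelation_of_injective hz h.1
      ((starRingEnd ℂ).injective.comp h.2))
    rw [hvalue, eq_inv_mul_iff_mul_eq₀ hc]
    exact (edgeLimit_conj u v).symm
  rw [hedgeF, mul_inv_cancel_left₀ hc]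
  exact ⟨hcorrelation, hratio⟩

end EdgeF

theorem exists_forall_eq_mul_one_add {ι : Type*} {l : Filter ι} {f g : ι → ℂ} {c : ℂ} (hc : c ≠ 0)
    (hg : ∀ i, g i ≠ 0) (hlim : Tendsto (fun i => f i / g i) l (𝓝 c)) :
    ∃ ε : ι → ℂ, Tendsto ε l (𝓝 0) ∧ ∀ i, f i = g i * c * (1 + ε i) := by
  refine ⟨fun i => f i / g i / c - 1, ?_, fun i => ?_⟩
  · simpa only [div_self hc, sub_self] using (hlim.div_const c).sub_const 1
  · rw [add_sub_cancel, div_div, mul_div_cancel₀ _ (mul_ne_zero (hg i) hc)]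

theorem mainTheorem6 (k : ℕ) (z : ℂ) (hz : ‖z‖ = 1) (u v : Fin k → ℂ) :
    (∀ N : ℕ, Integrable
      (charPolyProduct N (fun j => edgePoint z N (u j)) (fun j => edgePoint z N (v j)))
      (gaussianEntries N)) ∧
    IntegrableOn (karlinMcGregorIntegrand (1 / 2) u (fun j => conj (v j)))
      {s : Fin k → ℝ | ∀ i, s i ∈ Set.Ioi (0 : ℝ)} ∧
    Tendsto (fun p : (Fin k → ℂ) × (Fin k → ℂ) => edgeRatio p.1 p.2)
      (𝓝[nondegeneratePairs k] (u, v)) (𝓝 (edgeF u v)) ∧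
    Tendsto
      (fun N : ℕ =>
        charPolyCorrelation N (fun j => edgePoint z N (u j)) (fun j => edgePoint z N (v j)) /
          edgePrefactor N u v)
      atTop (𝓝 ((2 * (Real.pi : ℂ)) ^ k / (k.factorial : ℂ) * edgeF u v)) ∧
    (edgeF u v ≠ 0 →
      ∃ ε : ℕ → ℂ, Tendsto ε atTop (𝓝 0) ∧ ∀ N : ℕ,
        charPolyCorrelation N (fun j => edgePoint z N (u j)) (fun j => edgePoint z N (v j)) =
          edgePrefactor N u v * ((2 * (Real.pi : ℂ)) ^ k / (k.factorial : ℂ)) * edgeF u v *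
            (1 + ε N)) := by
  have hprefactor (N : ℕ) : edgePrefactor N u v ≠ 0 := Complex.exp_ne_zero _
  obtain ⟨hcorrelation, hratio⟩ := tendsto_edgeCorrelation_and_edgeRatio hz u v
  have hlim : Tendsto (fun N : ℕ =>
      charPolyCorrelation N (fun j => edgePoint z N (u j)) (fun j => edgePoint z N (v j)) /
        edgePrefactor N u v) atTop
      (𝓝 ((2 * (Real.pi : ℂ)) ^ k / (k.factorial : ℂ) * edgeF u v)) := by
    refine hcorrelation.congr' ?_
    filter_upwards [eventually_ne_atTop 0] with N hN
    rw [charPolyCorrelation_edgePoint hz hN, mul_div_cancel_left₀ _ (hprefactor N)]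
  refine ⟨fun N => integrable_charPolyProduct N _ _,
    integrableOn_karlinMcGregorIntegrand_half _ _ _, hratio, hlim, fun hF => ?_⟩
  simpa only [mul_assoc] using exists_forall_eq_mul_one_add
    (mul_ne_zero (two_pi_pow_div_factorial_ne_zero k) hF) hprefactor hlim
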